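/- Let $d\ge 2$ and let $\Omega\subset\mathbb R^d$ be a uniformly convex domain, i.e. a compact convex set with non-empty interior for which there is $c>0$ such that for all $x,y\in\Omega$ the closed ball with centre $\frac{x+y}{2}$ and radius $c|x-y|^2$ is contained in $\Omega$ (the curvatures of $\partial\Omega$ are bounded from below by a positive constant, no smoothness of $\partial\Omega$ being required). Let $\|\cdot\|$ be a strictly convex norm on $\mathbb R^d$, and assume (UA) either $d=2$, or $d\ge 2$ and $\|\cdot\|$ is the Euclidean norm $|\cdot|$. Let $1\le p\le 2$ and let $f^+,f^-$ be two finite positive Borel measures with $f^+(\mathbb R^d)=f^-(\mathbb R^d)$ that belong to $L^p(\partial\Omega)$, i.e. that have $L^p$ densities with respect to the Hausdorff measure $\mathcal H^{d-1}$ restricted to $\partial\Omega$. For a positive measure $\gamma$ with marginals $f^+$ and $f^-$ that minimizes $\int\|x-y\|\,\mathrm d\gamma(x,y)$ among all such measures (an optimal transport plan), let $\sigma_\gamma$ be the measure on $\Omega$ defined by $$\int_\Omega\varphi\,\mathrm d\sigma_\gamma=\int\Big(\int_0^1\varphi\big((1-t)x+ty\big)\,\|x-y\|\,\mathrm dt\Big)\mathrm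 d\gamma(x,y)\qquad\text{for all }\varphi\in C(\Omega).$$ Then an optimal transport plan $\gamma$ exists, the measure $\sigma=\sigma_\gamma$ (the transport density between $f^+$ and $f^-$) does not depend on the choice of the optimal plan $\gamma$, and $\sigma\in L^p(\Omega)$, i.e. $\sigma$ has an $L^p$ density with respect to the Lebesgue measure on $\Omega$. -/

import Mathlib

open MeasureTheory Set

/-- A uniformly convex (compact) domain of `ℝ^d`: a compact convex set with non-empty interior
for which there is `c > 0` such that, for all `x, y ∈ Ω`, the closed ball centred at the midpoint
of `x` and `y` with radius `c ‖x - y‖ ^ 2` is contained in `Ω`. This is the usual quadratic uniform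
convexity of a set, which expresses, without any smoothness requirement on the boundary, that the
curvatures of `∂Ω` are bounded from below by a positive constant. -/
structure IsUniformlyConvexDomain {d : ℕ} (Ω : Set (EuclideanSpace ℝ (Fin d))) : Prop where
  isCompact : IsCompact Ω
  convex : Convex ℝ Ω
  nonempty_interior : (interior Ω).Nonempty
  uniformlyConvex : ∃ c : ℝ, 0 < c ∧ ∀ x ∈ Ω, ∀ y ∈ Ω,
    Metric.closedBall (midpoint ℝ x y) (c * ‖x - y‖ ^ 2) ⊆ Ω

/-- The seminorm `N` on `ℝ^d` is a strictly convex norm. -/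
structure IsStrictlyConvexNorm {d : ℕ} (N : Seminorm ℝ (EuclideanSpace ℝ (Fin d))) : Prop where
  eq_zero_of_map_eq_zero : ∀ x, N x = 0 → x = 0
  strictConvex_unitBall : StrictConvex ℝ {x | N x ≤ 1}

/-- A positive measure `μ` belongs to `L^p(m)`: it has a density with respect to the reference
measure `m`, and this density is an `L^p` function. -/
def MeasureMemLp {X : Type*} [MeasurableSpace X] (p : ENNReal) (m μ : Measure X) : Prop :=
  ∃ g : X → ℝ, (∀ x, 0 ≤ g x) ∧ MemLp g p m ∧ μ = m.withDensity (fun x => ENNReal.ofReal (g x))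

/-- The surface measure on the boundary of `Ω`, i.e. the (normalised) `(d-1)`-dimensional
Hausdorff measure restricted to `∂Ω`. -/
noncomputable def boundaryMeasure {d : ℕ} (Ω : Set (EuclideanSpace ℝ (Fin d))) :
    Measure (EuclideanSpace ℝ (Fin d)) :=
  (Measure.euclideanHausdorffMeasure (d - 1)).restrict (frontier Ω)

/-- `γ` is a transport plan from `f₁` to `f₂`: its marginals are `f₁` and `f₂`. (If `f₁`, `f₂` are
concentrated on a closed set `Ω`, then `γ` is automatically concentrated on `Ω × Ω`.) -/
structure IsTransportPlan {X : Type*} [MeasurableSpace X] (f₁ f₂ : Measure X)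
    (γ : Measure (X × X)) : Prop where
  map_fst : γ.map Prod.fst = f₁
  map_snd : γ.map Prod.snd = f₂

/-- The transport cost `∫ N (x - y) dγ(x, y)` of a plan `γ`. -/
noncomputable def transportCost {d : ℕ} (N : Seminorm ℝ (EuclideanSpace ℝ (Fin d)))
    (γ : Measure (EuclideanSpace ℝ (Fin d) × EuclideanSpace ℝ (Fin d))) : ENNReal :=
  ∫⁻ q, ENNReal.ofReal (N (q.1 - q.2)) ∂γ

/-- `γ` is an optimal transport plan from `f₁` to `f₂` for the cost `N (x - y)`. -/
structure IsOptimalPlan {d : ℕ} (N : Seminorm ℝ (EuclideanSpace ℝ (Fin d)))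
    (f₁ f₂ : Measure (EuclideanSpace ℝ (Fin d)))
    (γ : Measure (EuclideanSpace ℝ (Fin d) × EuclideanSpace ℝ (Fin d))) : Prop where
  isTransportPlan : IsTransportPlan f₁ f₂ γ
  cost_le : ∀ γ', IsTransportPlan f₁ f₂ γ' → transportCost N γ ≤ transportCost N γ'

/-- The measure `σ_γ` associated with a plan `γ`:
`∫ φ dσ_γ = ∫ (∫₀¹ φ ((1 - t) x + t y) N (x - y) dt) dγ(x, y)`,
that is, the image of the measure `N (x - y) dγ(x, y) ⊗ dt` on `(ℝ^d × ℝ^d) × [0, 1]` under the map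
`((x, y), t) ↦ (1 - t) x + t y`. -/
noncomputable def planDensity {d : ℕ} (N : Seminorm ℝ (EuclideanSpace ℝ (Fin d)))
    (γ : Measure (EuclideanSpace ℝ (Fin d) × EuclideanSpace ℝ (Fin d))) :
    Measure (EuclideanSpace ℝ (Fin d)) :=
  ((γ.withDensity (fun q => ENNReal.ofReal (N (q.1 - q.2)))).prod
      ((volume : Measure ℝ).restrict (Icc 0 1))).map
    (fun z => (1 - z.2) • z.1.1 + z.2 • z.1.2)

/-- `σ` is a transport density from `f₁` to `f₂`: it is the measure `σ_γ` of an optimal transport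
plan `γ` from `f₁` to `f₂`. -/
def IsTransportDensity {d : ℕ} (N : Seminorm ℝ (EuclideanSpace ℝ (Fin d)))
    (f₁ f₂ σ : Measure (EuclideanSpace ℝ (Fin d))) : Prop :=
  ∃ γ, IsOptimalPlan N f₁ f₂ γ ∧ σ = planDensity N γ

/-!
The transport density is studied through a potential `u`, i.e. a function which is `1`-Lipschitz
for the norm `N`, and through the pairs `(x, y)` of its contact set `u x - u y = N (x - y)`. By
duality a plan that lives on the contact set is optimal, and then every optimal plan lives there
(`contactSet_of_isOptimalPlan`). Such pairs `(x, y)` of distinct boundary points are the transport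
rays. Two strict convexities are at work: that of `N` makes rays that cross or follow each other
aligned, and that of `Ω` forbids three aligned boundary points. Hence rays are disjoint away from
their end-points (`injOn_interp`), and no ray starts where another one ends
(`not_raySet_of_raySet`).

The reference measure on `∂Ω` is the cone measure `κ` with respect to an interior point `a`, which
dominates the surface measure (`boundaryMeasure_le_coneMeasure`, a covering argument). In the polar
coordinates given by the gauge of `Ω` the Lebesgue measure is the product of `κ` with an explicit
law, so that null sets and Jacobians on the non-smooth boundary become statements about Lipschitz
functions on `ℝ^d`, which are differentiable almost everywhere. In this way:

* only a `κ`-null set of points is the beginning of two rays (`coneMeasure_branchSet`): where `∂Ω`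
  and `u` are both differentiable, the tangential derivative of `u` determines the ray. A plan is
  therefore determined off the diagonal by its marginals and `u` (`restrict_offDiag_eq`), which
  gives the uniqueness of the transport density;
* mass sent from `κ` to a single boundary point `y`, at distance at least `ε`, has during the first
  half of its trip a density at most `C / ε ^ 2` (`prod_coneMeasure_preimage_le`). The map involved
  is a rank-one perturbation of a translation, whose determinant measures the angle between the ray
  and the boundary, and uniform convexity bounds it below by `c ε ^ 2`.

For finitely many targets an optimal plan is produced by maximising the finite-dimensional dual
functional (`exists_semidiscrete_plan`), and since the cones over different targets are disjoint,
the bound `C / ε ^ 2` holds for the whole plan. Approximating the target measure and using that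
optimal plans are unique off the diagonal, the bound passes to any optimal plan whose first marginal
is at most `M κ`, in the form `C M / ε ^ 2` (`prod_preimage_le`).

For a first marginal with a density `g`, the rays are sorted according to the dyadic orders of
magnitude of `g x` and of `N (x - y)`. The resulting pieces of the domain are disjoint, and along
the ray from `x` to `y` the first half of the transport density, of which each ray carries the
weight `N (x - y)`, has a density `s ≤ C g(x) / N (x - y)` (`exists_step_bound`). Hence
`∫ s ^ p = ∫ s ^ (p - 1) dσ ≤ C ∫ g(x) ^ (p - 1) N (x - y) ^ (2 - p) dγ`, which for `p ≤ 2` is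
bounded by a multiple of `∫ g ^ p` over `∂Ω`. The second half of the transport density is the first
half of that of the reversed plan.
-/

namespace TransportDensity

open Filter Topology
open scoped ENNReal NNReal Pointwise

variable {d : ℕ}

local notation "𝔼[" d "]" => EuclideanSpace ℝ (Fin d)

/-! ### Strictly convex norms and strictly convex domains -/

section Norm

variable {N : Seminorm ℝ 𝔼[d]}

theorem continuous_seminorm (N : Seminorm ℝ 𝔼[d]) : Continuous N := by
  have h := N.convexOn.continuousOn_interior
  rw [interior_univ] at h
  exact continuousOn_univ.1 h

theorem seminorm_le_mul_norm (N : Seminorm ℝ 𝔼[d]) : ∃ C : ℝ, 0 < C ∧ ∀ x, N x ≤ C * ‖x‖ :=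
  Seminorm.bound_of_continuous_normedSpace N (continuous_seminorm N)

theorem seminorm_pos (hN : IsStrictlyConvexNorm N) {x : 𝔼[d]} (hx : x ≠ 0) : 0 < N x :=
  lt_of_le_of_ne (apply_nonneg N x) fun h => hx (hN.eq_zero_of_map_eq_zero x h.symm)

theorem seminorm_sub_pos (hN : IsStrictlyConvexNorm N) {x y : 𝔼[d]} (hx : x ≠ y) : 0 < N (x - y) :=
  seminorm_pos hN (sub_ne_zero.2 hx)

theorem sameRay_of_seminorm_add_eq (hN : IsStrictlyConvexNorm N) {x y : 𝔼[d]}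
    (h : N (x + y) = N x + N y) : SameRay ℝ x y := by
  by_cases hx : x = 0
  · subst hx; exact SameRay.zero_left y
  by_cases hy : y = 0
  · subst hy; exact SameRay.zero_right x
  have ha := seminorm_pos hN hx
  have hb := seminorm_pos hN hy
  set a := N x
  set b := N y
  have hab : 0 < a + b := by positivity
  have hunit : ∀ {w : 𝔼[d]} {c : ℝ}, 0 < c → N w = c → N (c⁻¹ • w) = 1 := by
    intro w c hc hw
    rw [map_smul_eq_mul, Real.norm_of_nonneg (by positivity), hw, inv_mul_cancel₀ hc.ne']
  by_cases hpq : a⁻¹ • x = b⁻¹ • y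
  · have hy' : y = (b * a⁻¹) • x := by
      rw [mul_smul, hpq, smul_smul, mul_inv_cancel₀ hb.ne', one_smul]
    rw [hy']
    exact SameRay.sameRay_nonneg_smul_right x (by positivity)
  · exfalso
    have hmem := hN.strictConvex_unitBall (x := a⁻¹ • x) (y := b⁻¹ • y) (hunit ha rfl).le
      (hunit hb rfl).le hpq (a := a / (a + b)) (b := b / (a + b)) (by positivity) (by positivity)
      (by field_simp)
    have hw : (a / (a + b)) • a⁻¹ • x + (b / (a + b)) • b⁻¹ • y = (a + b)⁻¹ • (x + y) := by
      rw [smul_smul, smul_smul, smul_add]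
      congr 2 <;> field_simp
    rw [hw] at hmem
    set w := (a + b)⁻¹ • (x + y) with hwdef
    have hNw : N w = 1 := hunit hab h
    -- a point with `N w = 1` is not interior to the unit ball: push it outwards
    have hcont : Tendsto (fun s : ℝ => s • w) (𝓝[>] 1) (𝓝 w) := by
      have : Tendsto (fun s : ℝ => s • w) (𝓝 1) (𝓝 ((1 : ℝ) • w)) :=
        (continuous_id.smul continuous_const).tendsto 1
      rw [one_smul] at this
      exact this.mono_left nhdsWithin_le_nhds
    have hev := hcont.eventually (mem_interior_iff_mem_nhds.1 hmem)
    obtain ⟨s, hs, hs1⟩ := (hev.and self_mem_nhdsWithin).exists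
    have hs1 : (1 : ℝ) < s := hs1
    have hs' : N (s • w) ≤ 1 := hs
    rw [map_smul_eq_mul, hNw, Real.norm_of_nonneg (by linarith)] at hs'
    linarith

end Norm

section Domain

variable {Ω : Set 𝔼[d]}

theorem strictConvex_domain (hΩ : IsUniformlyConvexDomain Ω) : StrictConvex ℝ Ω := by
  obtain ⟨c, hc, hball⟩ := hΩ.uniformlyConvex
  rw [strictConvex_iff_openSegment_subset]
  intro x hx y hy hxy z hz
  have hm : midpoint ℝ x y ∈ interior Ω := by
    refine interior_mono (hball x hx y hy) ?_
    refine Metric.ball_subset_interior_closedBall (Metric.mem_ball_self ?_)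
    have := norm_pos_iff.2 (sub_ne_zero.2 hxy)
    positivity
  obtain ⟨s, t, hs, ht, hst, rfl⟩ := hz
  rcases le_total s t with hle | hle
  · have : s • x + t • y = (2 * s) • midpoint ℝ x y + (t - s) • y := by
      rw [midpoint_eq_smul_add, invOf_eq_inv]; module
    rw [this]
    exact hΩ.convex.combo_interior_self_mem_interior hm hy (by positivity) (by linarith)
      (by linarith)
  · have : s • x + t • y = (2 * t) • midpoint ℝ x y + (s - t) • x := by
      rw [midpoint_eq_smul_add, invOf_eq_inv]; module
    rw [this]
    exact hΩ.convex.combo_interior_self_mem_interior hm hx (by positivity) (by linarith)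
      (by linarith)

theorem frontier_subset_domain (hΩ : IsUniformlyConvexDomain Ω) : frontier Ω ⊆ Ω :=
  hΩ.isCompact.isClosed.frontier_subset

theorem isCompact_frontier_domain (hΩ : IsUniformlyConvexDomain Ω) : IsCompact (frontier Ω) :=
  hΩ.isCompact.of_isClosed_subset isClosed_frontier (frontier_subset_domain hΩ)

theorem mem_interior_of_combo (hΩ : IsUniformlyConvexDomain Ω) {x y : 𝔼[d]} (hx : x ∈ Ω)
    (hy : y ∈ Ω)
    (hxy : x ≠ y) {t : ℝ} (ht : t ∈ Ioo (0 : ℝ) 1) : (1 - t) • x + t • y ∈ interior Ω :=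
  strictConvex_domain hΩ hx hy hxy (by linarith [ht.2]) ht.1 (by ring)

/-- A half-line issued from a point of the domain meets the boundary at most once, apart from its
origin. -/
theorem eq_of_mem_frontier_of_ray (hΩ : IsUniformlyConvexDomain Ω) {z e : 𝔼[d]} (hz : z ∈ Ω)
    {s t : ℝ} (hs : 0 < s) (ht : 0 < t) (hzs : z + s • e ∈ frontier Ω)
    (hzt : z + t • e ∈ frontier Ω) : z + s • e = z + t • e := by
  wlog hst : s ≤ t generalizing s t
  · exact (this ht hs hzt hzs (not_le.1 hst).le).symm
  rcases hst.eq_or_lt with rfl | hlt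
  · rfl
  by_cases he : e = 0
  · simp [he]
  exfalso
  have hint : (1 - s / t) • z + (s / t) • (z + t • e) ∈ interior Ω := by
    refine mem_interior_of_combo hΩ hz (frontier_subset_domain hΩ hzt) ?_
      ⟨by positivity, (div_lt_one ht).2 hlt⟩
    intro h
    have : t • e = 0 := by simpa using h.symm
    exact (smul_ne_zero ht.ne' he) this
  have heq : (1 - s / t) • z + (s / t) • (z + t • e) = z + s • e := by
    rw [smul_add, smul_smul, div_mul_cancel₀ _ ht.ne']; module
  rw [heq] at hint
  exact hzs.2 hint

end Domain

/-! ### Potentials and transport rays -/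

section Rays

/-- The (Kantorovich) potentials for the cost `N (x - y)`: functions that are `1`-Lipschitz for the
norm `N`. -/
def IsPotential (N : Seminorm ℝ 𝔼[d]) (u : 𝔼[d] → ℝ) : Prop := ∀ x y, u x - u y ≤ N (x - y)

/-- The pairs `(x, y)` at which a potential `u` decreases as fast as it can. -/
def contactSet (N : Seminorm ℝ 𝔼[d]) (u : 𝔼[d] → ℝ) : Set (𝔼[d] × 𝔼[d]) :=
  {q | u q.1 - u q.2 = N (q.1 - q.2)}

/-- The non-trivial transport rays of the potential `u`, from a boundary point of `Ω` to another. -/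
def raySet (Ω : Set 𝔼[d]) (N : Seminorm ℝ 𝔼[d]) (u : 𝔼[d] → ℝ) : Set (𝔼[d] × 𝔼[d]) :=
  {q | q.1 ∈ frontier Ω ∧ q.2 ∈ frontier Ω ∧ q.1 ≠ q.2} ∩ contactSet N u

/-- The map `((x, y), t) ↦ (1 - t) x + t y`. -/
def interp (z : (𝔼[d] × 𝔼[d]) × ℝ) : 𝔼[d] := (1 - z.2) • z.1.1 + z.2 • z.1.2

theorem continuous_interp : Continuous (interp (d := d)) := by
  unfold interp; fun_prop

variable {N : Seminorm ℝ 𝔼[d]} {u : 𝔼[d] → ℝ} {Ω : Set 𝔼[d]}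

theorem IsPotential.lipschitzWith (hu : IsPotential N u) : ∃ C : ℝ≥0, LipschitzWith C u := by
  obtain ⟨C, hC, hb⟩ := seminorm_le_mul_norm N
  refine ⟨C.toNNReal, LipschitzWith.of_dist_le_mul fun x y => ?_⟩
  rw [Real.coe_toNNReal _ hC.le, Real.dist_eq, dist_eq_norm]
  refine abs_le.2 ⟨?_, (hu x y).trans (hb _)⟩
  have := (hu y x).trans (hb _)
  rw [norm_sub_rev] at this
  linarith

theorem IsPotential.continuous (hu : IsPotential N u) : Continuous u :=
  hu.lipschitzWith.choose_spec.continuous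

theorem isClosed_contactSet (hu : IsPotential N u) : IsClosed (contactSet N u) := by
  have := hu.continuous
  have h2 := continuous_seminorm N
  exact isClosed_eq (by fun_prop) (by fun_prop)

theorem measurableSet_raySet (hu : IsPotential N u) : MeasurableSet (raySet Ω N u) := by
  refine MeasurableSet.inter ?_ (isClosed_contactSet hu).measurableSet
  refine (measurable_fst isClosed_frontier.measurableSet).inter
    ((measurable_snd isClosed_frontier.measurableSet).inter ?_)
  exact (measurableSet_eq_fun measurable_fst measurable_snd).compl

/-- A potential is affine along a transport ray. -/
theorem potential_sub_interp (hu : IsPotential N u) {x y : 𝔼[d]} (h : (x, y) ∈ contactSet N u)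
    {t : ℝ} (ht : t ∈ Icc (0 : ℝ) 1) :
    u x - u ((1 - t) • x + t • y) = N (x - ((1 - t) • x + t • y)) ∧
    u ((1 - t) • x + t • y) - u y = N ((1 - t) • x + t • y - y) := by
  have h : u x - u y = N (x - y) := h
  have e1 : x - ((1 - t) • x + t • y) = t • (x - y) := by module
  have e2 : (1 - t) • x + t • y - y = (1 - t) • (x - y) := by module
  have h1 := hu x ((1 - t) • x + t • y)
  have h2 := hu ((1 - t) • x + t • y) y
  rw [e1, map_smul_eq_mul, Real.norm_of_nonneg ht.1] at h1 ⊢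
  rw [e2, map_smul_eq_mul, Real.norm_of_nonneg (by linarith [ht.2])] at h2 ⊢
  constructor <;> nlinarith

/-- The end of a transport ray is not the beginning of another one: the two rays would be aligned,
and a strictly convex boundary does not contain three aligned points. -/
theorem not_raySet_of_raySet (hΩ : IsUniformlyConvexDomain Ω) (hN : IsStrictlyConvexNorm N)
    (hu : IsPotential N u) {x y z : 𝔼[d]} (hxy : (x, y) ∈ raySet Ω N u) :
    (y, z) ∉ raySet Ω N u := by
  intro hyz
  obtain ⟨⟨hx, hy, hne⟩, h1⟩ := hxy
  obtain ⟨⟨-, hz, hne'⟩, h2⟩ := hyz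
  simp only at hx hy hz hne hne'
  have h1 : u x - u y = N (x - y) := h1
  have h2 : u y - u z = N (y - z) := h2
  have h3 := hu x z
  have hadd : x - z = (x - y) + (y - z) := by abel
  have hray : SameRay ℝ (x - y) (y - z) := by
    apply sameRay_of_seminorm_add_eq hN
    apply le_antisymm (map_add_le_add _ _ _)
    rw [← hadd]; linarith
  obtain ⟨r, hr, hr'⟩ := hray.exists_pos_left (sub_ne_zero.2 hne) (sub_ne_zero.2 hne')
  have hyI : y ∈ interior Ω := by
    have hxz : x ≠ z := by
      rintro rfl
      have : (r + 1) • (x - y) = 0 := by rw [add_smul, hr']; simp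
      rcases smul_eq_zero.1 this with h | h
      · linarith
      · exact hne (sub_eq_zero.1 h)
    have hh := mem_interior_of_combo hΩ (frontier_subset_domain hΩ hx)
      (frontier_subset_domain hΩ hz) hxz (t := 1 / (1 + r))
      ⟨by positivity, (div_lt_one (by positivity)).2 (by linarith)⟩
    have hz' : z = y - r • (x - y) := by rw [hr']; abel
    have : (1 - 1 / (1 + r)) • x + (1 / (1 + r)) • z = y := by
      have h0 : (1 + r) ≠ 0 := by positivity
      have : x = y + (x - y) := by abel
      rw [hz']
      nth_rewrite 1 [this]
      match_scalars <;> field_simp <;> ring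
    rwa [this] at hh
  exact hy.2 hyI

/-- Transport rays do not meet away from their end-points. -/
theorem injOn_interp (hΩ : IsUniformlyConvexDomain Ω) (hN : IsStrictlyConvexNorm N)
    (hu : IsPotential N u) : InjOn interp (raySet Ω N u ×ˢ Ioo (0 : ℝ) 1) := by
  rintro ⟨⟨x, y⟩, t⟩ ⟨⟨⟨hx, hy, hne⟩, hc⟩, ht⟩ ⟨⟨x', y'⟩, t'⟩ ⟨⟨⟨hx', hy', hne'⟩, hc'⟩, ht'⟩ heq
  simp only [interp] at hx hy hx' hy' hne hne' heq ht ht' hc hc'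
  obtain ⟨h1, h2⟩ := potential_sub_interp hu hc (Ioo_subset_Icc_self ht)
  obtain ⟨h1', h2'⟩ := potential_sub_interp hu hc' (Ioo_subset_Icc_self ht')
  rw [← heq] at h1' h2'
  have hzΩ : (1 - t) • x + t • y ∈ Ω := interior_subset <|
    mem_interior_of_combo hΩ (frontier_subset_domain hΩ hx) (frontier_subset_domain hΩ hy) hne ht
  obtain ⟨z, hzdef⟩ : ∃ z, z = (1 - t) • x + t • y := ⟨_, rfl⟩
  have hzdef' : z = (1 - t') • x' + t' • y' := hzdef.trans heq
  rw [← hzdef] at h1 h2 h1' h2' hzΩ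
  have exz : x - z = t • (x - y) := by rw [hzdef]; module
  have ezy : z - y = (1 - t) • (x - y) := by rw [hzdef]; module
  have exz' : x' - z = t' • (x' - y') := by rw [hzdef']; module
  have ezy' : z - y' = (1 - t') • (x' - y') := by rw [hzdef']; module
  have hray : SameRay ℝ (x - z) (z - y') := by
    apply sameRay_of_seminorm_add_eq hN
    apply le_antisymm (map_add_le_add _ _ _)
    have := hu x y'
    have e : x - z + (z - y') = x - y' := by abel
    rw [e]; linarith
  rw [exz, ezy'] at hray
  obtain ⟨r, hr, hr'⟩ := hray.exists_pos_left (smul_ne_zero ht.1.ne' (sub_ne_zero.2 hne))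
    (smul_ne_zero (by linarith [ht'.2]) (sub_ne_zero.2 hne'))
  have h1t : 0 < 1 - t := by linarith [ht.2]
  have h1t' : 0 < 1 - t' := by linarith [ht'.2]
  -- the two directions are positively proportional
  obtain ⟨lam, hlam, hdir⟩ : ∃ lam : ℝ, 0 < lam ∧ x' - y' = lam • (x - y) := by
    refine ⟨(1 - t')⁻¹ * (r * t), mul_pos (inv_pos.2 h1t') (mul_pos hr ht.1), ?_⟩
    rw [mul_smul, mul_smul, hr', smul_smul, inv_mul_cancel₀ h1t'.ne', one_smul]
  have hxx : x = x' := by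
    have e1 : x = z + t • (x - y) := by rw [← exz]; abel
    have e2 : x' = z + (t' * lam) • (x - y) := by rw [mul_smul, ← hdir, ← exz']; abel
    have := eq_of_mem_frontier_of_ray hΩ hzΩ ht.1 (mul_pos ht'.1 hlam) (e1 ▸ hx) (e2 ▸ hx')
    rw [e1, e2]; exact this
  have hyy : y = y' := by
    have e1 : y = z + (1 - t) • (y - x) := by
      have : y - x = -(x - y) := by abel
      rw [this, smul_neg, ← ezy]; abel
    have e2 : y' = z + ((1 - t') * lam) • (y - x) := by
      have : y - x = -(x - y) := by abel
      rw [this, smul_neg, mul_smul, ← hdir, ← ezy']; abel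
    have := eq_of_mem_frontier_of_ray hΩ hzΩ h1t (mul_pos h1t' hlam) (e1 ▸ hy) (e2 ▸ hy')
    rw [e1, e2]; exact this
  subst hxx hyy
  have : t • (x - y) = t' • (x - y) := by rw [← exz, ← exz']
  have htt : t = t' := smul_left_injective ℝ (sub_ne_zero.2 hne) this
  rw [htt]

end Rays

/-! ### The cone measure on the boundary of a convex domain -/

section Gauge

/-- The gauge (Minkowski functional) of `Ω` seen from the point `a`. -/
noncomputable def gaugeFrom (Ω : Set 𝔼[d]) (a z : 𝔼[d]) : ℝ := gauge ((fun w => a + w) ⁻¹' Ω) z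

/-- The radial projection of the vector `z`, issued from `a`, on the boundary of `Ω`. -/
noncomputable def radial (Ω : Set 𝔼[d]) (a z : 𝔼[d]) : 𝔼[d] := a + (gaugeFrom Ω a z)⁻¹ • z

/-- The cone measure of `Ω` with respect to `a`: the mass of a set `S` of boundary points is the
volume of the cone with apex `a` over `S`. -/
noncomputable def coneMeasure (Ω : Set 𝔼[d]) (a : 𝔼[d]) : Measure 𝔼[d] :=
  (volume.restrict ((fun w => a + w) ⁻¹' Ω)).map (radial Ω a)

/-- The law `d s ^ (d - 1) ds` on `[0, 1]` of the gauge of a uniform random point of a convex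
domain. -/
noncomputable def gaugeLaw (d : ℕ) : Measure ℝ :=
  (volume.restrict (Icc 0 1)).withDensity fun s => ENNReal.ofReal (d * s ^ (d - 1))

variable {Ω : Set 𝔼[d]} {a : 𝔼[d]}

theorem gaugeFrom_nonneg (z : 𝔼[d]) : 0 ≤ gaugeFrom Ω a z := gauge_nonneg z

theorem gaugeFrom_smul {c : ℝ} (hc : 0 ≤ c) (z : 𝔼[d]) :
    gaugeFrom Ω a (c • z) = c * gaugeFrom Ω a z := by
  simp [gaugeFrom, gauge_smul_of_nonneg hc]

theorem radial_smul {c : ℝ} (hc : 0 < c) (z : 𝔼[d]) : radial Ω a (c • z) = radial Ω a z := by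
  simp only [radial, gaugeFrom_smul hc.le, smul_smul]
  congr 2
  field_simp

theorem shift_mem_nhds (ha : a ∈ interior Ω) : (fun w => a + w) ⁻¹' Ω ∈ 𝓝 (0 : 𝔼[d]) := by
  have hc : ContinuousAt (fun w : 𝔼[d] => a + w) 0 := by fun_prop
  apply hc
  simpa using mem_interior_iff_mem_nhds.1 ha

theorem shift_eq_image : (fun w => a + w) ⁻¹' Ω = (fun w => -a + w) '' Ω := by
  ext z
  constructor
  · intro h; exact ⟨a + z, h, by simp⟩
  · rintro ⟨w, hw, rfl⟩; simpa using hw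

theorem isCompact_shift (hΩ : IsUniformlyConvexDomain Ω) :
    IsCompact ((fun w => a + w) ⁻¹' Ω) := by
  rw [shift_eq_image]
  exact hΩ.isCompact.image (by fun_prop)

theorem measurableSet_shift (hΩ : IsUniformlyConvexDomain Ω) :
    MeasurableSet ((fun w => a + w) ⁻¹' Ω) := (isCompact_shift hΩ).isClosed.measurableSet

theorem convex_shift (hΩ : IsUniformlyConvexDomain Ω) : Convex ℝ ((fun w => a + w) ⁻¹' Ω) :=
  hΩ.convex.translate_preimage_right a

theorem continuous_gaugeFrom (hΩ : IsUniformlyConvexDomain Ω) (ha : a ∈ interior Ω) :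
    Continuous (gaugeFrom Ω a) := continuous_gauge (convex_shift hΩ) (shift_mem_nhds ha)

theorem lipschitzWith_gaugeFrom (hΩ : IsUniformlyConvexDomain Ω) (ha : a ∈ interior Ω) :
    ∃ L : ℝ≥0, LipschitzWith L (gaugeFrom Ω a) :=
  (convex_shift hΩ).lipschitz_gauge (shift_mem_nhds ha)

theorem gaugeFrom_eq_zero (hΩ : IsUniformlyConvexDomain Ω) (ha : a ∈ interior Ω) {z : 𝔼[d]} :
    gaugeFrom Ω a z = 0 ↔ z = 0 :=
  gauge_eq_zero (absorbent_nhds_zero (shift_mem_nhds ha))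
    ((isCompact_shift hΩ).totallyBounded.isVonNBounded ℝ)

theorem gaugeFrom_pos (hΩ : IsUniformlyConvexDomain Ω) (ha : a ∈ interior Ω) {z : 𝔼[d]}
    (hz : z ≠ 0) : 0 < gaugeFrom Ω a z :=
  (gaugeFrom_nonneg z).lt_of_ne fun h => hz ((gaugeFrom_eq_zero hΩ ha).1 h.symm)

theorem gaugeFrom_le_one (hΩ : IsUniformlyConvexDomain Ω) (ha : a ∈ interior Ω) {z : 𝔼[d]} :
    gaugeFrom Ω a z ≤ 1 ↔ a + z ∈ Ω := by
  rw [gaugeFrom, gauge_le_one_iff_mem_closure (convex_shift hΩ) (shift_mem_nhds ha),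
    (isCompact_shift hΩ).isClosed.closure_eq]
  rfl

theorem gaugeFrom_eq_one (hΩ : IsUniformlyConvexDomain Ω) (ha : a ∈ interior Ω) {z : 𝔼[d]} :
    gaugeFrom Ω a z = 1 ↔ a + z ∈ frontier Ω := by
  rw [gaugeFrom, gauge_eq_one_iff_mem_frontier (convex_shift hΩ) (shift_mem_nhds ha)]
  have := (Homeomorph.addLeft a).preimage_frontier Ω
  exact (Set.ext_iff.1 this z).symm

theorem gaugeFrom_add_le (hΩ : IsUniformlyConvexDomain Ω) (ha : a ∈ interior Ω) (z w : 𝔼[d]) :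
    gaugeFrom Ω a (z + w) ≤ gaugeFrom Ω a z + gaugeFrom Ω a w :=
  gauge_add_le (convex_shift hΩ) (absorbent_nhds_zero (shift_mem_nhds ha)) z w

theorem gaugeFrom_sub_of_mem_frontier (hΩ : IsUniformlyConvexDomain Ω) (ha : a ∈ interior Ω)
    {x : 𝔼[d]} (hx : x ∈ frontier Ω) : gaugeFrom Ω a (x - a) = 1 :=
  (gaugeFrom_eq_one hΩ ha).2 (by simpa using hx)

theorem radial_mem_frontier (hΩ : IsUniformlyConvexDomain Ω) (ha : a ∈ interior Ω) {z : 𝔼[d]}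
    (hz : z ≠ 0) : radial Ω a z ∈ frontier Ω := by
  have h := gaugeFrom_pos hΩ ha hz
  rw [radial, ← gaugeFrom_eq_one hΩ ha, gaugeFrom_smul (by positivity), inv_mul_cancel₀ h.ne']

theorem measurable_radial (hΩ : IsUniformlyConvexDomain Ω) (ha : a ∈ interior Ω) :
    Measurable (radial Ω a) := by
  have := (continuous_gaugeFrom hΩ ha).measurable
  unfold radial
  fun_prop

theorem coneMeasure_apply (hΩ : IsUniformlyConvexDomain Ω) (ha : a ∈ interior Ω) {S : Set 𝔼[d]}
    (hS : MeasurableSet S) :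
    coneMeasure Ω a S = volume ((fun w => a + w) ⁻¹' Ω ∩ radial Ω a ⁻¹' S) := by
  rw [coneMeasure, Measure.map_apply (measurable_radial hΩ ha) hS,
    Measure.restrict_apply (measurable_radial hΩ ha hS), inter_comm]

theorem isFiniteMeasure_coneMeasure (hΩ : IsUniformlyConvexDomain Ω) :
    IsFiniteMeasure (coneMeasure Ω a) := by
  have : IsFiniteMeasure (volume.restrict ((fun w => a + w) ⁻¹' Ω)) :=
    ⟨by rw [Measure.restrict_apply_univ]; exact (isCompact_shift hΩ).measure_lt_top⟩
  unfold coneMeasure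
  infer_instance

end Gauge

section GaugeLaw

theorem gaugeLaw_Icc (hd : 1 ≤ d) {s : ℝ} (h0 : 0 ≤ s) (h1 : s ≤ 1) :
    gaugeLaw d (Icc 0 s) = ENNReal.ofReal (s ^ d) := by
  rw [gaugeLaw, withDensity_apply _ measurableSet_Icc, Measure.restrict_restrict measurableSet_Icc,
    inter_eq_left.2 (Icc_subset_Icc_right h1), ← ofReal_integral_eq_lintegral_ofReal,
    integral_Icc_eq_integral_Ioc, ← intervalIntegral.integral_of_le h0]
  · congr 1
    rw [intervalIntegral.integral_const_mul, integral_pow]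
    obtain ⟨k, rfl⟩ : ∃ k, d = k + 1 := ⟨d - 1, by omega⟩
    push_cast
    simp
    field_simp
  · exact Continuous.integrableOn_Icc (by fun_prop)
  · filter_upwards [ae_restrict_mem measurableSet_Icc] with t ht
    have := ht.1
    simp only [Pi.zero_apply]; positivity

theorem gaugeLaw_Iic (hd : 1 ≤ d) (s : ℝ) :
    gaugeLaw d (Iic s) = ENNReal.ofReal ((max 0 (min s 1)) ^ d) := by
  have key : gaugeLaw d (Iic s) = gaugeLaw d (Iic s ∩ Icc 0 1) := by
    rw [gaugeLaw, withDensity_apply _ measurableSet_Iic,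
      withDensity_apply _ (measurableSet_Iic.inter measurableSet_Icc),
      Measure.restrict_restrict measurableSet_Iic,
      Measure.restrict_restrict (measurableSet_Iic.inter measurableSet_Icc), inter_assoc,
      inter_self]
  rcases lt_or_ge s 0 with h | h
  · have : Iic s ∩ Icc (0 : ℝ) 1 = ∅ := by
      ext t; simp only [mem_inter_iff, mem_Iic, mem_Icc, mem_empty_iff_false, iff_false]
      intro ht; linarith [ht.1, ht.2.1]
    rw [key, this, measure_empty, max_eq_left (by simp [h.le])]
    simp [show d ≠ 0 by omega]
  · have : Iic s ∩ Icc (0 : ℝ) 1 = Icc 0 (min s 1) := by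
      ext t; simp only [mem_inter_iff, mem_Iic, mem_Icc, le_min_iff]; tauto
    rw [key, this, gaugeLaw_Icc hd (le_min h zero_le_one) (min_le_right _ _),
      max_eq_right (le_min h zero_le_one)]

theorem isFiniteMeasure_gaugeLaw (d : ℕ) : IsFiniteMeasure (gaugeLaw d) := by
  refine isFiniteMeasure_withDensity_ofReal ?_
  exact (Continuous.integrableOn_Icc (by fun_prop) : IntegrableOn _ _ _).hasFiniteIntegral

theorem restrict_Icc_le_gaugeLaw (hd : 1 ≤ d) :
    (volume.restrict (Icc (1 / 2 : ℝ) 1)) ≤ ((2 : ℝ≥0∞) ^ d) • gaugeLaw d := by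
  refine Measure.le_iff.2 fun A hA => ?_
  rw [Measure.smul_apply, smul_eq_mul, gaugeLaw, withDensity_apply _ hA,
    Measure.restrict_restrict hA, Measure.restrict_apply hA, ← setLIntegral_one,
    ← lintegral_const_mul' _ _ (by simp)]
  refine (setLIntegral_mono' (hA.inter measurableSet_Icc) ?_).trans
    (lintegral_mono_set (inter_subset_inter_right A (Icc_subset_Icc_left (by norm_num))))
  rintro s ⟨-, hs, -⟩
  have h2 : (2 : ℝ≥0∞) ^ d = ENNReal.ofReal (2 ^ d) := by
    rw [ENNReal.ofReal_pow (by norm_num)]; norm_num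
  rw [h2, ← ENNReal.ofReal_mul (by positivity), ← ENNReal.ofReal_one]
  apply ENNReal.ofReal_le_ofReal
  obtain ⟨k, rfl⟩ : ∃ k, d = k + 1 := ⟨d - 1, by omega⟩
  have : (1 : ℝ) ≤ (2 * s) ^ k := one_le_pow₀ (by linarith)
  rw [mul_pow] at this
  simp only [Nat.add_sub_cancel, pow_succ]
  push_cast
  nlinarith [mul_nonneg (Nat.cast_nonneg (α := ℝ) k) (zero_le_one.trans this)]

theorem gaugeLaw_Ioc_le (δ : ℝ) :
    gaugeLaw d (Ioc (1 - δ) 1) ≤ ENNReal.ofReal (d * δ) := by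
  rw [gaugeLaw, withDensity_apply _ measurableSet_Ioc, Measure.restrict_restrict measurableSet_Ioc]
  calc ∫⁻ s in Ioc (1 - δ) 1 ∩ Icc 0 1, ENNReal.ofReal (d * s ^ (d - 1))
      ≤ ∫⁻ s in Ioc (1 - δ) 1 ∩ Icc 0 1, ENNReal.ofReal d := by
        refine setLIntegral_mono' (measurableSet_Ioc.inter measurableSet_Icc) ?_
        rintro s ⟨-, h0, h1⟩
        apply ENNReal.ofReal_le_ofReal
        exact mul_le_of_le_one_right (Nat.cast_nonneg d) (pow_le_one₀ h0 h1)
    _ ≤ ∫⁻ s in Ioc (1 - δ) 1, ENNReal.ofReal d := lintegral_mono_set inter_subset_left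
    _ = ENNReal.ofReal (d * δ) := by
        rw [setLIntegral_const, Real.volume_Ioc, ← ENNReal.ofReal_mul (Nat.cast_nonneg d)]
        congr 1; ring

end GaugeLaw

/-- Polar coordinates with respect to a convex domain: under the uniform measure, the radial
projection and the gauge are independent. -/
theorem map_radial_gaugeFrom (hd : 1 ≤ d) {Ω : Set 𝔼[d]} {a : 𝔼[d]}
    (hΩ : IsUniformlyConvexDomain Ω) (ha : a ∈ interior Ω) :
    (volume.restrict ((fun w => a + w) ⁻¹' Ω)).map (fun z => (radial Ω a z, gaugeFrom Ω a z)) =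
      (coneMeasure Ω a).prod (gaugeLaw d) := by
  have := isFiniteMeasure_coneMeasure (a := a) hΩ
  have := isFiniteMeasure_gaugeLaw d
  have hjm := (continuous_gaugeFrom hΩ ha).measurable
  have hrm := measurable_radial hΩ ha
  have hKm := measurableSet_shift (a := a) hΩ
  have : Nonempty (Fin d) := ⟨⟨0, hd⟩⟩
  have : Nontrivial 𝔼[d] := inferInstance
  symm
  refine Measure.prod_eq fun S T hS hT => ?_
  set K := (fun w => a + w) ⁻¹' Ω with hK
  have hKfin : volume K ≠ ∞ := (isCompact_shift hΩ).measure_lt_top.ne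
  have hfin : IsFiniteMeasure (volume.restrict (K ∩ radial Ω a ⁻¹' S)) :=
    ⟨by simpa using (measure_mono inter_subset_left).trans_lt hKfin.lt_top⟩
  have hSr := hrm hS
  have hext : (volume.restrict (K ∩ radial Ω a ⁻¹' S)).map (gaugeFrom Ω a) =
      coneMeasure Ω a S • gaugeLaw d := by
    refine Measure.ext_of_Iic _ _ fun s => ?_
    rw [Measure.map_apply hjm measurableSet_Iic, Measure.restrict_apply (hjm measurableSet_Iic),
      Measure.smul_apply, smul_eq_mul, gaugeLaw_Iic hd, coneMeasure_apply hΩ ha hS]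
    rcases le_or_gt s 0 with h | h
    · rw [max_eq_left (by simp [h]), zero_pow (by omega), ENNReal.ofReal_zero, mul_zero]
      refine measure_mono_null (t := {0}) ?_ (measure_singleton 0)
      rintro z ⟨hz, -⟩
      exact (gaugeFrom_eq_zero hΩ ha).1 (le_antisymm (le_trans hz h) (gaugeFrom_nonneg z))
    rcases le_or_gt 1 s with h1 | h1
    · rw [min_eq_right h1, max_eq_right zero_le_one, one_pow, ENNReal.ofReal_one, mul_one]
      congr 1
      refine inter_eq_right.2 fun z hz => ?_
      exact ((gaugeFrom_le_one hΩ ha).2 hz.1).trans h1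
    · rw [min_eq_left h1.le, max_eq_right h.le]
      -- the part of the cone below height `s` is the dilation of the cone by the factor `s`
      have hset : gaugeFrom Ω a ⁻¹' Iic s ∩ (K ∩ radial Ω a ⁻¹' S) =
          s • (K ∩ radial Ω a ⁻¹' S) := by
        ext z
        rw [mem_smul_set_iff_inv_smul_mem₀ h.ne']
        simp only [mem_inter_iff, mem_preimage, mem_Iic, radial_smul (inv_pos.2 h)]
        rw [hK, mem_preimage, mem_preimage, ← gaugeFrom_le_one hΩ ha, ← gaugeFrom_le_one hΩ ha,
          gaugeFrom_smul (inv_pos.2 h).le, inv_mul_le_iff₀ h, mul_one]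
        constructor
        · rintro ⟨h2, -, h3⟩; exact ⟨h2, h3⟩
        · rintro ⟨h2, h3⟩; exact ⟨h2, h2.trans h1.le, h3⟩
      rw [hset, Measure.addHaar_smul, finrank_euclideanSpace_fin, abs_of_nonneg (by positivity),
        mul_comm]
  rw [Measure.map_apply (hrm.prodMk hjm) (hS.prod hT),
    Measure.restrict_apply ((hrm.prodMk hjm) (hS.prod hT))]
  have h2 := congrArg (fun m => m T) hext
  simp only [Measure.map_apply hjm hT, Measure.restrict_apply (hjm hT), Measure.smul_apply,
    smul_eq_mul] at h2
  rw [← h2]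
  congr 1
  ext z
  simp only [mem_inter_iff, mem_preimage, mem_prod]
  tauto

/-! ### The surface measure is controlled by the cone measure -/

section Hausdorff

variable {Ω : Set 𝔼[d]} {a : 𝔼[d]}

theorem exists_norm_sub_le (hΩ : IsUniformlyConvexDomain Ω) (a : 𝔼[d]) :
    ∃ R : ℝ, 0 < R ∧ ∀ x ∈ Ω, ‖x - a‖ ≤ R := by
  obtain ⟨R, hR⟩ := hΩ.isCompact.isBounded.subset_closedBall a
  refine ⟨max R 1, by positivity, fun x hx => ?_⟩
  have := hR hx
  rw [Metric.mem_closedBall, dist_eq_norm] at this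
  exact this.trans (le_max_left _ _)

/-- The shell `{1 - δ < gauge ≤ 1}` of the cone over a boundary ball of radius `r`, with `δ`
comparable to `r`, contains a ball with radius comparable to `r`. -/
theorem ball_subset_shell (hΩ : IsUniformlyConvexDomain Ω) (ha : a ∈ interior Ω) :
    ∃ D η : ℝ, 0 < D ∧ 0 < η ∧ ∀ x ∈ frontier Ω, ∀ r : ℝ, 0 < r → r ≤ 1 → ∃ z₀ : 𝔼[d],
      Metric.ball z₀ (η * r) ⊆ (fun w => a + w) ⁻¹' Ω ∩
        {z | radial Ω a z ∈ Metric.ball x r ∧ gaugeFrom Ω a z ∈ Ioc (1 - D * r) 1} := by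
  obtain ⟨R, hR, hRb⟩ := exists_norm_sub_le hΩ a
  obtain ⟨L, hL⟩ := lipschitzWith_gaugeFrom hΩ ha
  refine ⟨1 / (4 * (1 + R)), 1 / (8 * (1 + R) * (1 + L)), by positivity, by positivity, ?_⟩
  intro x hx r hr hr1
  set δ : ℝ := 1 / (4 * (1 + R)) * r with hδ
  set η : ℝ := 1 / (8 * (1 + R) * (1 + L)) with hη
  have hδ0 : 0 < δ := by positivity
  have hδR : δ * (1 + R) = r / 4 := by rw [hδ]; field_simp
  have hηL : η * r * (1 + L) = δ / 2 := by rw [hδ, hη]; field_simp; ring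
  have hηr : 0 < η * r := by positivity
  have hδ4 : δ ≤ 1 / 4 := by nlinarith
  have hLη : η * r * L < δ / 2 := by nlinarith
  refine ⟨(1 - δ / 2) • (x - a), fun z hz => ?_⟩
  rw [Metric.mem_ball, dist_eq_norm] at hz
  set w := x - a with hw
  have hwR : ‖w‖ ≤ R := hRb x (frontier_subset_domain hΩ hx)
  have hjw : gaugeFrom Ω a ((1 - δ / 2) • w) = 1 - δ / 2 := by
    rw [gaugeFrom_smul (by linarith), gaugeFrom_sub_of_mem_frontier hΩ ha hx, mul_one]
  have hj : |gaugeFrom Ω a z - (1 - δ / 2)| < δ / 2 := by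
    have := hL.dist_le_mul z ((1 - δ / 2) • w)
    rw [hjw, Real.dist_eq, dist_eq_norm] at this
    have h2 : (L : ℝ) * ‖z - (1 - δ / 2) • w‖ ≤ L * (η * r) :=
      mul_le_mul_of_nonneg_left hz.le L.2
    linarith
  set j := gaugeFrom Ω a z with hjdef
  obtain ⟨hj1, hj2⟩ := abs_lt.1 hj
  have hjhalf : 1 / 2 ≤ j := by linarith
  refine ⟨(gaugeFrom_le_one hΩ ha).1 (by rw [← hjdef]; linarith), ?_, by linarith, by linarith⟩
  rw [Metric.mem_ball, dist_eq_norm]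
  have e : radial Ω a z - x = j⁻¹ • ((z - (1 - δ / 2) • w) + ((1 - δ / 2) - j) • w) := by
    have h1 : (z - (1 - δ / 2) • w) + ((1 - δ / 2) - j) • w = z - j • w := by module
    rw [h1, smul_sub, smul_smul, inv_mul_cancel₀ (by linarith), radial, ← hjdef, hw]
    module
  rw [e, norm_smul, norm_inv, Real.norm_of_nonneg (by linarith), inv_mul_lt_iff₀ (by linarith)]
  have h3 : ‖((1 - δ / 2) - j) • w‖ ≤ δ / 2 * R := by
    rw [norm_smul, Real.norm_eq_abs, abs_sub_comm]
    exact mul_le_mul hj.le hwR (norm_nonneg _) (by positivity)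
  have h4 : η * r ≤ δ / 2 := by nlinarith [L.2, mul_nonneg hηr.le L.2]
  calc _ ≤ ‖z - (1 - δ / 2) • w‖ + ‖((1 - δ / 2) - j) • w‖ := norm_add_le _ _
    _ < j * r := by nlinarith

theorem coneMeasure_ball_ge (hd : 1 ≤ d) (hΩ : IsUniformlyConvexDomain Ω) (ha : a ∈ interior Ω) :
    ∃ c : ℝ, 0 < c ∧ ∀ x ∈ frontier Ω, ∀ r : ℝ, 0 < r → r ≤ 1 →
      ENNReal.ofReal (c * r ^ (d - 1)) ≤ coneMeasure Ω a (Metric.ball x r) := by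
  obtain ⟨D, η, hD, hη, hsub⟩ := ball_subset_shell hΩ ha
  have : Nonempty (Fin d) := ⟨⟨0, hd⟩⟩
  set V : ℝ≥0∞ := volume (Metric.ball (0 : 𝔼[d]) 1) with hV
  have hVtop : V ≠ ∞ := measure_ball_lt_top.ne
  have hVpos : 0 < V.toReal := ENNReal.toReal_pos (Metric.measure_ball_pos _ _ one_pos).ne' hVtop
  have hd0 : (0 : ℝ) < d := by exact_mod_cast hd
  refine ⟨η ^ d * V.toReal / (d * D), by positivity, fun x hx r hr hr1 => ?_⟩
  obtain ⟨z₀, hz₀⟩ := hsub x hx r hr hr1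
  have := isFiniteMeasure_gaugeLaw d
  have h1 : volume (Metric.ball z₀ (η * r)) ≤
      coneMeasure Ω a (Metric.ball x r) * gaugeLaw d (Ioc (1 - D * r) 1) := by
    have hm : Measurable fun z => (radial Ω a z, gaugeFrom Ω a z) :=
      (measurable_radial hΩ ha).prodMk (continuous_gaugeFrom hΩ ha).measurable
    have hS : MeasurableSet (Metric.ball x r ×ˢ Ioc (1 - D * r) 1) :=
      Metric.isOpen_ball.measurableSet.prod measurableSet_Ioc
    rw [← Measure.prod_prod, ← map_radial_gaugeFrom hd hΩ ha, Measure.map_apply hm hS,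
      Measure.restrict_apply (hm hS), inter_comm]
    exact measure_mono hz₀
  have h2 := h1.trans (mul_le_mul_right (gaugeLaw_Ioc_le (d := d) (D * r)) _)
  rw [Measure.addHaar_ball _ _ (by positivity), finrank_euclideanSpace_fin, ← hV,
    ← ENNReal.ofReal_toReal hVtop, ← ENNReal.ofReal_mul (by positivity)] at h2
  have h3 : η ^ d * V.toReal / (d * D) * r ^ (d - 1) =
      ((η * r) ^ d * V.toReal) / (d * (D * r)) := by
    obtain ⟨k, rfl⟩ : ∃ k, d = k + 1 := ⟨d - 1, by omega⟩
    rw [Nat.add_sub_cancel, mul_pow, pow_succ r]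
    field_simp
  rw [h3, ENNReal.ofReal_div_of_pos (by positivity)]
  exact ENNReal.div_le_of_le_mul h2

/-- Covering argument behind the comparison of the surface and cone measures. -/
theorem hausdorffMeasure_le_coneMeasure_of_ball_subset {c : ℝ} (hc : 0 < c)
    (hball : ∀ x ∈ frontier Ω, ∀ r : ℝ, 0 < r → r ≤ 1 →
      ENNReal.ofReal (c * r ^ (d - 1)) ≤ coneMeasure Ω a (Metric.ball x r))
    {S U : Set 𝔼[d]} (hS : S ⊆ frontier Ω) {ρ : ℝ} (hρ : 0 < ρ)
    (hSU : ∀ x ∈ S, Metric.ball x ρ ⊆ U) :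
    Measure.hausdorffMeasure ((d - 1 : ℕ) : ℝ) S ≤
      ENNReal.ofReal (10 ^ (d - 1) / c) * coneMeasure Ω a U := by
  set ρ' := min ρ 1 with hρ'
  have hρ'0 : 0 < ρ' := lt_min hρ one_pos
  set r : ℕ → ℝ := fun m => ρ' / (m + 2) with hr
  have hr0 : ∀ m, 0 < r m := fun m => by positivity
  have hrρ : ∀ m, r m < ρ' := fun m => by
    rw [hr, div_lt_iff₀ (by positivity)]
    nlinarith [Nat.cast_nonneg (α := ℝ) m]
  choose v hvS hvdisj hvcov using fun m =>
    Vitali.exists_disjoint_subfamily_covering_enlargement_closedBall S (id : 𝔼[d] → 𝔼[d])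
      (fun _ => r m) (r m) (fun _ _ => le_rfl) 5 (by norm_num)
  have hvcount : ∀ m, (v m).Countable := fun m =>
    (hvdisj m).countable_of_nonempty_interior fun x _ =>
      ⟨x, Metric.ball_subset_interior_closedBall (Metric.mem_ball_self (hr0 m))⟩
  have : ∀ m, Countable (v m) := fun m => (hvcount m).to_subtype
  have hdiam : ∀ m (i : v m), Metric.ediam (Metric.closedBall (i : 𝔼[d]) (5 * r m)) ≤
      ENNReal.ofReal (10 * r m) := fun m i => by
    refine Metric.ediam_le fun x hx y hy => ?_
    rw [edist_dist]
    apply ENNReal.ofReal_le_ofReal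
    linarith [dist_triangle_right x y (i : 𝔼[d]), Metric.mem_closedBall.1 hx,
      Metric.mem_closedBall.1 hy]
  have hlim : Tendsto (fun m => ENNReal.ofReal (10 * r m)) atTop (𝓝 0) := by
    have h1 : Tendsto (fun m : ℕ => 10 * (ρ' / ((m : ℝ) + 2))) atTop (𝓝 0) := by
      have h3 : Tendsto (fun m : ℕ => (m : ℝ) + 2) atTop atTop :=
        tendsto_atTop_add_const_right _ _ tendsto_natCast_atTop_atTop
      have h2 : Tendsto (fun m : ℕ => ρ' / ((m : ℝ) + 2)) atTop (𝓝 0) := h3.const_div_atTop ρ'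
      simpa using h2.const_mul 10
    simpa using ENNReal.tendsto_ofReal h1
  refine (Measure.hausdorffMeasure_le_liminf_tsum ((d - 1 : ℕ) : ℝ) S _ hlim
    (fun m (i : v m) => Metric.closedBall (i : 𝔼[d]) (5 * r m)) (Eventually.of_forall hdiam)
    (Eventually.of_forall fun m x hx => ?_)).trans ?_
  · obtain ⟨b, hb, hsub⟩ := hvcov m x hx
    exact mem_iUnion.2 ⟨⟨b, hb⟩, hsub (Metric.mem_closedBall_self (hr0 m).le)⟩
  refine liminf_le_of_le ?_ fun b hb => ?_
  · isBoundedDefault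
  obtain ⟨m, hm⟩ := hb.exists
  refine hm.trans ?_
  calc ∑' i : v m, Metric.ediam (Metric.closedBall (i : 𝔼[d]) (5 * r m)) ^ ((d - 1 : ℕ) : ℝ)
      ≤ ∑' i : v m, ENNReal.ofReal (10 ^ (d - 1) / c) *
          coneMeasure Ω a (Metric.ball (i : 𝔼[d]) (r m)) := by
        refine ENNReal.tsum_le_tsum fun i => ?_
        rw [ENNReal.rpow_natCast]
        refine (pow_le_pow_left' (hdiam m i) _).trans ?_
        rw [← ENNReal.ofReal_pow (by have := hr0 m; positivity)]
        have e : (10 * r m) ^ (d - 1) = 10 ^ (d - 1) / c * (c * r m ^ (d - 1)) := by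
          rw [mul_pow]; field_simp
        rw [e, ENNReal.ofReal_mul (by positivity)]
        exact mul_le_mul_right (hball _ (hS (hvS m i.2)) _ (hr0 m)
          ((hrρ m).le.trans (min_le_right _ _))) _
    _ = ENNReal.ofReal (10 ^ (d - 1) / c) *
          ∑' i : v m, coneMeasure Ω a (Metric.ball (i : 𝔼[d]) (r m)) := ENNReal.tsum_mul_left
    _ ≤ ENNReal.ofReal (10 ^ (d - 1) / c) * coneMeasure Ω a U := by
        refine mul_le_mul_right ?_ _
        rw [← measure_iUnion (fun i k hik => ?_) fun i => Metric.isOpen_ball.measurableSet]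
        · refine measure_mono (iUnion_subset fun i => ?_)
          exact (Metric.ball_subset_ball ((hrρ m).le.trans (min_le_left _ _))).trans
            (hSU _ (hvS m i.2))
        · exact (hvdisj m i.2 k.2 (Subtype.coe_injective.ne hik)).mono
            Metric.ball_subset_closedBall Metric.ball_subset_closedBall

/-- The surface measure of a convex domain is bounded by a multiple of its cone measure. -/
theorem boundaryMeasure_le_coneMeasure (hd : 1 ≤ d) (hΩ : IsUniformlyConvexDomain Ω)
    (ha : a ∈ interior Ω) :
    ∃ C : ℝ≥0∞, C ≠ ∞ ∧ boundaryMeasure Ω ≤ C • coneMeasure Ω a := by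
  obtain ⟨c, hc, hball⟩ := coneMeasure_ball_ge hd hΩ ha
  have := isFiniteMeasure_coneMeasure (a := a) hΩ
  have key : ∀ S ⊆ frontier Ω, Measure.hausdorffMeasure ((d - 1 : ℕ) : ℝ) S ≤
      ENNReal.ofReal (10 ^ (d - 1) / c) * coneMeasure Ω a S := by
    intro S hS
    have hopen : ∀ U ⊇ S, IsOpen U → Measure.hausdorffMeasure ((d - 1 : ℕ) : ℝ) S ≤
        ENNReal.ofReal (10 ^ (d - 1) / c) * coneMeasure Ω a U := by
      intro U hSU hU
      set T : ℕ → Set 𝔼[d] := fun n => {x ∈ S | Metric.ball x (1 / (n + 1 : ℝ)) ⊆ U} with hT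
      have hTS : S = ⋃ n, T n := by
        refine subset_antisymm (fun x hx => ?_) (iUnion_subset fun n x hx => hx.1)
        obtain ⟨ε, hε, hεU⟩ := Metric.isOpen_iff.1 hU x (hSU hx)
        obtain ⟨n, hn⟩ := exists_nat_one_div_lt hε
        exact mem_iUnion.2 ⟨n, hx, (Metric.ball_subset_ball hn.le).trans hεU⟩
      have hmono : Monotone T := fun n m hnm x hx =>
        ⟨hx.1, (Metric.ball_subset_ball (Nat.one_div_le_one_div hnm)).trans hx.2⟩
      rw [hTS, hmono.measure_iUnion]
      exact iSup_le fun n => hausdorffMeasure_le_coneMeasure_of_ball_subset hc hball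
        (fun x hx => hS hx.1) (Nat.one_div_pos_of_nat (n := n)) fun x hx => hx.2
    rw [S.measure_eq_iInf_isOpen (coneMeasure Ω a)]
    have hne : ENNReal.ofReal (10 ^ (d - 1) / c) ≠ 0 := by
      rw [Ne, ENNReal.ofReal_eq_zero, not_le]; positivity
    simp_rw [ENNReal.mul_iInf_of_ne hne ENNReal.ofReal_ne_top]
    exact le_iInf₂ fun U hU => le_iInf fun hUo => hopen U hU hUo
  refine ⟨(Measure.addHaarScalarFactor (volume : Measure (EuclideanSpace ℝ (Fin (d - 1))))
    (Measure.hausdorffMeasure ((d - 1 : ℕ) : ℝ)) : ℝ≥0∞) *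
      ENNReal.ofReal (10 ^ (d - 1) / c), by finiteness, Measure.le_iff.2 fun S hS => ?_⟩
  rw [boundaryMeasure, Measure.restrict_apply hS, Measure.euclideanHausdorffMeasure_def,
    Measure.smul_apply, Measure.smul_apply, smul_eq_mul, mul_assoc, ENNReal.smul_def, smul_eq_mul]
  exact mul_le_mul_right ((key _ inter_subset_right).trans
    (mul_le_mul_right (measure_mono inter_subset_left) _)) _

end Hausdorff

/-! ### Transport towards a single boundary point -/

section SingleTarget

variable {Ω : Set 𝔼[d]} {a : 𝔼[d]}

theorem fderiv_gaugeFrom_self {z : 𝔼[d]}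
    (hz : DifferentiableAt ℝ (gaugeFrom Ω a) z) :
    fderiv ℝ (gaugeFrom Ω a) z z = gaugeFrom Ω a z := by
  have h1 : HasDerivAt (fun s : ℝ => gaugeFrom Ω a (s • z)) (fderiv ℝ (gaugeFrom Ω a) z z) 1 := by
    have h2 : HasDerivAt (fun s : ℝ => s • z) z 1 := by
      simpa using (hasDerivAt_id (1 : ℝ)).smul_const z
    have h5 : HasFDerivAt (gaugeFrom Ω a) (fderiv ℝ (gaugeFrom Ω a) z) ((1 : ℝ) • z) := by
      rw [one_smul]; exact hz.hasFDerivAt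
    exact h5.comp_hasDerivAt (1 : ℝ) h2
  have h3 : HasDerivAt (fun s : ℝ => gaugeFrom Ω a (s • z)) (gaugeFrom Ω a z) 1 := by
    have h4 : HasDerivAt (fun s : ℝ => s * gaugeFrom Ω a z) (gaugeFrom Ω a z) 1 := by
      simpa using (hasDerivAt_id (1 : ℝ)).mul_const (gaugeFrom Ω a z)
    refine h4.congr_of_eventuallyEq ?_
    filter_upwards [eventually_gt_nhds (zero_lt_one' ℝ)] with s hs
    exact gaugeFrom_smul hs.le z
  exact h1.unique h3

/-- Wherever it exists, the derivative of a gauge is a subgradient of the gauge at the origin. -/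
theorem fderiv_gaugeFrom_le (hΩ : IsUniformlyConvexDomain Ω) (ha : a ∈ interior Ω) {z : 𝔼[d]}
    (hz : DifferentiableAt ℝ (gaugeFrom Ω a) z) (h : 𝔼[d]) :
    fderiv ℝ (gaugeFrom Ω a) z h ≤ gaugeFrom Ω a h := by
  have h1 : HasDerivAt (fun s : ℝ => gaugeFrom Ω a (z + s • h))
      (fderiv ℝ (gaugeFrom Ω a) z h) 0 := by
    have h2 : HasDerivAt (fun s : ℝ => z + s • h) h 0 := by
      simpa using ((hasDerivAt_id (0 : ℝ)).smul_const h).const_add z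
    have h5 : HasFDerivAt (gaugeFrom Ω a) (fderiv ℝ (gaugeFrom Ω a) z) (z + (0 : ℝ) • h) := by
      rw [zero_smul, add_zero]; exact hz.hasFDerivAt
    exact h5.comp_hasDerivAt (0 : ℝ) h2
  have h3 := h1.hasDerivWithinAt (s := Ioi 0)
  rw [hasDerivWithinAt_iff_tendsto_slope' (by simp)] at h3
  refine le_of_tendsto h3 ?_
  filter_upwards [self_mem_nhdsWithin] with s hs
  have hs : (0 : ℝ) < s := hs
  have h4 := gaugeFrom_add_le hΩ ha z (s • h)
  rw [gaugeFrom_smul hs.le] at h4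
  rw [slope_def_field, zero_smul, add_zero, sub_zero, div_le_iff₀ hs]
  linarith

theorem ae_differentiableAt_gaugeFrom (hΩ : IsUniformlyConvexDomain Ω) (ha : a ∈ interior Ω) :
    ∀ᵐ z : 𝔼[d], DifferentiableAt ℝ (gaugeFrom Ω a) z :=
  (lipschitzWith_gaugeFrom hΩ ha).choose_spec.ae_differentiableAt

/-- Quantitative transversality: the ray from `y` to a boundary point `x` makes with the tangent
plane at `x` an angle of order at least `‖x - y‖`. -/
theorem one_sub_fderiv_gaugeFrom_ge (hΩ : IsUniformlyConvexDomain Ω) (ha : a ∈ interior Ω) :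
    ∃ c : ℝ, 0 < c ∧ ∀ z y : 𝔼[d], z ≠ 0 → DifferentiableAt ℝ (gaugeFrom Ω a) z → y ∈ Ω →
      c * ‖radial Ω a z - y‖ ^ 2 ≤ 1 - fderiv ℝ (gaugeFrom Ω a) z (y - a) := by
  obtain ⟨R, hR, hRb⟩ := exists_norm_sub_le hΩ a
  obtain ⟨c, hc, hball⟩ := hΩ.uniformlyConvex
  refine ⟨2 * c / R, by positivity, fun z y hz hdiff hy => ?_⟩
  set x := radial Ω a z with hx
  have hxΩ : x ∈ Ω := frontier_subset_domain hΩ (radial_mem_frontier hΩ ha hz)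
  set ρ := c * ‖x - y‖ ^ 2 with hρ
  have hρ0 : 0 ≤ ρ := by positivity
  set f := fderiv ℝ (gaugeFrom Ω a) z with hf
  have hfx : f (x - a) = 1 := by
    have : x - a = (gaugeFrom Ω a z)⁻¹ • z := by rw [hx, radial]; abel
    rw [this, map_smul, hf, fderiv_gaugeFrom_self hdiff, smul_eq_mul,
      inv_mul_cancel₀ (gaugeFrom_pos hΩ ha hz).ne']
  -- test the supporting half-space against the point of the ball closest to it
  have hm : midpoint ℝ x y + (ρ / R) • (x - a) ∈ Ω := by
    apply hball x hxΩ y hy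
    rw [Metric.mem_closedBall, dist_eq_norm, add_sub_cancel_left, norm_smul,
      Real.norm_of_nonneg (by positivity), div_mul_eq_mul_div, div_le_iff₀ hR]
    exact mul_le_mul_of_nonneg_left (hRb x hxΩ) hρ0
  have h1 := fderiv_gaugeFrom_le hΩ ha hdiff (midpoint ℝ x y + (ρ / R) • (x - a) - a)
  have h2 : gaugeFrom Ω a (midpoint ℝ x y + (ρ / R) • (x - a) - a) ≤ 1 :=
    (gaugeFrom_le_one hΩ ha).2 (by simpa using hm)
  have h3 : midpoint ℝ x y + (ρ / R) • (x - a) - a =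
      (1 / 2 : ℝ) • (x - a) + (1 / 2 : ℝ) • (y - a) + (ρ / R) • (x - a) := by
    rw [midpoint_eq_smul_add, invOf_eq_inv]; module
  rw [h3] at h1 h2
  rw [← hf, map_add, map_add, map_smul, map_smul, map_smul, hfx] at h1
  simp only [smul_eq_mul] at h1
  have h4 : 2 * c / R * ‖x - y‖ ^ 2 = 2 * (ρ / R) := by rw [hρ]; ring
  rw [h4]
  linarith

/-- In polar coordinates from `a`, the dilations with centre `y` read
`z ↦ a + z + (1 - gauge z) (y - a)`, a rank-one perturbation of a translation. -/
theorem add_gaugeFrom_smul_radial_sub (hΩ : IsUniformlyConvexDomain Ω) (ha : a ∈ interior Ω)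
    {z : 𝔼[d]} (hz : z ≠ 0) (y : 𝔼[d]) :
    a + z + (1 - gaugeFrom Ω a z) • (y - a) = y + gaugeFrom Ω a z • (radial Ω a z - y) := by
  have h : gaugeFrom Ω a z • (gaugeFrom Ω a z)⁻¹ • z = z := by
    rw [smul_smul, mul_inv_cancel₀ (gaugeFrom_pos hΩ ha hz).ne', one_smul]
  have h2 : gaugeFrom Ω a z • (radial Ω a z - y) =
      gaugeFrom Ω a z • (a - y) + gaugeFrom Ω a z • (gaugeFrom Ω a z)⁻¹ • z := by
    rw [radial]; module
  rw [h2, h]; module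

theorem det_id_sub_smulRight (f : 𝔼[d] →L[ℝ] ℝ) (b : 𝔼[d]) :
    (ContinuousLinearMap.id ℝ 𝔼[d] - f.smulRight b).det = 1 - f b := by
  have h : ((ContinuousLinearMap.id ℝ 𝔼[d] - f.smulRight b : 𝔼[d] →L[ℝ] 𝔼[d]) : 𝔼[d] →ₗ[ℝ] 𝔼[d]) =
      LinearMap.transvection (f : 𝔼[d] →ₗ[ℝ] ℝ) (-b) := by
    ext1 x
    simp [LinearMap.transvection, sub_eq_add_neg]
  rw [ContinuousLinearMap.det, h, LinearMap.transvection.det]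
  simp [sub_eq_add_neg]

theorem volume_preimage_dilation_le (hd : 1 ≤ d) (hΩ : IsUniformlyConvexDomain Ω)
    (ha : a ∈ interior Ω) :
    ∃ C : ℝ, 0 < C ∧ ∀ y ∈ frontier Ω, ∀ ε : ℝ, 0 < ε → ∀ A : Set 𝔼[d], MeasurableSet A →
      volume {z : 𝔼[d] | ε ≤ ‖radial Ω a z - y‖ ∧ y + gaugeFrom Ω a z • (radial Ω a z - y) ∈ A} ≤
        ENNReal.ofReal (C / ε ^ 2) * volume A := by
  obtain ⟨c, hc, hdet⟩ := one_sub_fderiv_gaugeFrom_ge hΩ ha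
  refine ⟨1 / c, by positivity, fun y hy ε hε A hA => ?_⟩
  have : Nonempty (Fin d) := ⟨⟨0, hd⟩⟩
  have hjc := continuous_gaugeFrom hΩ ha
  have hrm := measurable_radial hΩ ha
  set F : 𝔼[d] → 𝔼[d] := fun z => y + gaugeFrom Ω a z • (radial Ω a z - y) with hF
  set P : Set 𝔼[d] := {z : 𝔼[d] | ε ≤ ‖radial Ω a z - y‖ ∧ F z ∈ A} with hP
  set D : Set 𝔼[d] := {z | DifferentiableAt ℝ (gaugeFrom Ω a) z} with hD
  set B : Set 𝔼[d] := (P ∩ D) ∩ {0}ᶜ with hB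
  have hFm : Measurable F := by
    have := hjc.measurable
    rw [hF]; fun_prop
  have hPm : MeasurableSet P :=
    (measurableSet_le measurable_const (hrm.sub_const y).norm).inter (hFm hA)
  have hBm : MeasurableSet B :=
    (hPm.inter (measurableSet_of_differentiableAt ℝ _)).inter (measurableSet_singleton 0).compl
  have hPB : volume P = volume B := by
    refine measure_congr ?_
    have h0 : ∀ᵐ z : 𝔼[d], z ≠ 0 := by
      rw [ae_iff]; simp
    filter_upwards [ae_differentiableAt_gaugeFrom hΩ ha, h0] with z hz hz0
    exact propext ⟨fun h => ⟨⟨h, hz⟩, hz0⟩, fun h => h.1.1⟩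
  have hderiv : ∀ z ∈ B, HasFDerivWithinAt F
      (ContinuousLinearMap.id ℝ 𝔼[d] - (fderiv ℝ (gaugeFrom Ω a) z).smulRight (y - a)) B z := by
    rintro z ⟨⟨-, hz⟩, hz0⟩
    have h1 : HasFDerivAt (fun z : 𝔼[d] => a + z + (1 - gaugeFrom Ω a z) • (y - a))
        (ContinuousLinearMap.id ℝ 𝔼[d] - (fderiv ℝ (gaugeFrom Ω a) z).smulRight (y - a)) z := by
      have hz' : HasFDerivAt (gaugeFrom Ω a) (fderiv ℝ (gaugeFrom Ω a) z) z :=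
        DifferentiableAt.hasFDerivAt hz
      have h2 := ((hasFDerivAt_id (𝕜 := ℝ) z).const_add a).add
        ((hz'.const_sub 1).smul_const (y - a))
      exact h2.congr_fderiv (by ext1 v; simp [sub_eq_add_neg]; abel)
    refine (h1.congr_of_eventuallyEq ?_).hasFDerivWithinAt
    filter_upwards [isOpen_compl_singleton.mem_nhds hz0] with w hw
    exact (add_gaugeFrom_smul_radial_sub hΩ ha hw y).symm
  have hinj : InjOn F B := by
    rintro z ⟨⟨⟨hz1, -⟩, -⟩, hz0⟩ z' ⟨⟨⟨hz1', -⟩, -⟩, hz0'⟩ heq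
    have hj := gaugeFrom_pos hΩ ha hz0
    have hj' := gaugeFrom_pos hΩ ha hz0'
    have hx := radial_mem_frontier hΩ ha hz0
    have hx' := radial_mem_frontier hΩ ha hz0'
    have hre : ∀ w : 𝔼[d], w ≠ 0 → w = gaugeFrom Ω a w • (radial Ω a w - a) := fun w hw => by
      rw [radial, add_sub_cancel_left, smul_smul, mul_inv_cancel₀ (gaugeFrom_pos hΩ ha hw).ne',
        one_smul]
    set s := gaugeFrom Ω a z
    set s' := gaugeFrom Ω a z'
    set x := radial Ω a z
    set x' := radial Ω a z'
    have heq' : s • (x - y) = s' • (x' - y) := add_left_cancel heq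
    have hdir : x' - y = (s / s') • (x - y) := by
      rw [div_eq_inv_mul, mul_smul, heq', smul_smul, inv_mul_cancel₀ hj'.ne', one_smul]
    have hxx : x = x' := by
      have e1 : x = y + (1 : ℝ) • (x - y) := by module
      have e2 : x' = y + (s / s') • (x - y) := by rw [← hdir]; abel
      rw [e1, e2]
      exact eq_of_mem_frontier_of_ray hΩ (frontier_subset_domain hΩ hy) one_pos (by positivity)
        (e1 ▸ hx) (e2 ▸ hx')
    have hne : x - y ≠ 0 := norm_pos_iff.1 (hε.trans_le hz1)
    have hss : s = s' := by
      rw [← hxx] at heq'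
      exact smul_left_injective ℝ hne heq'
    rw [hre z hz0, hre z' hz0']
    change s • (x - a) = s' • (x' - a)
    rw [hss, hxx]
  have himage : F '' B ⊆ A := by
    rintro _ ⟨z, ⟨⟨⟨-, hz⟩, -⟩, -⟩, rfl⟩
    exact hz
  have hcv := lintegral_abs_det_fderiv_eq_addHaar_image volume hBm hderiv hinj
  have hlow : ENNReal.ofReal (c * ε ^ 2) * volume B ≤ volume A := by
    refine le_trans ?_ (measure_mono himage)
    rw [← hcv, ← setLIntegral_const]
    refine setLIntegral_mono' hBm fun z hz => ENNReal.ofReal_le_ofReal ?_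
    obtain ⟨⟨⟨hz1, -⟩, hzD⟩, hz0⟩ := hz
    rw [det_id_sub_smulRight]
    refine le_trans ?_ (le_abs_self _)
    refine le_trans ?_ (hdet z y hz0 hzD (frontier_subset_domain hΩ hy))
    gcongr
  rw [hPB]
  have e : ENNReal.ofReal (1 / c / ε ^ 2) = (ENNReal.ofReal (c * ε ^ 2))⁻¹ := by
    rw [← ENNReal.ofReal_inv_of_pos (by positivity)]
    congr 1; field_simp
  rw [e, mul_comm, ← div_eq_mul_inv,
    ENNReal.le_div_iff_mul_le (Or.inl (by rw [Ne, ENNReal.ofReal_eq_zero, not_le]; positivity))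
      (Or.inl ENNReal.ofReal_ne_top), mul_comm]
  exact hlow

/-- Mass leaving the boundary uniformly (for the cone measure) towards a single boundary point `y`,
from a distance at least `ε`, has during the first half of its trip a density at most `C / ε ^
2`. -/
theorem prod_coneMeasure_preimage_le (hd : 1 ≤ d) (hΩ : IsUniformlyConvexDomain Ω)
    (ha : a ∈ interior Ω) :
    ∃ C : ℝ, 0 < C ∧ ∀ y ∈ frontier Ω, ∀ ε : ℝ, 0 < ε → ∀ A : Set 𝔼[d], MeasurableSet A →
      ((coneMeasure Ω a).restrict {x | ε ≤ ‖x - y‖}).prod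
          ((volume : Measure ℝ).restrict (Icc 0 (1 / 2)))
        {q | (1 - q.2) • q.1 + q.2 • y ∈ A} ≤ ENNReal.ofReal (C / ε ^ 2) * volume A := by
  obtain ⟨C, hC, hvol⟩ := volume_preimage_dilation_le hd hΩ ha
  refine ⟨2 ^ d * C, by positivity, fun y hy ε hε A hA => ?_⟩
  have := isFiniteMeasure_coneMeasure (a := a) hΩ
  have := isFiniteMeasure_gaugeLaw d
  have hjm := (continuous_gaugeFrom hΩ ha).measurable
  have hrm := measurable_radial hΩ ha
  have hSm : MeasurableSet {x : 𝔼[d] | ε ≤ ‖x - y‖} :=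
    (isClosed_le continuous_const (by fun_prop)).measurableSet
  have hm : MeasurableSet {q : 𝔼[d] × ℝ | (1 - q.2) • q.1 + q.2 • y ∈ A} := by
    have : Measurable fun q : 𝔼[d] × ℝ => (1 - q.2) • q.1 + q.2 • y := by fun_prop
    exact this hA
  have hm' : MeasurableSet {q : 𝔼[d] × ℝ | y + q.2 • (q.1 - y) ∈ A} := by
    have : Measurable fun q : 𝔼[d] × ℝ => y + q.2 • (q.1 - y) := by fun_prop
    exact this hA
  have hslice : ∀ x : 𝔼[d], ((volume : Measure ℝ).restrict (Icc 0 (1 / 2)))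
      (Prod.mk x ⁻¹' {q | (1 - q.2) • q.1 + q.2 • y ∈ A}) ≤
      ((2 : ℝ≥0∞) ^ d) * gaugeLaw d (Prod.mk x ⁻¹' {q : 𝔼[d] × ℝ | y + q.2 • (q.1 - y) ∈ A}) := by
    intro x
    refine le_trans (le_of_eq ?_) (Measure.le_iff'.1 (restrict_Icc_le_gaugeLaw hd) _)
    rw [Measure.restrict_apply (measurable_prodMk_left hm),
      Measure.restrict_apply (measurable_prodMk_left hm'),
      ← (Measure.measurePreserving_sub_left volume (1 : ℝ)).measure_preimage
        ((measurable_prodMk_left hm').inter measurableSet_Icc).nullMeasurableSet]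
    congr 1
    ext t
    simp only [mem_inter_iff, mem_preimage, mem_ofPred_eq, mem_Icc]
    have e : (1 - t) • x + t • y = y + (1 - t) • (x - y) := by module
    rw [e]
    refine and_congr_right fun _ => ⟨fun h => ⟨by linarith [h.2], by linarith [h.1]⟩,
      fun h => ⟨by linarith [h.2], by linarith [h.1]⟩⟩
  calc _ = ∫⁻ x in {x | ε ≤ ‖x - y‖}, ((volume : Measure ℝ).restrict (Icc 0 (1 / 2)))
        (Prod.mk x ⁻¹' {q | (1 - q.2) • q.1 + q.2 • y ∈ A}) ∂(coneMeasure Ω a) :=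
        Measure.prod_apply hm
    _ ≤ ∫⁻ x in {x | ε ≤ ‖x - y‖}, ((2 : ℝ≥0∞) ^ d) *
        gaugeLaw d (Prod.mk x ⁻¹' {q : 𝔼[d] × ℝ | y + q.2 • (q.1 - y) ∈ A}) ∂(coneMeasure Ω a) :=
        lintegral_mono hslice
    _ = (2 : ℝ≥0∞) ^ d * ((coneMeasure Ω a).restrict {x | ε ≤ ‖x - y‖}).prod (gaugeLaw d)
        {q : 𝔼[d] × ℝ | y + q.2 • (q.1 - y) ∈ A} := by
        rw [lintegral_const_mul' _ _ (by simp), Measure.prod_apply hm']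
    _ = (2 : ℝ≥0∞) ^ d * (volume.restrict ((fun w => a + w) ⁻¹' Ω))
        {z | ε ≤ ‖radial Ω a z - y‖ ∧ y + gaugeFrom Ω a z • (radial Ω a z - y) ∈ A} := by
        have hset : MeasurableSet ({x : 𝔼[d] | ε ≤ ‖x - y‖} ×ˢ (univ : Set ℝ)) :=
          hSm.prod MeasurableSet.univ
        have e1 : ((coneMeasure Ω a).restrict {x | ε ≤ ‖x - y‖}).prod (gaugeLaw d) =
            ((coneMeasure Ω a).prod (gaugeLaw d)).restrict ({x : 𝔼[d] | ε ≤ ‖x - y‖} ×ˢ univ) := by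
          rw [← Measure.prod_restrict, Measure.restrict_univ]
        rw [e1, Measure.restrict_apply hm', ← map_radial_gaugeFrom hd hΩ ha,
          Measure.map_apply (hrm.prodMk hjm) (hm'.inter hset)]
        congr 2
        ext z
        simp only [mem_preimage, mem_inter_iff, mem_ofPred_eq, mem_prod, mem_univ, and_true]
        tauto
    _ ≤ (2 : ℝ≥0∞) ^ d * (ENNReal.ofReal (C / ε ^ 2) * volume A) := by
        refine mul_le_mul_right ?_ _
        exact (Measure.restrict_apply_le _ _).trans (hvol y hy ε hε A hA)
    _ = ENNReal.ofReal (2 ^ d * C / ε ^ 2) * volume A := by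
        rw [← mul_assoc, mul_div_assoc, ENNReal.ofReal_mul (by positivity),
          ENNReal.ofReal_pow (by norm_num)]
        norm_num

end SingleTarget

/-! ### Boundary points from which two rays start are negligible -/

section Branching

variable {Ω : Set 𝔼[d]} {a : 𝔼[d]} {N : Seminorm ℝ 𝔼[d]} {u : 𝔼[d] → ℝ}

/-- The boundary points from which at least two distinct transport rays of `u` start. -/
def branchSet (Ω : Set 𝔼[d]) (N : Seminorm ℝ 𝔼[d]) (u : 𝔼[d] → ℝ) : Set 𝔼[d] :=
  {x | ∃ y₁ y₂, y₁ ≠ y₂ ∧ (x, y₁) ∈ raySet Ω N u ∧ (x, y₂) ∈ raySet Ω N u}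

theorem measurableSet_branchSet (hΩ : IsUniformlyConvexDomain Ω) (hu : IsPotential N u) :
    MeasurableSet (branchSet Ω N u) := by
  -- the set is a countable union of projections of compact sets
  have huc := hu.continuous
  have hNc := continuous_seminorm N
  set T : ℕ → Set (𝔼[d] × 𝔼[d] × 𝔼[d]) := fun n =>
    (frontier Ω ×ˢ frontier Ω ×ˢ frontier Ω) ∩
      {q | (u q.1 - u q.2.1 = N (q.1 - q.2.1) ∧ u q.1 - u q.2.2 = N (q.1 - q.2.2)) ∧
        1 / ((n : ℝ) + 1) ≤ ‖q.1 - q.2.1‖ ∧ 1 / ((n : ℝ) + 1) ≤ ‖q.1 - q.2.2‖ ∧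
        1 / ((n : ℝ) + 1) ≤ ‖q.2.1 - q.2.2‖} with hT
  have hTc : ∀ n, IsCompact (T n) := fun n => by
    have hF := isCompact_frontier_domain hΩ
    have e₁ : IsClosed {q : 𝔼[d] × 𝔼[d] × 𝔼[d] | u q.1 - u q.2.1 = N (q.1 - q.2.1)} :=
      isClosed_eq (by fun_prop) (by fun_prop)
    have e₂ : IsClosed {q : 𝔼[d] × 𝔼[d] × 𝔼[d] | u q.1 - u q.2.2 = N (q.1 - q.2.2)} :=
      isClosed_eq (by fun_prop) (by fun_prop)
    have c₁ : IsClosed {q : 𝔼[d] × 𝔼[d] × 𝔼[d] | 1 / ((n : ℝ) + 1) ≤ ‖q.1 - q.2.1‖} :=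
      isClosed_le continuous_const (by fun_prop)
    have c₂ : IsClosed {q : 𝔼[d] × 𝔼[d] × 𝔼[d] | 1 / ((n : ℝ) + 1) ≤ ‖q.1 - q.2.2‖} :=
      isClosed_le continuous_const (by fun_prop)
    have c₃ : IsClosed {q : 𝔼[d] × 𝔼[d] × 𝔼[d] | 1 / ((n : ℝ) + 1) ≤ ‖q.2.1 - q.2.2‖} :=
      isClosed_le continuous_const (by fun_prop)
    exact (hF.prod (hF.prod hF)).inter_right ((e₁.inter e₂).inter (c₁.inter (c₂.inter c₃)))
  have hB : branchSet Ω N u = ⋃ n, Prod.fst '' T n := by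
    ext x
    simp only [mem_iUnion, mem_image]
    constructor
    · rintro ⟨y₁, y₂, hne, ⟨⟨hx, hy₁, hne₁⟩, h₁⟩, ⟨⟨-, hy₂, hne₂⟩, h₂⟩⟩
      simp only at hx hy₁ hy₂ hne₁ hne₂
      have hpos : 0 < min ‖x - y₁‖ (min ‖x - y₂‖ ‖y₁ - y₂‖) :=
        lt_min (norm_pos_iff.2 (sub_ne_zero.2 hne₁))
          (lt_min (norm_pos_iff.2 (sub_ne_zero.2 hne₂)) (norm_pos_iff.2 (sub_ne_zero.2 hne)))
      obtain ⟨n, hn⟩ := exists_nat_one_div_lt hpos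
      rw [lt_min_iff, lt_min_iff] at hn
      exact ⟨n, (x, y₁, y₂), ⟨⟨hx, hy₁, hy₂⟩, ⟨h₁, h₂⟩, hn.1.le, hn.2.1.le, hn.2.2.le⟩, rfl⟩
    · rintro ⟨n, ⟨x', y₁, y₂⟩, ⟨⟨hx, hy₁, hy₂⟩, ⟨h₁, h₂⟩, h3, h4, h5⟩, rfl⟩
      simp only at hx hy₁ hy₂ h₁ h₂ h3 h4 h5
      have hn : (0 : ℝ) < 1 / ((n : ℝ) + 1) := by positivity
      exact ⟨y₁, y₂, sub_ne_zero.1 (norm_pos_iff.1 (hn.trans_le h5)),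
        ⟨⟨hx, hy₁, sub_ne_zero.1 (norm_pos_iff.1 (hn.trans_le h3))⟩, h₁⟩,
        ⟨⟨hx, hy₂, sub_ne_zero.1 (norm_pos_iff.1 (hn.trans_le h4))⟩, h₂⟩⟩
  rw [hB]
  exact MeasurableSet.iUnion fun n =>
    ((hTc n).image continuous_fst).isClosed.measurableSet

theorem lipschitzOnWith_radial (hΩ : IsUniformlyConvexDomain Ω) (ha : a ∈ interior Ω) {ρ : ℝ}
    (hρ : 0 < ρ) : ∃ C : ℝ≥0, LipschitzOnWith C (radial Ω a) {z | ρ < ‖z‖} := by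
  obtain ⟨R, hR, hRb⟩ := exists_norm_sub_le hΩ a
  obtain ⟨L, hL⟩ := lipschitzWith_gaugeFrom hΩ ha
  have hne : ∀ z : 𝔼[d], ρ < ‖z‖ → z ≠ 0 := fun z hz => norm_pos_iff.1 (hρ.trans hz)
  have hbd : ∀ z : 𝔼[d], ρ < ‖z‖ → ‖(gaugeFrom Ω a z)⁻¹ • z‖ ≤ R := fun z hz => by
    have := hRb _ (frontier_subset_domain hΩ (radial_mem_frontier hΩ ha (hne z hz)))
    rwa [radial, add_sub_cancel_left] at this
  refine ⟨((1 + R * L) * (R / ρ)).toNNReal, LipschitzOnWith.of_dist_le_mul fun z hz z' hz' => ?_⟩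
  rw [Real.coe_toNNReal _ (by positivity)]
  have hj := gaugeFrom_pos hΩ ha (hne z hz)
  have hj' := gaugeFrom_pos hΩ ha (hne z' hz')
  have hjρ : (gaugeFrom Ω a z)⁻¹ ≤ R / ρ := by
    have h1 := hbd z hz
    rw [norm_smul, norm_inv, Real.norm_of_nonneg hj.le] at h1
    rw [le_div_iff₀ hρ]
    exact (mul_le_mul_of_nonneg_left (le_of_lt hz) (inv_nonneg.2 hj.le)).trans h1
  have hLip := hL.dist_le_mul z' z
  rw [Real.dist_eq, dist_eq_norm] at hLip
  have e : radial Ω a z - radial Ω a z' = (gaugeFrom Ω a z)⁻¹ • ((z - z') +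
      (gaugeFrom Ω a z' - gaugeFrom Ω a z) • ((gaugeFrom Ω a z')⁻¹ • z')) := by
    have h1 : (gaugeFrom Ω a z' - gaugeFrom Ω a z) • ((gaugeFrom Ω a z')⁻¹ • z') =
        z' - gaugeFrom Ω a z • ((gaugeFrom Ω a z')⁻¹ • z') := by
      rw [sub_smul]
      congr 1
      rw [smul_smul, mul_inv_cancel₀ hj'.ne', one_smul]
    rw [h1, sub_add_sub_cancel, smul_sub, smul_smul (gaugeFrom Ω a z)⁻¹ (gaugeFrom Ω a z),
      inv_mul_cancel₀ hj.ne', one_smul, radial, radial]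
    abel
  rw [dist_eq_norm, e, norm_smul, norm_inv, Real.norm_of_nonneg hj.le, dist_eq_norm]
  calc (gaugeFrom Ω a z)⁻¹ * ‖_‖ ≤ (R / ρ) * (‖z - z'‖ + L * ‖z' - z‖ * R) := by
        refine mul_le_mul hjρ ((norm_add_le _ _).trans (add_le_add le_rfl ?_)) (norm_nonneg _)
          (by positivity)
        rw [norm_smul, Real.norm_eq_abs]
        exact mul_le_mul hLip (hbd z' hz') (norm_nonneg _) (by positivity)
    _ = (1 + R * L) * (R / ρ) * ‖z - z'‖ := by rw [norm_sub_rev z' z]; ring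

theorem ae_differentiableAt_comp_radial (hΩ : IsUniformlyConvexDomain Ω) (ha : a ∈ interior Ω)
    (hu : IsPotential N u) :
    ∀ᵐ z : 𝔼[d], z ≠ 0 → DifferentiableAt ℝ (fun w => u (radial Ω a w)) z := by
  obtain ⟨Cu, hCu⟩ := hu.lipschitzWith
  have h : ∀ n : ℕ, ∀ᵐ z : 𝔼[d], z ∈ {z : 𝔼[d] | 1 / ((n : ℝ) + 1) < ‖z‖} →
      DifferentiableWithinAt ℝ (fun w => u (radial Ω a w))
        {z : 𝔼[d] | 1 / ((n : ℝ) + 1) < ‖z‖} z := by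
    intro n
    obtain ⟨C, hC⟩ := lipschitzOnWith_radial hΩ ha (ρ := 1 / ((n : ℝ) + 1)) (by positivity)
    exact (hCu.comp_lipschitzOnWith hC).ae_differentiableWithinAt_of_mem
  filter_upwards [ae_all_iff.2 h] with z hz hz0
  obtain ⟨n, hn⟩ := exists_nat_one_div_lt (norm_pos_iff.2 hz0)
  refine (hz n hn).differentiableAt ?_
  exact (isOpen_lt continuous_const continuous_norm).mem_nhds hn

/-- The potential is touched from above at `x` by `N (· - y) + u y`; this bounds its derivative in
the tangential direction `τ`, even where `N` is not differentiable. -/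
theorem fderiv_comp_radial_le (hΩ : IsUniformlyConvexDomain Ω) (ha : a ∈ interior Ω)
    (hu : IsPotential N u) {z y τ : 𝔼[d]} (hz : z ≠ 0) (hj : DifferentiableAt ℝ (gaugeFrom Ω a) z)
    (hv : DifferentiableAt ℝ (fun w => u (radial Ω a w)) z)
    (hc : (radial Ω a z, y) ∈ contactSet N u) (hτ : fderiv ℝ (gaugeFrom Ω a) z τ = 0) :
    fderiv ℝ (fun w => u (radial Ω a w)) z (gaugeFrom Ω a z • τ) ≤
      N (radial Ω a z - y + τ) - N (radial Ω a z - y) := by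
  have hjpos := gaugeFrom_pos hΩ ha hz
  set x := radial Ω a z with hx
  set h := gaugeFrom Ω a z • τ with hh
  obtain ⟨C, hC, hCN⟩ := seminorm_le_mul_norm N
  have hcurve : HasDerivAt (fun s : ℝ => z + s • h) h 0 := by
    simpa using ((hasDerivAt_id (0 : ℝ)).smul_const h).const_add z
  have hz0 : z + (0 : ℝ) • h = z := by simp
  -- derivative of the potential along the curve
  have h1 : HasDerivAt (fun s : ℝ => u (radial Ω a (z + s • h)))
      (fderiv ℝ (fun w => u (radial Ω a w)) z h) 0 := by
    have h5 : HasFDerivAt (fun w => u (radial Ω a w)) (fderiv ℝ (fun w => u (radial Ω a w)) z)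
      (z + (0 : ℝ) • h) := by rw [hz0]; exact hv.hasFDerivAt
    exact HasFDerivAt.comp_hasDerivAt (l := fun w => u (radial Ω a w)) (0 : ℝ) h5 hcurve
  -- derivative of the radial projection along the curve
  have h2 : HasDerivAt (fun s : ℝ => radial Ω a (z + s • h)) τ 0 := by
    have h5 : HasFDerivAt (gaugeFrom Ω a) (fderiv ℝ (gaugeFrom Ω a) z) (z + (0 : ℝ) • h) := by
      rw [hz0]; exact hj.hasFDerivAt
    have h6 : HasDerivAt (fun s : ℝ => gaugeFrom Ω a (z + s • h)) 0 0 := by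
      have := h5.comp_hasDerivAt (0 : ℝ) hcurve
      rw [hh, map_smul, hτ, smul_zero, ← hh] at this
      exact this
    have h7 := ((h6.fun_inv (by rw [hz0]; exact hjpos.ne')).fun_smul hcurve).const_add a
    rw [hz0] at h7
    have h8 : (gaugeFrom Ω a z)⁻¹ • h + (-0 / gaugeFrom Ω a z ^ 2) • z = τ := by
      rw [hh, smul_smul, inv_mul_cancel₀ hjpos.ne']; simp
    rw [h8] at h7
    exact h7
  have h1' := h1.hasDerivWithinAt (s := Ioi 0)
  have h2' := h2.hasDerivWithinAt (s := Ioi 0)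
  rw [hasDerivWithinAt_iff_tendsto_slope' (by simp)] at h1' h2'
  have h3 : Tendsto (fun s => N (x - y + τ) - N (x - y) +
      C * ‖slope (fun s : ℝ => radial Ω a (z + s • h)) 0 s - τ‖) (𝓝[>] 0)
      (𝓝 (N (x - y + τ) - N (x - y) + C * ‖τ - τ‖)) :=
    (((h2'.sub_const τ).norm).const_mul C).const_add _
  rw [sub_self, norm_zero, mul_zero, add_zero] at h3
  refine le_of_tendsto_of_tendsto h1' h3 ?_
  have hlt1 : ∀ᶠ s : ℝ in 𝓝[>] 0, s < 1 :=
    nhdsWithin_le_nhds (eventually_lt_nhds (zero_lt_one' ℝ))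
  filter_upwards [self_mem_nhdsWithin, hlt1] with s hs hs1
  have hs : (0 : ℝ) < s := hs
  rw [slope_def_field, slope_def_module, sub_zero, hz0, ← hx, div_le_iff₀ hs]
  set X := radial Ω a (z + s • h) with hX
  have hc' : u x - u y = N (x - y) := hc
  have h4 := hu X y
  have h5 : X - y = ((1 - s) • (x - y) + s • (x - y + τ)) + (X - x - s • τ) := by module
  have h6 : N (X - y) ≤ ((1 - s) * N (x - y) + s * N (x - y + τ)) + C * ‖X - x - s • τ‖ := by
    rw [h5]
    refine (map_add_le_add _ _ _).trans (add_le_add ((map_add_le_add _ _ _).trans ?_) (hCN _))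
    rw [map_smul_eq_mul, map_smul_eq_mul, Real.norm_of_nonneg hs.le,
      Real.norm_of_nonneg (by linarith)]
  have h7 : ‖X - x - s • τ‖ = ‖s⁻¹ • (X - x) - τ‖ * s := by
    have : X - x - s • τ = s • (s⁻¹ • (X - x) - τ) := by
      rw [smul_sub, smul_smul, mul_inv_cancel₀ hs.ne', one_smul]
    rw [this, norm_smul, Real.norm_of_nonneg hs.le, mul_comm]
  rw [h7] at h6
  nlinarith

/-- At a point where the boundary and the potential are differentiable, the tangential derivative
of the potential together with the strict convexity of `N` determines the direction of the ray. -/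
theorem radial_notMem_branchSet (hΩ : IsUniformlyConvexDomain Ω) (ha : a ∈ interior Ω)
    (hN : IsStrictlyConvexNorm N) (hu : IsPotential N u) {z : 𝔼[d]} (hz : z ≠ 0)
    (hj : DifferentiableAt ℝ (gaugeFrom Ω a) z)
    (hv : DifferentiableAt ℝ (fun w => u (radial Ω a w)) z) :
    radial Ω a z ∉ branchSet Ω N u := by
  rintro ⟨y₁, y₂, hne, ⟨⟨hx, hy₁, hne₁⟩, h₁⟩, ⟨⟨-, hy₂, hne₂⟩, h₂⟩⟩
  obtain ⟨c, hc, htrans⟩ := one_sub_fderiv_gaugeFrom_ge hΩ ha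
  have key₁ := fun τ hτ => fderiv_comp_radial_le hΩ ha hu (τ := τ) hz hj hv h₁ hτ
  have key₂ := fun τ hτ => fderiv_comp_radial_le hΩ ha hu (τ := τ) hz hj hv h₂ hτ
  have hfx : fderiv ℝ (gaugeFrom Ω a) z (radial Ω a z - a) = 1 := by
    rw [radial, add_sub_cancel_left, map_smul, fderiv_gaugeFrom_self hj, smul_eq_mul,
      inv_mul_cancel₀ (gaugeFrom_pos hΩ ha hz).ne']
  have hpos : ∀ y ∈ frontier Ω, radial Ω a z ≠ y →
      0 < fderiv ℝ (gaugeFrom Ω a) z (radial Ω a z - y) := fun y hy hxy => by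
    have e : radial Ω a z - y = (radial Ω a z - a) - (y - a) := by abel
    rw [e, map_sub, hfx]
    refine lt_of_lt_of_le ?_ (htrans z y hz hj (frontier_subset_domain hΩ hy))
    have := norm_pos_iff.2 (sub_ne_zero.2 hxy)
    positivity
  simp only at hx hy₁ hy₂ hne₁ hne₂
  have hp₁ := hpos y₁ hy₁ hne₁
  have hp₂ := hpos y₂ hy₂ hne₂
  set x := radial Ω a z
  set f := fderiv ℝ (gaugeFrom Ω a) z
  set g := fderiv ℝ (fun w => u (radial Ω a w)) z
  set j := gaugeFrom Ω a z
  -- the tangential vector `w₂ - b w₁`, where `wᵢ = x - yᵢ`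
  obtain ⟨b, hb, hfb⟩ : ∃ b : ℝ, 0 < b ∧ f (x - y₂) = b * f (x - y₁) :=
    ⟨f (x - y₂) / f (x - y₁), div_pos hp₂ hp₁, by field_simp⟩
  set τ := (x - y₂) - b • (x - y₁) with hτ
  have hfτ : f τ = 0 := by rw [hτ, map_sub, map_smul, smul_eq_mul, hfb, sub_self]
  have hray : ¬ SameRay ℝ (x - y₁) (b⁻¹ • (x - y₂)) := by
    intro hr
    obtain ⟨r, hr0, hr1⟩ := hr.exists_pos_left (sub_ne_zero.2 hne₁)
      (smul_ne_zero (inv_pos.2 hb).ne' (sub_ne_zero.2 hne₂))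
    have e1 : y₁ = x + (1 : ℝ) • (y₁ - x) := by module
    have e2 : y₂ = x + (b * r) • (y₁ - x) := by
      have h3 : (b * r) • (x - y₁) = x - y₂ := by
        rw [mul_smul, hr1, smul_smul, mul_inv_cancel₀ hb.ne', one_smul]
      have h4 : (b * r) • (y₁ - x) = -((b * r) • (x - y₁)) := by module
      rw [h4, h3]; abel
    have := eq_of_mem_frontier_of_ray hΩ (frontier_subset_domain hΩ hx) one_pos
      (mul_pos hb hr0) (e1 ▸ hy₁) (e2 ▸ hy₂)
    rw [← e1, ← e2] at this
    exact hne this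
  have hhalf : ∀ w : 𝔼[d], N ((1 / 2 : ℝ) • w) = 1 / 2 * N w := fun w => by
    rw [map_smul_eq_mul, Real.norm_of_nonneg (by norm_num)]
  have hstrict : N ((x - y₁) + b⁻¹ • (x - y₂)) < N (x - y₁) + b⁻¹ * N (x - y₂) := by
    have h3 : N (b⁻¹ • (x - y₂)) = b⁻¹ * N (x - y₂) := by
      rw [map_smul_eq_mul, Real.norm_of_nonneg (by positivity)]
    rw [← h3]
    exact (map_add_le_add _ _ _).lt_of_ne fun h => hray (sameRay_of_seminorm_add_eq hN h)
  have i1 := key₁ ((1 / 2 * b⁻¹ : ℝ) • τ) (by rw [map_smul, hfτ, smul_zero])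
  have i2 := key₂ ((-(1 / 2) : ℝ) • τ) (by rw [map_smul, hfτ, smul_zero])
  have e1 : x - y₁ + (1 / 2 * b⁻¹ : ℝ) • τ = (1 / 2 : ℝ) • ((x - y₁) + b⁻¹ • (x - y₂)) := by
    rw [hτ, smul_sub, smul_smul, mul_assoc, inv_mul_cancel₀ hb.ne']; module
  have e2 : x - y₂ + (-(1 / 2) : ℝ) • τ = (1 / 2 : ℝ) • ((x - y₂) + b • (x - y₁)) := by
    rw [hτ]; module
  have hb2 : N ((x - y₂) + b • (x - y₁)) ≤ N (x - y₂) + b * N (x - y₁) := by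
    refine (map_add_le_add _ _ _).trans (le_of_eq ?_)
    rw [map_smul_eq_mul, Real.norm_of_nonneg hb.le]
  rw [e1, hhalf, smul_comm, map_smul, smul_eq_mul] at i1
  rw [e2, hhalf, smul_comm, map_smul, smul_eq_mul] at i2
  have i3 : b * (1 / 2 * b⁻¹ * g (j • τ)) < b * (1 / 2 * (N (x - y₁) + b⁻¹ * N (x - y₂)) -
      N (x - y₁)) := mul_lt_mul_of_pos_left (by linarith) hb
  have e3 : b * (1 / 2 * b⁻¹ * g (j • τ)) = 1 / 2 * g (j • τ) := by field_simp
  have e4 : b * (1 / 2 * (N (x - y₁) + b⁻¹ * N (x - y₂)) - N (x - y₁)) =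
      1 / 2 * N (x - y₂) - 1 / 2 * (b * N (x - y₁)) := by field_simp; ring
  rw [e3, e4] at i3
  linarith

theorem coneMeasure_branchSet (hd : 1 ≤ d) (hΩ : IsUniformlyConvexDomain Ω) (ha : a ∈ interior Ω)
    (hN : IsStrictlyConvexNorm N) (hu : IsPotential N u) :
    coneMeasure Ω a (branchSet Ω N u) = 0 := by
  have : Nonempty (Fin d) := ⟨⟨0, hd⟩⟩
  rw [coneMeasure_apply hΩ ha (measurableSet_branchSet hΩ hu)]
  refine measure_mono_null inter_subset_right (measure_eq_zero_iff_ae_notMem.2 ?_)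
  have h0 : ∀ᵐ z : 𝔼[d], z ≠ 0 := by rw [ae_iff]; simp
  filter_upwards [h0, ae_differentiableAt_gaugeFrom hΩ ha,
    ae_differentiableAt_comp_radial hΩ ha hu] with z hz hj hv
  exact radial_notMem_branchSet hΩ ha hN hu hz hj (hv hz)

theorem coneMeasure_singleton (hd : 2 ≤ d) (hΩ : IsUniformlyConvexDomain Ω) (ha : a ∈ interior Ω)
    (x : 𝔼[d]) : coneMeasure Ω a {x} = 0 := by
  rw [coneMeasure_apply hΩ ha (measurableSet_singleton x)]
  refine measure_mono_null (t := (Submodule.span ℝ {x - a} : Submodule ℝ 𝔼[d])) ?_ ?_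
  · rintro z ⟨-, hz⟩
    have hz : radial Ω a z = x := hz
    rw [SetLike.mem_coe, Submodule.mem_span_singleton]
    by_cases hz0 : z = 0
    · exact ⟨0, by simp [hz0]⟩
    · refine ⟨gaugeFrom Ω a z, ?_⟩
      rw [← hz, radial, add_sub_cancel_left, smul_smul,
        mul_inv_cancel₀ (gaugeFrom_pos hΩ ha hz0).ne', one_smul]
  · refine Measure.addHaar_submodule _ _ fun h => ?_
    have h1 := finrank_span_le_card (R := ℝ) ({x - a} : Set 𝔼[d])
    rw [h, finrank_top, finrank_euclideanSpace_fin] at h1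
    simp at h1
    omega

end Branching

/-! ### The semi-discrete transport problem -/

section SemiDiscrete

variable {Ω : Set 𝔼[d]} {a : 𝔼[d]} {N : Seminorm ℝ 𝔼[d]} {ι : Type*} [Fintype ι] [Nonempty ι]

/-- The largest potential `u` with `u (y i) ≤ - ψ i` for all `i`. -/
noncomputable def minPotential (N : Seminorm ℝ 𝔼[d]) (y : ι → 𝔼[d]) (ψ : ι → ℝ) (x : 𝔼[d]) : ℝ :=
  Finset.univ.inf' Finset.univ_nonempty fun i => N (x - y i) - ψ i

/-- The set of points for which the target `y i` is optimal. -/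
def cell (N : Seminorm ℝ 𝔼[d]) (y : ι → 𝔼[d]) (ψ : ι → ℝ) (i : ι) : Set 𝔼[d] :=
  {x | N (x - y i) - ψ i ≤ minPotential N y ψ x}

/-- The dual (Kantorovich) functional of the semi-discrete problem. -/
noncomputable def dualValue (N : Seminorm ℝ 𝔼[d]) (f : Measure 𝔼[d]) (y : ι → 𝔼[d]) (m : ι → ℝ≥0)
    (ψ : ι → ℝ) : ℝ := ∫ x, minPotential N y ψ x ∂f + ∑ i, m i * ψ i

variable {y : ι → 𝔼[d]} {ψ φ : ι → ℝ}

theorem minPotential_le (x : 𝔼[d]) (i : ι) : minPotential N y ψ x ≤ N (x - y i) - ψ i :=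
  Finset.inf'_le _ (Finset.mem_univ i)

theorem le_minPotential {x : 𝔼[d]} {r : ℝ} (h : ∀ i, r ≤ N (x - y i) - ψ i) :
    r ≤ minPotential N y ψ x :=
  Finset.le_inf' _ _ fun i _ => h i

theorem exists_minPotential_eq (x : 𝔼[d]) : ∃ i, minPotential N y ψ x = N (x - y i) - ψ i := by
  obtain ⟨i, -, hi⟩ := Finset.exists_mem_eq_inf' Finset.univ_nonempty
    fun i => N (x - y i) - ψ i
  exact ⟨i, hi⟩

theorem isPotential_minPotential : IsPotential N (minPotential N y ψ) := by
  intro x x'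
  obtain ⟨i, hi⟩ := exists_minPotential_eq (N := N) (y := y) (ψ := ψ) x'
  have h1 := minPotential_le (N := N) (y := y) (ψ := ψ) x i
  have h2 : N (x - y i) ≤ N (x - x') + N (x' - y i) := by
    have := map_add_le_add N (x - x') (x' - y i)
    rwa [sub_add_sub_cancel] at this
  linarith

theorem abs_minPotential_sub_le (x : 𝔼[d]) :
    |minPotential N y ψ x - minPotential N y φ x| ≤ ‖ψ - φ‖ := by
  have key : ∀ ψ φ : ι → ℝ, minPotential N y ψ x - ‖ψ - φ‖ ≤ minPotential N y φ x := fun ψ φ => by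
    refine le_minPotential fun i => ?_
    have h1 := minPotential_le (N := N) (y := y) (ψ := ψ) x i
    have h2 := (abs_le.1 (Real.norm_eq_abs _ ▸ norm_le_pi_norm (ψ - φ) i)).1
    simp only [Pi.sub_apply] at h2
    linarith
  have h1 := key ψ φ
  have h2 := key φ ψ
  rw [norm_sub_rev] at h2
  exact abs_le.2 ⟨by linarith, by linarith⟩

theorem contactSet_of_mem_cell {x : 𝔼[d]} {i : ι} (hx : x ∈ cell N y ψ i) :
    (x, y i) ∈ contactSet N (minPotential N y ψ) := by
  have hx : N (x - y i) - ψ i ≤ minPotential N y ψ x := hx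
  have h1 := minPotential_le (N := N) (y := y) (ψ := ψ) (y i) i
  rw [sub_self, map_zero] at h1
  have h2 := isPotential_minPotential (N := N) (y := y) (ψ := ψ) x (y i)
  exact le_antisymm h2 (by simp only; linarith)

theorem isClosed_cell (i : ι) : IsClosed (cell N y ψ i) := by
  have h1 := (isPotential_minPotential (N := N) (y := y) (ψ := ψ)).continuous
  have h2 := continuous_seminorm N
  exact isClosed_le (by fun_prop) (by fun_prop)

theorem iUnion_cell : ⋃ i, cell N y ψ i = univ :=
  eq_univ_of_forall fun x => mem_iUnion.2 <|
    (exists_minPotential_eq (N := N) (y := y) (ψ := ψ) x).imp fun _ h => h.ge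

theorem IsPotential.integrable {u : 𝔼[d] → ℝ} (hu : IsPotential N u)
    (hΩ : IsUniformlyConvexDomain Ω)
    {f : Measure 𝔼[d]} [IsFiniteMeasure f] (hf : ∀ᵐ x ∂f, x ∈ frontier Ω) : Integrable u f := by
  have h := hu.continuous.continuousOn.integrableOn_compact (μ := f) (isCompact_frontier_domain hΩ)
  rwa [IntegrableOn, Measure.restrict_eq_self_of_ae_mem hf] at h

theorem exists_max_dualValue (hΩ : IsUniformlyConvexDomain Ω) {f : Measure 𝔼[d]} [IsFiniteMeasure f]
    (hf : ∀ᵐ x ∂f, x ∈ frontier Ω) (y : ι → 𝔼[d]) (m : ι → ℝ≥0)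
      (hm : ∑ i, (m i : ℝ) = f.real univ) :
    ∃ ψ, ∀ φ, dualValue N f y m φ ≤ dualValue N f y m ψ := by
  have hint : ∀ ψ, Integrable (minPotential N y ψ) f := fun ψ =>
    isPotential_minPotential.integrable hΩ hf
  have hcont : Continuous (dualValue N f y m) := by
    refine Continuous.add ?_ (by fun_prop)
    refine (LipschitzWith.of_dist_le_mul (K := (f.real univ).toNNReal) fun ψ φ => ?_).continuous
    rw [Real.dist_eq, ← integral_sub (hint _) (hint _), ← Real.norm_eq_abs,
      Real.coe_toNNReal _ measureReal_nonneg, mul_comm, dist_eq_norm]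
    exact norm_integral_le_of_norm_le_const (Eventually.of_forall abs_minPotential_sub_le)
  let i₀ : ι := Classical.arbitrary ι
  set R : ℝ := ∑ i, N (y i - y i₀) with hR
  have hRi : ∀ i, N (y i - y i₀) ≤ R := fun i =>
    Finset.single_le_sum (f := fun i => N (y i - y i₀)) (fun _ _ => apply_nonneg _ _)
      (Finset.mem_univ i)
  obtain ⟨ψ, -, hψ⟩ := (isCompact_Icc (a := fun _ : ι => -R) (b := fun _ : ι => R)).exists_isMaxOn
    ⟨0, fun _ => by simp; exact Finset.sum_nonneg fun _ _ => apply_nonneg _ _,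
      fun _ => Finset.sum_nonneg fun _ _ => apply_nonneg _ _⟩ hcont.continuousOn
  refine ⟨ψ, fun φ => ?_⟩
  -- replacing `φ` by the values of its potential, normalised at `i₀`, brings it into the box
  set u := minPotential N y φ with hu
  have hup : IsPotential N u := isPotential_minPotential
  set φ' : ι → ℝ := fun i => u (y i₀) - u (y i) with hφ'
  have hbox : φ' ∈ Icc (fun _ : ι => -R) (fun _ : ι => R) := by
    refine ⟨fun i => ?_, fun i => ?_⟩
    · have := (hup (y i) (y i₀)).trans (hRi i)
      simp only [hφ']; linarith
    · have h := hup (y i₀) (y i)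
      rw [map_sub_rev] at h
      exact h.trans (hRi i)
  refine le_trans ?_ (hψ hbox)
  have h1 : ∀ x, u x - u (y i₀) ≤ minPotential N y φ' x := fun x => by
    refine le_minPotential fun i => ?_
    have := hup x (y i)
    simp only [hφ']; linarith
  have h2 : ∀ i, φ i ≤ φ' i - u (y i₀) := fun i => by
    have := minPotential_le (N := N) (y := y) (ψ := φ) (y i) i
    rw [sub_self, map_zero, ← hu] at this
    simp only [hφ']; linarith
  have h3 : ∫ x, u x ∂f - u (y i₀) * f.real univ ≤ ∫ x, minPotential N y φ' x ∂f := by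
    have : ∫ x, u x ∂f - u (y i₀) * f.real univ = ∫ x, (u x - u (y i₀)) ∂f := by
      rw [integral_sub (hint φ) (integrable_const _), integral_const, smul_eq_mul, mul_comm]
    rw [this]
    exact integral_mono ((hint φ).sub (integrable_const _)) (hint φ') h1
  have h4 : ∑ i, (m i : ℝ) * φ i ≤ ∑ i, (m i : ℝ) * φ' i - u (y i₀) * f.real univ := by
    rw [← hm, Finset.mul_sum, ← Finset.sum_sub_distrib]
    refine Finset.sum_le_sum fun i _ => ?_
    have := mul_le_mul_of_nonneg_left (h2 i) (m i).coe_nonneg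
    linarith
  simp only [dualValue]
  rw [← hu]
  linarith

/-- First order condition at a maximum of the dual functional. -/
theorem le_measure_cell (hΩ : IsUniformlyConvexDomain Ω) {f : Measure 𝔼[d]} [IsFiniteMeasure f]
    (hf : ∀ᵐ x ∂f, x ∈ frontier Ω) {m : ι → ℝ≥0}
    (hψ : ∀ φ, dualValue N f y m φ ≤ dualValue N f y m ψ) (i : ι) :
    (m i : ℝ≥0∞) ≤ f (cell N y ψ i) := by
  classical
  have hint : ∀ ψ, Integrable (minPotential N y ψ) f := fun ψ =>
    isPotential_minPotential.integrable hΩ hf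
  have hcont : ∀ ψ, Continuous (minPotential N y ψ) := fun ψ => isPotential_minPotential.continuous
  have hNc := continuous_seminorm N
  set A : ℝ → Set 𝔼[d] := fun s => {x | N (x - y i) - ψ i < minPotential N y ψ x + s} with hA
  have hAm : ∀ s, MeasurableSet (A s) := fun s => by
    have := hcont ψ
    exact (isOpen_lt (by fun_prop) (by fun_prop)).measurableSet
  have key : ∀ s : ℝ, 0 < s → (m i : ℝ≥0∞) ≤ f (A s) := by
    intro s hs
    set φ : ι → ℝ := ψ + Pi.single i s with hφ
    have hpt : ∀ x, minPotential N y ψ x - minPotential N y φ x ≤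
        (A s).indicator (fun _ => s) x := by
      intro x
      by_cases hx : x ∈ A s
      · rw [indicator_of_mem hx]
        have : minPotential N y ψ x - s ≤ minPotential N y φ x := by
          refine le_minPotential fun k => ?_
          have h1 := minPotential_le (N := N) (y := y) (ψ := ψ) x k
          have h2 : φ k ≤ ψ k + s := by
            rw [hφ, Pi.add_apply]
            by_cases hk : k = i
            · subst hk; simp
            · simp [hk, hs.le]
          linarith
        linarith
      · rw [indicator_of_notMem hx]
        have hx' : minPotential N y ψ x + s ≤ N (x - y i) - ψ i := not_lt.1 hx
        have : minPotential N y ψ x ≤ minPotential N y φ x := by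
          refine le_minPotential fun k => ?_
          by_cases hk : k = i
          · subst hk; rw [hφ]; simp only [Pi.add_apply, Pi.single_eq_same]; linarith
          · have h1 := minPotential_le (N := N) (y := y) (ψ := ψ) x k
            rw [hφ]; simpa [hk] using h1
        linarith
    have h1 := hψ φ
    have h2 : ∑ k, (m k : ℝ) * φ k = ∑ k, (m k : ℝ) * ψ k + m i * s := by
      simp only [hφ, Pi.add_apply, mul_add, Finset.sum_add_distrib]
      congr 1
      rw [Finset.sum_eq_single i] <;> simp +contextual
    have h3 : ∫ x, minPotential N y ψ x ∂f - ∫ x, minPotential N y φ x ∂f ≤ f.real (A s) * s := by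
      rw [← integral_sub (hint _) (hint _)]
      refine (integral_mono ((hint _).sub (hint _)) ((integrable_const s).indicator (hAm s))
        hpt).trans (le_of_eq ?_)
      rw [integral_indicator (hAm s), setIntegral_const, smul_eq_mul]
    simp only [dualValue] at h1
    have h4 : (m i : ℝ) * s ≤ f.real (A s) * s := by linarith
    have h5 : (m i : ℝ) ≤ f.real (A s) := le_of_mul_le_mul_right h4 hs
    rw [measureReal_def] at h5
    have := ENNReal.ofReal_le_ofReal h5
    rwa [ENNReal.ofReal_coe_nnreal, ENNReal.ofReal_toReal (measure_ne_top _ _)] at this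
  have hanti : Antitone fun n : ℕ => A (1 / ((n : ℝ) + 1)) := fun n k hnk x hx => by
    have h1 : N (x - y i) - ψ i < minPotential N y ψ x + 1 / ((k : ℝ) + 1) := hx
    have h2 := Nat.one_div_le_one_div (α := ℝ) hnk
    exact h1.trans_le (by linarith)
  have hinter : ⋂ n : ℕ, A (1 / ((n : ℝ) + 1)) = cell N y ψ i := by
    ext x
    simp only [mem_iInter]
    constructor
    · intro h
      change N (x - y i) - ψ i ≤ minPotential N y ψ x
      refine le_of_forall_pos_le_add fun ε hε => ?_
      obtain ⟨n, hn⟩ := exists_nat_one_div_lt hε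
      have h1 : N (x - y i) - ψ i < minPotential N y ψ x + 1 / ((n : ℝ) + 1) := h n
      linarith
    · intro h n
      have h1 : N (x - y i) - ψ i ≤ minPotential N y ψ x := h
      have h2 : (0 : ℝ) < 1 / ((n : ℝ) + 1) := by positivity
      change N (x - y i) - ψ i < minPotential N y ψ x + 1 / ((n : ℝ) + 1)
      linarith
  have hlim := tendsto_measure_iInter_atTop (μ := f) (fun n => (hAm _).nullMeasurableSet) hanti
    ⟨0, measure_ne_top _ _⟩
  rw [hinter] at hlim
  exact ge_of_tendsto' hlim fun n => key _ (by positivity)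

theorem ae_mem_frontier_coneMeasure (hd : 1 ≤ d) (hΩ : IsUniformlyConvexDomain Ω)
    (ha : a ∈ interior Ω) : ∀ᵐ x ∂(coneMeasure Ω a), x ∈ frontier Ω := by
  have : Nonempty (Fin d) := ⟨⟨0, hd⟩⟩
  rw [coneMeasure, ae_map_iff (p := fun x => x ∈ frontier Ω)
    (measurable_radial hΩ ha).aemeasurable isClosed_frontier.measurableSet]
  refine ae_restrict_of_ae ?_
  have h0 : ∀ᵐ z : 𝔼[d], z ≠ 0 := by rw [ae_iff]; simp
  filter_upwards [h0] with z hz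
  exact radial_mem_frontier hΩ ha hz

/-- Solution of the semi-discrete problem: a plan that lives on the contact set of a potential. The
tie-breaking between the cells does not matter, because points with two rays are negligible. -/
theorem exists_semidiscrete_plan (hd : 2 ≤ d) (hΩ : IsUniformlyConvexDomain Ω)
    (ha : a ∈ interior Ω) (hN : IsStrictlyConvexNorm N) {f : Measure 𝔼[d]} [IsFiniteMeasure f]
    (hf : f ≪ coneMeasure Ω a) {y : ι → 𝔼[d]} (hy : Function.Injective y)
    (hyΩ : ∀ i, y i ∈ frontier Ω) (m : ι → ℝ≥0) (hm : ∑ i, (m i : ℝ≥0∞) = f univ) :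
    ∃ (u : 𝔼[d] → ℝ) (γ : Measure (𝔼[d] × 𝔼[d])), IsPotential N u ∧ γ.map Prod.fst = f ∧
      γ.map Prod.snd = Measure.sum (fun i => (m i : ℝ≥0∞) • Measure.dirac (y i)) ∧
      γ (contactSet N u)ᶜ = 0 := by
  have hfr : ∀ᵐ x ∂f, x ∈ frontier Ω :=
    hf.ae_le (ae_mem_frontier_coneMeasure (by omega) hΩ ha)
  have hm' : ∑ i, (m i : ℝ) = f.real univ := by
    rw [measureReal_def, ← hm, ENNReal.toReal_sum (by simp)]
    simp
  obtain ⟨ψ, hψ⟩ := exists_max_dualValue (N := N) hΩ hfr y m hm'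
  have hle := le_measure_cell hΩ hfr hψ
  set u := minPotential N y ψ with hu
  have hup : IsPotential N u := isPotential_minPotential
  have hcm : ∀ i, MeasurableSet (cell N y ψ i) := fun i => (isClosed_cell i).measurableSet
  have hdisj : Pairwise (Function.onFun (AEDisjoint f) (cell N y ψ)) := by
    intro i k hik
    have hnull : f (branchSet Ω N u ∪ {y i} ∪ {y k} ∪ (frontier Ω)ᶜ) = 0 := by
      refine measure_union_null (measure_union_null (measure_union_null ?_ ?_) ?_) hfr
      · exact hf (coneMeasure_branchSet (by omega) hΩ ha hN hup)
      · exact hf (coneMeasure_singleton hd hΩ ha _)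
      · exact hf (coneMeasure_singleton hd hΩ ha _)
    refine measure_mono_null ?_ hnull
    rintro x ⟨h1, h2⟩
    by_contra hx
    simp only [mem_union, mem_singleton_iff, not_or, mem_compl_iff, not_not] at hx
    obtain ⟨⟨⟨hx1, hx2⟩, hx3⟩, hx4⟩ := hx
    exact hx1 ⟨y i, y k, hy.ne hik, ⟨⟨hx4, hyΩ i, hx2⟩, contactSet_of_mem_cell h1⟩,
      ⟨⟨hx4, hyΩ k, hx3⟩, contactSet_of_mem_cell h2⟩⟩
  have hsum : Measure.sum (fun i => f.restrict (cell N y ψ i)) = f := by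
    rw [← Measure.restrict_iUnion_ae hdisj fun i => (hcm i).nullMeasurableSet, iUnion_cell,
      Measure.restrict_univ]
  -- the cells have exactly the prescribed masses, since they have no less and the total is right
  have hcell : ∀ i, f (cell N y ψ i) = m i := by
    have htot : ∑ i, f (cell N y ψ i) = f univ := by
      conv_rhs => rw [← hsum]
      rw [Measure.sum_apply _ MeasurableSet.univ, tsum_fintype]
      simp
    have h1 : ∑ i, (m i : ℝ) = ∑ i, (f (cell N y ψ i)).toReal := by
      rw [← ENNReal.toReal_sum fun i _ => measure_ne_top _ _, htot, hm', measureReal_def]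
    have h2 : ∀ i, (m i : ℝ) ≤ (f (cell N y ψ i)).toReal := fun i =>
      ENNReal.toReal_mono (measure_ne_top f (cell N y ψ i)) (hle i)
    intro i
    have h3 := (Finset.sum_eq_sum_iff_of_le fun i _ => h2 i).1 h1 i (Finset.mem_univ i)
    rw [← ENNReal.ofReal_toReal (measure_ne_top f (cell N y ψ i)), ← h3,
      ENNReal.ofReal_coe_nnreal]
  have hpair : ∀ i, Measurable fun x : 𝔼[d] => (x, y i) := fun i => by fun_prop
  refine ⟨u, Measure.sum fun i => (f.restrict (cell N y ψ i)).map fun x => (x, y i), hup,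
    ?_, ?_, ?_⟩
  · rw [Measure.map_sum measurable_fst.aemeasurable]
    conv_rhs => rw [← hsum]
    congr 1
    funext i
    rw [Measure.map_map measurable_fst (hpair i)]
    exact Measure.map_id
  · rw [Measure.map_sum measurable_snd.aemeasurable]
    congr 1
    funext i
    rw [Measure.map_map measurable_snd (hpair i)]
    change Measure.map (fun _ => y i) _ = _
    rw [Measure.map_const, Measure.restrict_apply_univ, hcell]
  · have hcl := (isClosed_contactSet hup).measurableSet.compl
    rw [Measure.sum_apply _ hcl, ENNReal.tsum_eq_zero]
    intro i
    rw [Measure.map_apply (hpair i) hcl, Measure.restrict_apply (hpair i hcl)]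
    convert measure_empty (μ := f)
    ext x
    simp only [mem_inter_iff, mem_preimage, mem_compl_iff, mem_empty_iff_false, iff_false, not_and]
    intro h hx
    exact h (contactSet_of_mem_cell hx)

end SemiDiscrete

/-! ### From finitely many targets to arbitrary target measures -/

section Limit

variable {Ω : Set 𝔼[d]} {a : 𝔼[d]} {N : Seminorm ℝ 𝔼[d]}

theorem exists_plan_simpleFunc (hd : 2 ≤ d) (hΩ : IsUniformlyConvexDomain Ω)
    (ha : a ∈ interior Ω) (hN : IsStrictlyConvexNorm N) {f₁ f₂ : Measure 𝔼[d]} [IsFiniteMeasure f₁]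
    [IsFiniteMeasure f₂] (hmass : f₁ univ = f₂ univ) (hf : f₁ ≪ coneMeasure Ω a)
    (q : SimpleFunc 𝔼[d] 𝔼[d]) (hq : ∀ x, q x ∈ frontier Ω) :
    ∃ (u : 𝔼[d] → ℝ) (γ : Measure (𝔼[d] × 𝔼[d])), IsPotential N u ∧
      IsTransportPlan f₁ (f₂.map q) γ ∧
      γ (contactSet N u)ᶜ = 0 := by
  have : Nonempty q.range := ⟨⟨q 0, q.mem_range_self 0⟩⟩
  have hq' : Measurable fun x => (⟨q x, q.mem_range_self x⟩ : q.range) :=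
    q.measurable.subtype_mk
  set m : q.range → ℝ≥0 := fun i => (f₂ (q ⁻¹' {(i : 𝔼[d])})).toNNReal with hm
  have hmi : ∀ i, (m i : ℝ≥0∞) = f₂ (q ⁻¹' {(i : 𝔼[d])}) := fun i =>
    ENNReal.coe_toNNReal (measure_ne_top _ _)
  have hsum : f₂.map q = Measure.sum fun i : q.range =>
      (m i : ℝ≥0∞) • Measure.dirac (i : 𝔼[d]) := by
    have e : (q : 𝔼[d] → 𝔼[d]) = Subtype.val ∘ fun x => (⟨q x, q.mem_range_self x⟩ : q.range) := rfl
    rw [e, ← Measure.map_map measurable_subtype_coe hq', Measure.map_eq_sum _ _ hq',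
      Measure.map_sum measurable_subtype_coe.aemeasurable]
    congr 1
    funext i
    rw [Measure.map_smul, Measure.map_dirac, hmi]
    congr 2
    ext x
    simp [Subtype.ext_iff]
  have htot : ∑ i, (m i : ℝ≥0∞) = f₁ univ := by
    have h1 : (f₂.map q) univ = f₂ univ := by
      rw [Measure.map_apply q.measurable MeasurableSet.univ, preimage_univ]
    rw [hmass, ← h1, hsum, Measure.sum_apply _ MeasurableSet.univ, tsum_fintype]
    simp
  obtain ⟨u, γ, hu, h1, h2, h3⟩ := exists_semidiscrete_plan hd hΩ ha hN hf
    (y := fun i : q.range => (i : 𝔼[d])) Subtype.coe_injective (fun i => by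
      obtain ⟨x, hx⟩ := SimpleFunc.mem_range.1 i.2
      rw [← hx]; exact hq x) m htot
  exact ⟨u, γ, hu, ⟨h1, h2.trans hsum.symm⟩, h3⟩

theorem exists_simpleFunc_tendsto (hne : (frontier Ω).Nonempty) :
    ∃ q : ℕ → SimpleFunc 𝔼[d] 𝔼[d], (∀ n x, q n x ∈ frontier Ω) ∧
      ∀ x ∈ frontier Ω, Tendsto (fun n => q n x) atTop (𝓝 x) := by
  have : Nonempty (frontier Ω) := hne.to_subtype
  set e : ℕ → 𝔼[d] := fun n => (TopologicalSpace.denseSeq (frontier Ω) n : 𝔼[d]) with he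
  refine ⟨SimpleFunc.nearestPt e, fun n x => ?_, fun x hx => ?_⟩
  · rw [SimpleFunc.nearestPt, SimpleFunc.map_apply]
    exact Subtype.coe_prop _
  · refine SimpleFunc.tendsto_nearestPt ?_
    have h1 := TopologicalSpace.denseRange_denseSeq (frontier Ω)
    have h2 : (⟨x, hx⟩ : frontier Ω) ∈ closure (range (TopologicalSpace.denseSeq (frontier Ω))) :=
      h1 _
    have h3 := image_closure_subset_closure_image continuous_subtype_val (mem_image_of_mem _ h2)
    rwa [← range_comp] at h3

/-- Pointwise limits of normalised potentials along an ultrafilter; on compact sets the convergence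
is uniform by equicontinuity. -/
theorem exists_potential_limit (𝒰 : Ultrafilter ℕ) {u : ℕ → 𝔼[d] → ℝ}
    (hu : ∀ n, IsPotential N (u n))
    {x₀ : 𝔼[d]} (hx₀ : ∀ n, u n x₀ = 0) {K : Set 𝔼[d]} (hK : IsCompact K) :
    ∃ v, IsPotential N v ∧ ∀ δ > 0, ∀ᶠ n in (𝒰 : Filter ℕ), ∀ x ∈ K, |u n x - v x| ≤ δ := by
  have hlim : ∀ x, ∃ l, Tendsto (fun n => u n x) 𝒰 (𝓝 l) := by
    intro x
    have hb : ∀ n, u n x ∈ Icc (-N (x - x₀)) (N (x - x₀)) := fun n => by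
      have h1 := hu n x x₀
      have h2 := hu n x₀ x
      rw [map_sub_rev] at h2
      rw [hx₀] at h1 h2
      exact ⟨by linarith, by linarith⟩
    obtain ⟨l, -, hl⟩ := (isCompact_Icc (a := -N (x - x₀)) (b := N (x - x₀))).ultrafilter_le_nhds'
      (𝒰.map fun n => u n x) (Ultrafilter.mem_map.2 (Filter.univ_mem' hb))
    exact ⟨l, hl⟩
  choose v hv using hlim
  have hvp : IsPotential N v := fun x y => le_of_tendsto' ((hv x).sub (hv y)) fun n => hu n x y
  refine ⟨v, hvp, fun δ hδ => ?_⟩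
  obtain ⟨C, hC, hCN⟩ := seminorm_le_mul_norm N
  have hr : 0 < δ / (3 * C) := by positivity
  have hlip : ∀ {w : 𝔼[d] → ℝ}, IsPotential N w → ∀ {x y : 𝔼[d]}, dist x y < δ / (3 * C) →
      |w x - w y| ≤ δ / 3 := by
    intro w hw x y hxy
    have h1 : N (x - y) ≤ δ / 3 := by
      refine (hCN _).trans ?_
      rw [← dist_eq_norm]
      calc C * dist x y ≤ C * (δ / (3 * C)) := mul_le_mul_of_nonneg_left hxy.le hC.le
        _ = δ / 3 := by field_simp
    have h2 := hw x y
    have h3 := hw y x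
    rw [map_sub_rev] at h3
    exact abs_le.2 ⟨by linarith, by linarith⟩
  obtain ⟨t, -, htfin, htcov⟩ := hK.finite_cover_balls hr
  have hev : ∀ᶠ n in (𝒰 : Filter ℕ), ∀ y ∈ t, |u n y - v y| < δ / 3 := by
    rw [eventually_all_finite htfin]
    intro y _
    have := (hv y).eventually (Metric.ball_mem_nhds (v y) (by positivity : 0 < δ / 3))
    filter_upwards [this] with n hn
    rwa [Real.dist_eq] at hn
  filter_upwards [hev] with n hn x hx
  obtain ⟨y, hy, hxy⟩ := mem_iUnion₂.1 (htcov hx)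
  have hxy := Metric.mem_ball.1 hxy
  have h1 := abs_le.1 (hlip (hu n) hxy)
  have h2 := abs_le.1 (hlip hvp hxy)
  have h3 := abs_lt.1 (hn y hy)
  exact abs_le.2 ⟨by linarith [h1.1, h2.2, h3.1], by linarith [h1.2, h2.1, h3.2]⟩

theorem IsPotential.sub_const {u : 𝔼[d] → ℝ} (hu : IsPotential N u) (c : ℝ) :
    IsPotential N fun x => u x - c := fun x y => by simpa using hu x y

theorem contactSet_sub_const (u : 𝔼[d] → ℝ) (c : ℝ) :
    contactSet N (fun x => u x - c) = contactSet N u := by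
  ext q; simp [contactSet]

/-- A plan is concentrated on pairs of points of a closed set carrying its marginals. -/
theorem ae_mem_prod_of_isTransportPlan {f₁ f₂ : Measure 𝔼[d]} {γ : Measure (𝔼[d] × 𝔼[d])}
    (h : IsTransportPlan f₁ f₂ γ) {F : Set 𝔼[d]} (hF : MeasurableSet F) (h₁ : ∀ᵐ x ∂f₁, x ∈ F)
    (h₂ : ∀ᵐ x ∂f₂, x ∈ F) : ∀ᵐ q ∂γ, q.1 ∈ F ∧ q.2 ∈ F := by
  rw [← h.map_fst, ae_map_iff (p := fun x => x ∈ F) measurable_fst.aemeasurable hF] at h₁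
  rw [← h.map_snd, ae_map_iff (p := fun x => x ∈ F) measurable_snd.aemeasurable hF] at h₂
  filter_upwards [h₁, h₂] with q hq1 hq2 using ⟨hq1, hq2⟩

theorem measure_univ_of_isTransportPlan {f₁ f₂ : Measure 𝔼[d]} {γ : Measure (𝔼[d] × 𝔼[d])}
    (h : IsTransportPlan f₁ f₂ γ) : γ univ = f₁ univ := by
  rw [← h.map_fst, Measure.map_apply measurable_fst MeasurableSet.univ, preimage_univ]

theorem tendsto_map_simpleFunc {f₂ : Measure 𝔼[d]} [IsProbabilityMeasure f₂]
    (hf₂ : ∀ᵐ x ∂f₂, x ∈ frontier Ω) {q : ℕ → SimpleFunc 𝔼[d] 𝔼[d]}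
    (hq : ∀ x ∈ frontier Ω, Tendsto (fun n => q n x) atTop (𝓝 x))
    {F : ProbabilityMeasure 𝔼[d]} (hF : (F : Measure 𝔼[d]) = f₂)
    {Fn : ℕ → ProbabilityMeasure 𝔼[d]} (hFn : ∀ n, (Fn n : Measure 𝔼[d]) = f₂.map (q n)) :
    Tendsto Fn atTop (𝓝 F) := by
  rw [ProbabilityMeasure.tendsto_iff_forall_integral_tendsto]
  intro g
  have e : ∀ n, ∫ x, g x ∂(f₂.map (q n)) = ∫ x, g (q n x) ∂f₂ := fun n =>
    integral_map (q n).measurable.aemeasurable g.continuous.aestronglyMeasurable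
  simp only [hF, hFn, e]
  refine tendsto_integral_of_dominated_convergence (fun _ => ‖g‖) (fun n => ?_)
    (integrable_const _) (fun n => ?_) ?_
  · exact (g.continuous.measurable.comp (q n).measurable).aestronglyMeasurable
  · exact Eventually.of_forall fun x => g.norm_coe_le_norm _
  · filter_upwards [hf₂] with x hx
    exact (g.continuous.tendsto x).comp (hq x hx)

theorem isTightMeasureSet_of_compact {X : Type*} [TopologicalSpace X] [MeasurableSpace X]
    {S : Set (Measure X)} {K : Set X} (hK : IsCompact K) (h : ∀ μ ∈ S, μ Kᶜ = 0) :
    IsTightMeasureSet S :=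
  isTightMeasureSet_iff_exists_isCompact_measure_compl_le.2 fun ε _ =>
    ⟨K, hK, fun μ hμ => by rw [h μ hμ]; exact zero_le⟩

/-- Weak limit of the plans for discretised targets, together with the limit of their potentials. -/
theorem exists_plan_limit_of_isProbabilityMeasure (hd : 2 ≤ d) (hΩ : IsUniformlyConvexDomain Ω)
    (ha : a ∈ interior Ω) (hN : IsStrictlyConvexNorm N) {f₁ f₂ : Measure 𝔼[d]}
    [IsProbabilityMeasure f₁] [IsProbabilityMeasure f₂] (hf₁ : f₁ ≪ coneMeasure Ω a)
    (hf₂ : ∀ᵐ x ∂f₂, x ∈ frontier Ω) :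
    ∃ (u : 𝔼[d] → ℝ) (γ : Measure (𝔼[d] × 𝔼[d])) (un : ℕ → 𝔼[d] → ℝ)
      (γn : ℕ → Measure (𝔼[d] × 𝔼[d])),
      IsPotential N u ∧ IsTransportPlan f₁ f₂ γ ∧ γ (contactSet N u)ᶜ = 0 ∧
      (∀ n, IsPotential N (un n) ∧ (γn n).map Prod.fst = f₁ ∧ γn n (contactSet N (un n))ᶜ = 0 ∧
        ∃ T : Finset 𝔼[d], ↑T ⊆ frontier Ω ∧ ∀ᵐ q ∂(γn n), q.2 ∈ T) ∧
      ∀ O, IsOpen O → γ O ≤ liminf (fun n => γn n O) atTop := by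
  have hfr₁ : ∀ᵐ x ∂f₁, x ∈ frontier Ω :=
    hf₁.ae_le (ae_mem_frontier_coneMeasure (by omega) hΩ ha)
  have hFm : MeasurableSet (frontier Ω) := isClosed_frontier.measurableSet
  have hFc := isCompact_frontier_domain hΩ
  have hne : (frontier Ω).Nonempty := by
    obtain ⟨x, hx⟩ := hfr₁.exists
    exact ⟨x, hx⟩
  obtain ⟨x₀, hx₀⟩ := hne
  obtain ⟨q, hqF, hq⟩ := exists_simpleFunc_tendsto ⟨x₀, hx₀⟩
  choose w γ' hw hplan hcontact using fun n =>
    exists_plan_simpleFunc hd hΩ ha hN (f₂ := f₂) (by simp) hf₁ (q n) (hqF n)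
  have hprob : ∀ n, IsProbabilityMeasure (γ' n) := fun n =>
    ⟨by rw [measure_univ_of_isTransportPlan (hplan n)]; exact measure_univ⟩
  have hfr₂ : ∀ n, ∀ᵐ x ∂(f₂.map (q n)), x ∈ frontier Ω := fun n => by
    rw [ae_map_iff (p := fun x => x ∈ frontier Ω) (q n).measurable.aemeasurable hFm]
    exact Eventually.of_forall fun x => hqF n x
  have hsupp : ∀ n, ∀ᵐ z ∂(γ' n), z.1 ∈ frontier Ω ∧ z.2 ∈ frontier Ω := fun n =>
    ae_mem_prod_of_isTransportPlan (hplan n) hFm hfr₁ (hfr₂ n)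
  set P : ℕ → ProbabilityMeasure (𝔼[d] × 𝔼[d]) := fun n => ⟨γ' n, hprob n⟩ with hP
  -- weak compactness of the plans
  have hcomp : IsCompact (closure (range P)) := by
    refine isCompact_closure_of_isTightMeasureSet
      (isTightMeasureSet_of_compact (hFc.prod hFc) ?_)
    rintro _ ⟨_, ⟨n, rfl⟩, rfl⟩
    exact hsupp n
  obtain ⟨Q, -, σ, hσ, hlim⟩ := hcomp.tendsto_subseq (x := P) fun n => subset_closure ⟨n, rfl⟩
  have hσt := hσ.tendsto_atTop
  -- the marginals of the limit
  have hm₁ : (Q : Measure (𝔼[d] × 𝔼[d])).map Prod.fst = f₁ := by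
    have h1 := ProbabilityMeasure.tendsto_map_of_tendsto_of_continuous _ _ hlim continuous_fst
    set F₁ : ProbabilityMeasure 𝔼[d] := ⟨f₁, inferInstance⟩ with hF₁
    have h2 : ∀ n, (P (σ n)).map (continuous_fst.measurable.aemeasurable
        (μ := (P (σ n) : Measure (𝔼[d] × 𝔼[d])))) = F₁ := fun n =>
      Subtype.ext (hplan (σ n)).map_fst
    simp only [Function.comp_apply, h2] at h1
    have h3 := tendsto_nhds_unique h1 (tendsto_const_nhds (x := F₁))
    exact congrArg (fun R : ProbabilityMeasure 𝔼[d] => (R : Measure 𝔼[d])) h3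
  have hm₂ : (Q : Measure (𝔼[d] × 𝔼[d])).map Prod.snd = f₂ := by
    have h1 := ProbabilityMeasure.tendsto_map_of_tendsto_of_continuous _ _ hlim continuous_snd
    set F₂ : ProbabilityMeasure 𝔼[d] := ⟨f₂, inferInstance⟩ with hF₂
    have h2 := tendsto_map_simpleFunc (Fn := fun n => (P (σ n)).map
      (continuous_snd.measurable.aemeasurable (μ := (P (σ n) : Measure (𝔼[d] × 𝔼[d]))))) (F := F₂)
      hf₂ (fun x hx => (hq x hx).comp hσt) rfl fun n => (hplan (σ n)).map_snd
    have h3 := tendsto_nhds_unique h1 h2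
    exact congrArg (fun R : ProbabilityMeasure 𝔼[d] => (R : Measure 𝔼[d])) h3
  have hQplan : IsTransportPlan f₁ f₂ (Q : Measure (𝔼[d] × 𝔼[d])) := ⟨hm₁, hm₂⟩
  -- the limit of the potentials
  set un : ℕ → 𝔼[d] → ℝ := fun n x => w (σ n) x - w (σ n) x₀ with hun
  have hunp : ∀ n, IsPotential N (un n) := fun n => (hw (σ n)).sub_const _
  obtain ⟨v, hv, hvlim⟩ := exists_potential_limit (Filter.hyperfilter ℕ) hunp (x₀ := x₀)
    (fun n => by simp [hun]) hFc
  have hcont_n : ∀ n, γ' (σ n) (contactSet N (un n))ᶜ = 0 := fun n => by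
    rw [hun, contactSet_sub_const]; exact hcontact (σ n)
  have hzero : (Q : Measure (𝔼[d] × 𝔼[d])) (contactSet N v)ᶜ = 0 := by
    have hvc := hv.continuous
    have hNc := continuous_seminorm N
    set G : ℝ → Set (𝔼[d] × 𝔼[d]) := fun δ => {z | v z.1 - v z.2 < N (z.1 - z.2) - δ} with hG
    have hGo : ∀ δ, IsOpen (G δ) := fun δ => isOpen_lt (by fun_prop) (by fun_prop)
    have hG0 : ∀ δ > 0, (Q : Measure (𝔼[d] × 𝔼[d])) (G δ) = 0 := by
      intro δ hδ
      have h1 := ProbabilityMeasure.le_liminf_measure_open_of_tendsto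
        (hlim.mono_left (Nat.hyperfilter_le_atTop)) (hGo δ)
      have h2 : ∀ᶠ n in (Filter.hyperfilter ℕ : Filter ℕ),
          ((P ∘ σ) n : Measure (𝔼[d] × 𝔼[d])) (G δ) = 0 := by
        filter_upwards [hvlim (δ / 2) (by positivity)] with n hn
        refine measure_eq_zero_iff_ae_notMem.2 ?_
        have h3 : ∀ᵐ z ∂(γ' (σ n)), z ∈ contactSet N (un n) := hcont_n n
        filter_upwards [h3, hsupp (σ n)] with z hz hzF
        have hz : un n z.1 - un n z.2 = N (z.1 - z.2) := hz
        have h4 := abs_le.1 (hn _ hzF.1)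
        have h5 := abs_le.1 (hn _ hzF.2)
        change ¬ (v z.1 - v z.2 < N (z.1 - z.2) - δ)
        linarith [h4.1, h4.2, h5.1, h5.2]
      refine le_antisymm (h1.trans (le_of_eq ?_)) zero_le
      rw [liminf_congr h2, liminf_const]
    refine measure_mono_null (t := ⋃ n : ℕ, G (1 / ((n : ℝ) + 1))) ?_
      (measure_iUnion_null fun n => hG0 _ (by positivity))
    intro z hz
    have hlt : v z.1 - v z.2 < N (z.1 - z.2) := lt_of_le_of_ne (hv _ _) hz
    obtain ⟨n, hn⟩ := exists_nat_one_div_lt (sub_pos.2 hlt)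
    refine mem_iUnion.2 ⟨n, ?_⟩
    change v z.1 - v z.2 < N (z.1 - z.2) - 1 / ((n : ℝ) + 1)
    linarith
  refine ⟨v, Q, un, fun n => γ' (σ n), hv, hQplan, hzero, fun n => ⟨hunp n,
    (hplan (σ n)).map_fst, hcont_n n, (q (σ n)).range, ?_, ?_⟩, fun O hO =>
    ProbabilityMeasure.le_liminf_measure_open_of_tendsto hlim hO⟩
  · intro x hx
    obtain ⟨z, hz⟩ := SimpleFunc.mem_range.1 (Finset.mem_coe.1 hx)
    rw [← hz]; exact hqF _ z
  · have h1 : ∀ᵐ x ∂(f₂.map (q (σ n))), x ∈ ((q (σ n)).range : Set 𝔼[d]) := by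
      rw [ae_map_iff (p := fun x => x ∈ ((q (σ n)).range : Set 𝔼[d]))
        (q (σ n)).measurable.aemeasurable (Finset.measurableSet _)]
      exact Eventually.of_forall fun x => (q (σ n)).mem_range_self x
    rw [← (hplan (σ n)).map_snd, ae_map_iff (p := fun x => x ∈ ((q (σ n)).range : Set 𝔼[d]))
      measurable_snd.aemeasurable (Finset.measurableSet _)] at h1
    exact h1

theorem isTransportPlan_smul {f₁ f₂ : Measure 𝔼[d]} {γ : Measure (𝔼[d] × 𝔼[d])}
    (h : IsTransportPlan f₁ f₂ γ) (c : ℝ≥0∞) : IsTransportPlan (c • f₁) (c • f₂) (c • γ) :=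
  ⟨by rw [Measure.map_smul, h.map_fst], by rw [Measure.map_smul, h.map_snd]⟩

/-- Between a source which is absolutely continuous on the boundary and any target on the boundary
there is a plan that lives on the contact set of a potential, and which is a limit of such plans
with finitely many targets. -/
theorem exists_plan_limit (hd : 2 ≤ d) (hΩ : IsUniformlyConvexDomain Ω)
    (ha : a ∈ interior Ω) (hN : IsStrictlyConvexNorm N) {f₁ f₂ : Measure 𝔼[d]}
    [IsFiniteMeasure f₁] [IsFiniteMeasure f₂] (hmass : f₁ univ = f₂ univ)
    (hf₁ : f₁ ≪ coneMeasure Ω a) (hf₂ : ∀ᵐ x ∂f₂, x ∈ frontier Ω) :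
    ∃ (u : 𝔼[d] → ℝ) (γ : Measure (𝔼[d] × 𝔼[d])) (un : ℕ → 𝔼[d] → ℝ)
      (γn : ℕ → Measure (𝔼[d] × 𝔼[d])),
      IsPotential N u ∧ IsTransportPlan f₁ f₂ γ ∧ γ (contactSet N u)ᶜ = 0 ∧
      (∀ n, IsPotential N (un n) ∧ (γn n).map Prod.fst = f₁ ∧ γn n (contactSet N (un n))ᶜ = 0 ∧
        ∃ T : Finset 𝔼[d], ↑T ⊆ frontier Ω ∧ ∀ᵐ q ∂(γn n), q.2 ∈ T) ∧
      ∀ O, IsOpen O → γ O ≤ liminf (fun n => γn n O) atTop := by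
  by_cases h0 : f₁ univ = 0
  · have h1 : f₁ = 0 := Measure.measure_univ_eq_zero.1 h0
    have h2 : f₂ = 0 := Measure.measure_univ_eq_zero.1 (hmass ▸ h0)
    have hp : IsPotential N fun _ => 0 := fun x y => by simp
    refine ⟨fun _ => 0, 0, fun _ _ => 0, fun _ => 0, hp, ⟨by simp [h1], by simp [h2]⟩, by simp,
      fun n => ⟨hp, by simp [h1], by simp, ∅, by simp, by simp⟩, fun O _ => by simp⟩
  set c := f₁ univ with hc
  have hct : c ≠ ∞ := measure_ne_top _ _
  have hcc : c * c⁻¹ = 1 := ENNReal.mul_inv_cancel h0 hct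
  have hp₁ : IsProbabilityMeasure (c⁻¹ • f₁) :=
    ⟨by rw [Measure.smul_apply, smul_eq_mul, ← hc, mul_comm, hcc]⟩
  have hp₂ : IsProbabilityMeasure (c⁻¹ • f₂) :=
    ⟨by rw [Measure.smul_apply, smul_eq_mul, ← hmass, mul_comm, hcc]⟩
  obtain ⟨u, γ, un, γn, hu, hγ, hγc, hn, hO⟩ := exists_plan_limit_of_isProbabilityMeasure hd hΩ ha
    hN (f₁ := c⁻¹ • f₁) (f₂ := c⁻¹ • f₂) (hf₁.smul_left _) (Measure.ae_smul_measure hf₂ _)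
  have hback : ∀ f : Measure 𝔼[d], c • c⁻¹ • f = f := fun f => by rw [smul_smul, hcc, one_smul]
  refine ⟨u, c • γ, un, fun n => c • γn n, hu, ?_, ?_, fun n => ?_, fun O hOo => ?_⟩
  · have := isTransportPlan_smul hγ c
    rwa [hback, hback] at this
  · rw [Measure.smul_apply, hγc, smul_zero]
  · obtain ⟨h1, h2, h3, T, hT, h4⟩ := hn n
    exact ⟨h1, by rw [Measure.map_smul, h2, hback], by rw [Measure.smul_apply, h3, smul_zero],
      T, hT, Measure.ae_smul_measure h4 _⟩
  · have h1 := hO O hOo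
    simp only [Measure.smul_apply, smul_eq_mul]
    rw [ENNReal.liminf_const_mul_of_ne_top hct]
    exact mul_le_mul_right h1 c

end Limit

/-! ### Optimal plans live on the contact set, and are unique off the diagonal -/

section Optimal

variable {Ω : Set 𝔼[d]} {a : 𝔼[d]} {N : Seminorm ℝ 𝔼[d]} {u : 𝔼[d] → ℝ} {f₁ f₂ : Measure 𝔼[d]}
  {γ γ' : Measure (𝔼[d] × 𝔼[d])}

theorem isFiniteMeasure_of_isTransportPlan [IsFiniteMeasure f₁] (h : IsTransportPlan f₁ f₂ γ) :
    IsFiniteMeasure γ :=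
  ⟨by rw [measure_univ_of_isTransportPlan h]; exact measure_lt_top _ _⟩

theorem integrable_cost (hΩ : IsUniformlyConvexDomain Ω) [IsFiniteMeasure f₁]
    (hf₁ : ∀ᵐ x ∂f₁, x ∈ frontier Ω) (hf₂ : ∀ᵐ x ∂f₂, x ∈ frontier Ω)
    (h : IsTransportPlan f₁ f₂ γ) : Integrable (fun q => N (q.1 - q.2)) γ := by
  have := isFiniteMeasure_of_isTransportPlan h
  have hF := isCompact_frontier_domain hΩ
  have hae : ∀ᵐ q ∂γ, q ∈ frontier Ω ×ˢ frontier Ω :=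
    ae_mem_prod_of_isTransportPlan h isClosed_frontier.measurableSet hf₁ hf₂
  have hcont : Continuous fun q : 𝔼[d] × 𝔼[d] => N (q.1 - q.2) :=
    (continuous_seminorm N).comp (by fun_prop)
  have hint := hcont.continuousOn.integrableOn_compact (μ := γ) (hF.prod hF)
  rwa [IntegrableOn, Measure.restrict_eq_self_of_ae_mem hae] at hint

theorem transportCost_eq_ofReal (h : Integrable (fun q => N (q.1 - q.2)) γ) :
    transportCost N γ = ENNReal.ofReal (∫ q, N (q.1 - q.2) ∂γ) :=
  (ofReal_integral_eq_lintegral_ofReal h (Eventually.of_forall fun _ => apply_nonneg N _)).symm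

theorem integral_potential_sub (hu : IsPotential N u) (hΩ : IsUniformlyConvexDomain Ω)
    [IsFiniteMeasure f₁] [IsFiniteMeasure f₂]
    (hf₁ : ∀ᵐ x ∂f₁, x ∈ frontier Ω) (hf₂ : ∀ᵐ x ∂f₂, x ∈ frontier Ω)
    (h : IsTransportPlan f₁ f₂ γ) :
    Integrable (fun q => u q.1 - u q.2) γ ∧
      ∫ q, (u q.1 - u q.2) ∂γ = ∫ x, u x ∂f₁ - ∫ x, u x ∂f₂ := by
  have h1 : Integrable u (γ.map Prod.fst) := by rw [h.map_fst]; exact hu.integrable hΩ hf₁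
  have h2 : Integrable u (γ.map Prod.snd) := by rw [h.map_snd]; exact hu.integrable hΩ hf₂
  have h1' : Integrable (fun q : 𝔼[d] × 𝔼[d] => u q.1) γ := h1.comp_measurable measurable_fst
  have h2' : Integrable (fun q : 𝔼[d] × 𝔼[d] => u q.2) γ := h2.comp_measurable measurable_snd
  refine ⟨h1'.sub h2', ?_⟩
  rw [integral_sub h1' h2', ← h.map_fst, ← h.map_snd,
    integral_map measurable_fst.aemeasurable h1.aestronglyMeasurable,
    integral_map measurable_snd.aemeasurable h2.aestronglyMeasurable]

theorem integral_cost_of_contactSet (hc : γ (contactSet N u)ᶜ = 0) :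
    ∫ q, N (q.1 - q.2) ∂γ = ∫ q, (u q.1 - u q.2) ∂γ := by
  refine integral_congr_ae ?_
  have hc : ∀ᵐ q ∂γ, q ∈ contactSet N u := hc
  filter_upwards [hc] with q hq using Eq.symm hq

/-- The easy half of Kantorovich duality: the integral of `u x - u y` is the same for all plans, and
bounds their costs from below. -/
theorem isOptimalPlan_of_contactSet (hu : IsPotential N u) (hΩ : IsUniformlyConvexDomain Ω)
    [IsFiniteMeasure f₁] [IsFiniteMeasure f₂]
    (hf₁ : ∀ᵐ x ∂f₁, x ∈ frontier Ω) (hf₂ : ∀ᵐ x ∂f₂, x ∈ frontier Ω)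
    (h : IsTransportPlan f₁ f₂ γ) (hc : γ (contactSet N u)ᶜ = 0) : IsOptimalPlan N f₁ f₂ γ := by
  refine ⟨h, fun γ' h' => ?_⟩
  have hi' := integrable_cost (N := N) hΩ hf₁ hf₂ h'
  rw [transportCost_eq_ofReal (integrable_cost hΩ hf₁ hf₂ h), transportCost_eq_ofReal hi',
    integral_cost_of_contactSet hc, (integral_potential_sub hu hΩ hf₁ hf₂ h).2]
  obtain ⟨h1, h2⟩ := integral_potential_sub hu hΩ hf₁ hf₂ h'
  rw [← h2]
  exact ENNReal.ofReal_le_ofReal (integral_mono h1 hi' fun q => hu _ _)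

/-- Equality in the duality inequality forces any optimal plan on the contact set. -/
theorem contactSet_of_isOptimalPlan (hu : IsPotential N u) (hΩ : IsUniformlyConvexDomain Ω)
    [IsFiniteMeasure f₁] [IsFiniteMeasure f₂]
    (hf₁ : ∀ᵐ x ∂f₁, x ∈ frontier Ω) (hf₂ : ∀ᵐ x ∂f₂, x ∈ frontier Ω)
    (h : IsTransportPlan f₁ f₂ γ) (hc : γ (contactSet N u)ᶜ = 0)
    (h' : IsOptimalPlan N f₁ f₂ γ') : γ' (contactSet N u)ᶜ = 0 := by
  have hi := integrable_cost (N := N) hΩ hf₁ hf₂ h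
  have hi' := integrable_cost (N := N) hΩ hf₁ hf₂ h'.isTransportPlan
  obtain ⟨h1, h2⟩ := integral_potential_sub hu hΩ hf₁ hf₂ h'.isTransportPlan
  have h3 := h'.cost_le γ h
  have hnn : 0 ≤ ∫ q, N (q.1 - q.2) ∂γ := integral_nonneg fun q => apply_nonneg N _
  rw [transportCost_eq_ofReal hi, transportCost_eq_ofReal hi', ENNReal.ofReal_le_ofReal_iff hnn,
    integral_cost_of_contactSet hc, (integral_potential_sub hu hΩ hf₁ hf₂ h).2, ← h2] at h3
  have h4 : 0 ≤ fun q : 𝔼[d] × 𝔼[d] => N (q.1 - q.2) - (u q.1 - u q.2) :=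
    fun q => sub_nonneg.2 (hu _ _)
  have h5 : ∫ q, (N (q.1 - q.2) - (u q.1 - u q.2)) ∂γ' = 0 := by
    refine le_antisymm ?_ (integral_nonneg h4)
    rw [integral_sub hi' h1]
    linarith
  have h6 := (integral_eq_zero_iff_of_nonneg h4 (hi'.sub h1)).1 h5
  change ∀ᵐ q ∂γ', q ∈ contactSet N u
  filter_upwards [h6] with q hq
  exact (sub_eq_zero.1 hq).symm

/-- The rays that start from a point from which only one ray starts. -/
def uniqueRaySet (Ω : Set 𝔼[d]) (N : Seminorm ℝ 𝔼[d]) (u : 𝔼[d] → ℝ) : Set (𝔼[d] × 𝔼[d]) :=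
  raySet Ω N u ∩ Prod.fst ⁻¹' (branchSet Ω N u)ᶜ

theorem injOn_fst_uniqueRaySet : InjOn Prod.fst (uniqueRaySet Ω N u) := by
  rintro ⟨x, y⟩ ⟨h1, h2⟩ ⟨x', y'⟩ ⟨h1', -⟩ rfl
  by_contra hne
  exact h2 ⟨y, y', fun h => hne (by rw [h]), h1, h1'⟩

theorem measurableSet_uniqueRaySet (hΩ : IsUniformlyConvexDomain Ω) (hu : IsPotential N u) :
    MeasurableSet (uniqueRaySet Ω N u) :=
  (measurableSet_raySet hu).inter (measurable_fst (measurableSet_branchSet hΩ hu).compl)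

theorem measurableSet_offDiag : MeasurableSet {q : 𝔼[d] × 𝔼[d] | q.1 ≠ q.2} :=
  (measurableSet_eq_fun measurable_fst measurable_snd).compl

theorem ae_uniqueRaySet (hd : 1 ≤ d) (hΩ : IsUniformlyConvexDomain Ω) (ha : a ∈ interior Ω)
    (hN : IsStrictlyConvexNorm N) (hu : IsPotential N u) (hκ : f₁ ≪ coneMeasure Ω a)
    (hf₂ : ∀ᵐ x ∂f₂, x ∈ frontier Ω) (h : IsTransportPlan f₁ f₂ γ)
    (hc : γ (contactSet N u)ᶜ = 0) : ∀ᵐ q ∂γ, q.1 ≠ q.2 → q ∈ uniqueRaySet Ω N u := by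
  have hf₁ := hκ.ae_le (ae_mem_frontier_coneMeasure hd hΩ ha)
  have hbm := measurableSet_branchSet hΩ hu
  have h1 : ∀ᵐ q ∂γ, q.1 ∉ branchSet Ω N u := by
    have h2 : ∀ᵐ x ∂f₁, x ∈ (branchSet Ω N u)ᶜ := by
      rw [ae_iff]; simpa using hκ (coneMeasure_branchSet hd hΩ ha hN hu)
    rw [← h.map_fst, ae_map_iff (p := fun x => x ∈ (branchSet Ω N u)ᶜ)
      measurable_fst.aemeasurable hbm.compl] at h2
    exact h2
  have hc : ∀ᵐ q ∂γ, q ∈ contactSet N u := hc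
  filter_upwards [h1, hc, ae_mem_prod_of_isTransportPlan h isClosed_frontier.measurableSet hf₁ hf₂]
    with q hq1 hq2 hq3 hne
  exact ⟨⟨⟨hq3.1, hq3.2, hne⟩, hq2⟩, hq1⟩

/-- The mass that a plan moves out of a set `S` of starting points of rays is `f₁ S - f₂ S`: no ray
ends in `S`, hence all the mass of `f₂` in `S` has stayed in place. -/
theorem measure_uniqueRaySet_inter (hd : 1 ≤ d) (hΩ : IsUniformlyConvexDomain Ω)
    (ha : a ∈ interior Ω) (hN : IsStrictlyConvexNorm N) (hu : IsPotential N u)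
    [IsFiniteMeasure f₂] (hκ : f₁ ≪ coneMeasure Ω a)
    (hf₂ : ∀ᵐ x ∂f₂, x ∈ frontier Ω) (h : IsTransportPlan f₁ f₂ γ)
    (hc : γ (contactSet N u)ᶜ = 0) {S : Set 𝔼[d]} (hS : MeasurableSet S)
    (hSG : S ⊆ Prod.fst '' uniqueRaySet Ω N u) :
    γ (uniqueRaySet Ω N u ∩ Prod.fst ⁻¹' S) = f₁ S - f₂ S := by
  set G := uniqueRaySet Ω N u with hG
  have hGm : MeasurableSet G := measurableSet_uniqueRaySet hΩ hu
  have hae := ae_uniqueRaySet hd hΩ ha hN hu hκ hf₂ h hc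
  have hsplit : ∀ T : Set (𝔼[d] × 𝔼[d]), γ T = γ (T ∩ {q | q.1 ≠ q.2}ᶜ) + γ (T ∩ G) := by
    intro T
    rw [← measure_inter_add_sdiff T measurableSet_offDiag, add_comm]
    congr 1
    refine measure_congr ?_
    filter_upwards [hae] with q hq
    exact propext ⟨fun h => ⟨h.1, hq h.2⟩, fun h => ⟨h.1, h.2.1.1.2.2⟩⟩
  have h2 : f₂ S = γ (Prod.snd ⁻¹' S ∩ {q | q.1 ≠ q.2}ᶜ) := by
    have h3 : Prod.snd ⁻¹' S ∩ G = ∅ := by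
      ext ⟨x, y⟩
      simp only [mem_inter_iff, mem_preimage, mem_empty_iff_false, iff_false, not_and]
      intro hy hxy
      obtain ⟨⟨y', z⟩, hyz, hyy⟩ := hSG hy
      simp only at hyy
      subst hyy
      exact not_raySet_of_raySet hΩ hN hu hxy.1 hyz.1
    rw [← h.map_snd, Measure.map_apply measurable_snd hS, hsplit, h3, measure_empty, add_zero]
  have h4 : Prod.snd ⁻¹' S ∩ {q : 𝔼[d] × 𝔼[d] | q.1 ≠ q.2}ᶜ =
      Prod.fst ⁻¹' S ∩ {q : 𝔼[d] × 𝔼[d] | q.1 ≠ q.2}ᶜ := by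
    ext ⟨x, y⟩
    simp only [mem_inter_iff, mem_preimage, mem_compl_iff, mem_ofPred_eq, not_not]
    constructor <;> rintro ⟨h5, rfl⟩ <;> exact ⟨h5, rfl⟩
  have h1 : f₁ S = f₂ S + γ (G ∩ Prod.fst ⁻¹' S) := by
    rw [h2, h4, ← h.map_fst, Measure.map_apply measurable_fst hS, hsplit, inter_comm G]
  rw [h1, ENNReal.add_sub_cancel_left (measure_ne_top _ _)]

/-- Two plans on the contact set of the same potential move the same mass along the same rays: a set
of rays is determined by its set of starting points, on which the moved mass is prescribed. -/
theorem restrict_offDiag_eq (hd : 1 ≤ d) (hΩ : IsUniformlyConvexDomain Ω)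
    (ha : a ∈ interior Ω) (hN : IsStrictlyConvexNorm N) (hu : IsPotential N u)
    [IsFiniteMeasure f₂] (hκ : f₁ ≪ coneMeasure Ω a) (hf₂ : ∀ᵐ x ∂f₂, x ∈ frontier Ω)
    (h : IsTransportPlan f₁ f₂ γ) (hc : γ (contactSet N u)ᶜ = 0)
    (h' : IsTransportPlan f₁ f₂ γ') (hc' : γ' (contactSet N u)ᶜ = 0) :
    γ.restrict {q | q.1 ≠ q.2} = γ'.restrict {q | q.1 ≠ q.2} := by
  ext D hD
  have hGm : MeasurableSet (uniqueRaySet Ω N u) := measurableSet_uniqueRaySet hΩ hu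
  set S := Prod.fst '' (uniqueRaySet Ω N u ∩ D) with hSdef
  have hS : MeasurableSet S := (hGm.inter hD).image_of_measurable_injOn measurable_fst
    (injOn_fst_uniqueRaySet.mono inter_subset_left)
  have hSG : S ⊆ Prod.fst '' uniqueRaySet Ω N u := image_mono inter_subset_left
  have hset : uniqueRaySet Ω N u ∩ Prod.fst ⁻¹' S = uniqueRaySet Ω N u ∩ D := by
    ext q
    constructor
    · rintro ⟨hq, ⟨q', hq', heq⟩⟩
      have := injOn_fst_uniqueRaySet hq'.1 hq heq
      exact ⟨hq, this ▸ hq'.2⟩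
    · rintro ⟨hq, hqD⟩
      exact ⟨hq, q, ⟨hq, hqD⟩, rfl⟩
  have key : ∀ {γ : Measure (𝔼[d] × 𝔼[d])}, IsTransportPlan f₁ f₂ γ → γ (contactSet N u)ᶜ = 0 →
      γ.restrict {q | q.1 ≠ q.2} D = f₁ S - f₂ S := by
    intro γ h hc
    rw [Measure.restrict_apply hD, ← measure_uniqueRaySet_inter hd hΩ ha hN hu hκ hf₂ h hc hS hSG,
      hset]
    refine measure_congr ?_
    filter_upwards [ae_uniqueRaySet hd hΩ ha hN hu hκ hf₂ h hc] with q hq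
    exact propext ⟨fun h => ⟨hq h.2, h.1⟩, fun h => ⟨h.2, h.1.1.1.2.2⟩⟩
  rw [key h hc, key h' hc']

theorem withDensity_cost_eq (γ : Measure (𝔼[d] × 𝔼[d])) :
    γ.withDensity (fun q => ENNReal.ofReal (N (q.1 - q.2))) =
      (γ.restrict {q | q.1 ≠ q.2}).withDensity (fun q => ENNReal.ofReal (N (q.1 - q.2))) := by
  rw [← restrict_withDensity measurableSet_offDiag, eq_comm]
  refine Measure.restrict_eq_self_of_ae_mem ?_
  have hm : Measurable fun q : 𝔼[d] × 𝔼[d] => ENNReal.ofReal (N (q.1 - q.2)) :=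
    ((continuous_seminorm N).comp (by fun_prop)).measurable.ennreal_ofReal
  rw [ae_withDensity_iff hm]
  refine Eventually.of_forall fun q hq h => hq ?_
  rw [h]; simp

theorem planDensity_eq_of_restrict_offDiag_eq
    (h : γ.restrict {q | q.1 ≠ q.2} = γ'.restrict {q | q.1 ≠ q.2}) :
    planDensity N γ = planDensity N γ' := by
  rw [planDensity, planDensity, withDensity_cost_eq γ, withDensity_cost_eq γ', h]

end Optimal

/-! ### The density estimate for bounded starting measures -/

section Bounded

variable {Ω : Set 𝔼[d]} {a : 𝔼[d]} {N : Seminorm ℝ 𝔼[d]} {u : 𝔼[d] → ℝ}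
  {γ : Measure (𝔼[d] × 𝔼[d])} {M : ℝ≥0∞} {A : Set 𝔼[d]}

theorem measurableSet_lt_cost (N : Seminorm ℝ 𝔼[d]) (ε : ℝ) :
    MeasurableSet {q : 𝔼[d] × 𝔼[d] | ε < N (q.1 - q.2)} :=
  (isOpen_lt continuous_const ((continuous_seminorm N).comp (by fun_prop))).measurableSet

/-- Mass sent to one boundary point `y`. -/
theorem prod_restrict_target_le {C ε r : ℝ} {y : 𝔼[d]} [IsFiniteMeasure γ]
    (hΩ : IsUniformlyConvexDomain Ω)
    (hC : ((coneMeasure Ω a).restrict {x | r ≤ ‖x - y‖}).prod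
          ((volume : Measure ℝ).restrict (Icc 0 (1 / 2)))
        {q | (1 - q.2) • q.1 + q.2 • y ∈ A} ≤ ENNReal.ofReal C * volume A)
    (hr : ∀ z, ε < N z → r ≤ ‖z‖) (hM : γ.map Prod.fst ≤ M • coneMeasure Ω a)
    (hA : MeasurableSet A) :
    ((γ.restrict {q | q.2 = y ∧ ε < N (q.1 - q.2)}).prod
      ((volume : Measure ℝ).restrict (Icc 0 (1 / 2)))) (interp ⁻¹' A) ≤
      M * (ENNReal.ofReal C * volume A) := by
  have := isFiniteMeasure_coneMeasure (a := a) hΩ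
  set τ := (volume : Measure ℝ).restrict (Icc 0 (1 / 2)) with hτ
  set B : Set (𝔼[d] × 𝔼[d]) := {q | q.2 = y ∧ ε < N (q.1 - q.2)} with hB
  have hBm : MeasurableSet B :=
    (measurableSet_eq_fun measurable_snd measurable_const).inter (measurableSet_lt_cost N ε)
  have hm : MeasurableSet {q : 𝔼[d] × ℝ | (1 - q.2) • q.1 + q.2 • y ∈ A} := by
    have : Measurable fun q : 𝔼[d] × ℝ => (1 - q.2) • q.1 + q.2 • y := by fun_prop
    exact this hA
  have hmi : MeasurableSet (interp ⁻¹' A) := continuous_interp.measurable hA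
  have hh : Measurable fun x : 𝔼[d] => τ (Prod.mk x ⁻¹' {q | (1 - q.2) • q.1 + q.2 • y ∈ A}) :=
    measurable_measure_prodMk_left hm
  have hle : (γ.restrict B).map Prod.fst ≤ M • (coneMeasure Ω a).restrict {x | r ≤ ‖x - y‖} := by
    refine Measure.le_iff.2 fun S hS => ?_
    have hSm : MeasurableSet {x : 𝔼[d] | r ≤ ‖x - y‖} :=
      (isClosed_le continuous_const (by fun_prop)).measurableSet
    rw [Measure.map_apply measurable_fst hS, Measure.restrict_apply (measurable_fst hS),
      Measure.smul_apply, Measure.restrict_apply hS]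
    refine le_trans ?_ (Measure.le_iff'.1 hM _)
    rw [Measure.map_apply measurable_fst (hS.inter hSm)]
    refine measure_mono ?_
    rintro ⟨x, y'⟩ ⟨h1, rfl, h2⟩
    exact ⟨h1, hr _ h2⟩
  calc _ = ∫⁻ q in B, τ (Prod.mk q ⁻¹' (interp ⁻¹' A)) ∂γ := Measure.prod_apply hmi
    _ = ∫⁻ q in B, τ (Prod.mk q.1 ⁻¹' {q | (1 - q.2) • q.1 + q.2 • y ∈ A}) ∂γ := by
        refine setLIntegral_congr_fun hBm ?_
        rintro ⟨x, y'⟩ ⟨rfl, -⟩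
        rfl
    _ = ∫⁻ x, τ (Prod.mk x ⁻¹' {q | (1 - q.2) • q.1 + q.2 • y ∈ A})
          ∂((γ.restrict B).map Prod.fst) := (lintegral_map hh measurable_fst).symm
    _ ≤ ∫⁻ x, τ (Prod.mk x ⁻¹' {q | (1 - q.2) • q.1 + q.2 • y ∈ A})
          ∂(M • (coneMeasure Ω a).restrict {x | r ≤ ‖x - y‖}) := lintegral_mono' hle le_rfl
    _ = M * ((coneMeasure Ω a).restrict {x | r ≤ ‖x - y‖}).prod τ
        {q | (1 - q.2) • q.1 + q.2 • y ∈ A} := by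
        rw [lintegral_smul_measure, Measure.prod_apply hm, smul_eq_mul]
    _ ≤ _ := by gcongr

/-- Mass sent to finitely many boundary points: the cones over the different targets are disjoint,
so that the estimates for the single targets add up without loss. -/
theorem prod_preimage_le_of_finite_targets (hd : 1 ≤ d) (hΩ : IsUniformlyConvexDomain Ω)
    (ha : a ∈ interior Ω) (hN : IsStrictlyConvexNorm N) :
    ∃ C : ℝ, 0 < C ∧ ∀ (u : 𝔼[d] → ℝ) (γ : Measure (𝔼[d] × 𝔼[d])) (M : ℝ≥0∞) (T : Finset 𝔼[d])
      (ε : ℝ)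
      (A : Set 𝔼[d]), IsFiniteMeasure γ → IsPotential N u → γ.map Prod.fst ≤ M • coneMeasure Ω a →
      γ (contactSet N u)ᶜ = 0 → ↑T ⊆ frontier Ω → (∀ᵐ q ∂γ, q.2 ∈ T) → 0 < ε → MeasurableSet A →
      ((γ.restrict {q | ε < N (q.1 - q.2)}).prod ((volume : Measure ℝ).restrict (Icc 0 (1 / 2))))
        (interp ⁻¹' A) ≤ M * (ENNReal.ofReal (C / ε ^ 2) * volume A) := by
  obtain ⟨C, hC, hbound⟩ := prod_coneMeasure_preimage_le hd hΩ ha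
  obtain ⟨K, hK, hNK⟩ := seminorm_le_mul_norm N
  refine ⟨C * K ^ 2, by positivity, fun u γ M T ε A _ hu hM hc hT hγT hε hA => ?_⟩
  set τ := (volume : Measure ℝ).restrict (Icc 0 (1 / 2)) with hτ
  set R : 𝔼[d] → Set (𝔼[d] × 𝔼[d]) := fun y => raySet Ω N u ∩ {q | q.2 = y} with hR
  have hRm : ∀ y, MeasurableSet (R y) := fun y =>
    (measurableSet_raySet hu).inter (measurableSet_eq_fun measurable_snd measurable_const)
  set Z : 𝔼[d] → Set 𝔼[d] := fun y => interp '' (R y ×ˢ Ioo (0 : ℝ) 1) with hZ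
  have hinj := injOn_interp hΩ hN hu
  have hsub : ∀ y, R y ×ˢ Ioo (0 : ℝ) 1 ⊆ raySet Ω N u ×ˢ Ioo (0 : ℝ) 1 := fun y =>
    prod_mono inter_subset_left le_rfl
  have hZm : ∀ y, MeasurableSet (Z y) := fun y =>
    ((hRm y).prod measurableSet_Ioo).image_of_measurable_injOn continuous_interp.measurable
      (hinj.mono (hsub y))
  have hdisj : (T : Set 𝔼[d]).PairwiseDisjoint fun y => A ∩ Z y := by
    intro y _ y' _ hne
    refine Disjoint.mono inter_subset_right inter_subset_right (Set.disjoint_left.2 ?_)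
    rintro _ ⟨z, hz, rfl⟩ ⟨z', hz', heq⟩
    have := hinj (hsub _ hz') (hsub _ hz) heq
    subst this
    exact hne (hz.1.2.symm.trans hz'.1.2)
  have hfront : ∀ᵐ q ∂γ, q.1 ∈ frontier Ω := by
    have h1 : ∀ᵐ x ∂(γ.map Prod.fst), x ∈ frontier Ω :=
      (hM.absolutelyContinuous.trans Measure.smul_absolutelyContinuous).ae_le
        (ae_mem_frontier_coneMeasure hd hΩ ha)
    exact ae_of_ae_map measurable_fst.aemeasurable h1
  have hc : ∀ᵐ q ∂γ, q ∈ contactSet N u := hc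
  set γε := γ.restrict {q | ε < N (q.1 - q.2)} with hγε
  have hray : ∀ᵐ q ∂γε, q ∈ raySet Ω N u ∧ q.2 ∈ T := by
    filter_upwards [ae_restrict_of_ae hc, ae_restrict_of_ae hfront, ae_restrict_of_ae hγT,
      ae_restrict_mem (measurableSet_lt_cost N ε)] with q h1 h2 h3 h4
    refine ⟨⟨⟨h2, hT h3, fun h => ?_⟩, h1⟩, h3⟩
    have h4 : ε < N (q.1 - q.2) := h4
    rw [h, sub_self, map_zero] at h4
    linarith
  have ht : ∀ᵐ t ∂τ, t ∈ Ioo (0 : ℝ) 1 := by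
    have h0 : ∀ᵐ t ∂τ, t ≠ 0 := ae_restrict_of_ae (by simp [ae_iff])
    filter_upwards [h0, ae_restrict_mem measurableSet_Icc] with t ht0 ht
    exact ⟨lt_of_le_of_ne ht.1 ht0.symm, by linarith [ht.2]⟩
  have hcover : ∀ᵐ z ∂(γε.prod τ), z ∈ interp ⁻¹' A →
      z ∈ ⋃ y ∈ T, interp ⁻¹' (A ∩ Z y) ∩ {q | q.2 = y ∧ ε < N (q.1 - q.2)} ×ˢ univ := by
    have h1 := Measure.quasiMeasurePreserving_fst (μ := γε) (ν := τ) |>.ae hray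
    have h2 := Measure.quasiMeasurePreserving_snd (μ := γε) (ν := τ) |>.ae ht
    have h3 := Measure.quasiMeasurePreserving_fst (μ := γε) (ν := τ) |>.ae
      (ae_restrict_mem (measurableSet_lt_cost N ε))
    filter_upwards [h1, h2, h3] with z hz1 hz2 hz3 hzA
    simp only [mem_iUnion]
    exact ⟨z.1.2, hz1.2, ⟨hzA, z, ⟨⟨hz1.1, rfl⟩, hz2⟩, rfl⟩, ⟨rfl, hz3⟩, mem_univ _⟩
  have hpiece : ∀ y ∈ T, (γε.prod τ)
      (interp ⁻¹' (A ∩ Z y) ∩ {q | q.2 = y ∧ ε < N (q.1 - q.2)} ×ˢ univ) ≤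
      M * (ENNReal.ofReal (C * K ^ 2 / ε ^ 2) * volume (A ∩ Z y)) := by
    intro y hy
    have hAm := hA.inter (hZm y)
    have e : C * K ^ 2 / ε ^ 2 = C / (ε / K) ^ 2 := by field_simp
    rw [e]
    have hlt : ∀ z, ε < N z → ε / K ≤ ‖z‖ := fun z hz => by
      rw [div_le_iff₀' hK]; exact hz.le.trans (hNK z)
    refine le_trans ?_ (prod_restrict_target_le (N := N) (γ := γ) hΩ
      (hbound y (hT hy) _ (by positivity) _ hAm) hlt hM hAm)
    have hBm : MeasurableSet {q : 𝔼[d] × 𝔼[d] | q.2 = y ∧ ε < N (q.1 - q.2)} :=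
      (measurableSet_eq_fun measurable_snd measurable_const).inter (measurableSet_lt_cost N ε)
    have hres : γ.restrict {q | q.2 = y ∧ ε < N (q.1 - q.2)} =
        γε.restrict {q | q.2 = y ∧ ε < N (q.1 - q.2)} := by
      rw [hγε, Measure.restrict_restrict hBm]
      congr 1
      ext q
      exact ⟨fun h => ⟨h, h.2⟩, fun h => h.1⟩
    have hprod : (γε.restrict {q | q.2 = y ∧ ε < N (q.1 - q.2)}).prod τ =
        (γε.prod τ).restrict ({q | q.2 = y ∧ ε < N (q.1 - q.2)} ×ˢ univ) := by
      rw [← Measure.prod_restrict, Measure.restrict_univ]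
    rw [hres, hprod, Measure.restrict_apply (continuous_interp.measurable hAm)]
  calc (γε.prod τ) (interp ⁻¹' A)
      ≤ (γε.prod τ) (⋃ y ∈ T, interp ⁻¹' (A ∩ Z y) ∩
          {q | q.2 = y ∧ ε < N (q.1 - q.2)} ×ˢ univ) := measure_mono_ae hcover
    _ ≤ ∑ y ∈ T, (γε.prod τ) (interp ⁻¹' (A ∩ Z y) ∩
          {q | q.2 = y ∧ ε < N (q.1 - q.2)} ×ˢ univ) := measure_biUnion_finset_le _ _
    _ ≤ ∑ y ∈ T, M * (ENNReal.ofReal (C * K ^ 2 / ε ^ 2) * volume (A ∩ Z y)) :=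
        Finset.sum_le_sum hpiece
    _ = M * (ENNReal.ofReal (C * K ^ 2 / ε ^ 2) * volume (⋃ y ∈ T, A ∩ Z y)) := by
        rw [← Finset.mul_sum, ← Finset.mul_sum,
          measure_biUnion_finset hdisj fun y _ => hA.inter (hZm y)]
    _ ≤ _ := by
        gcongr
        exact iUnion₂_subset fun y _ => inter_subset_left

/-- Mass whose starting measure is bounded by `M` and which is moved at distance at least `ε` has,
during the first half of its trip, a density at most `C M / ε ^ 2`. -/
theorem prod_preimage_le (hd : 2 ≤ d) (hΩ : IsUniformlyConvexDomain Ω)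
    (ha : a ∈ interior Ω) (hN : IsStrictlyConvexNorm N) :
    ∃ C : ℝ, 0 < C ∧ ∀ (u : 𝔼[d] → ℝ) (γ : Measure (𝔼[d] × 𝔼[d])) (M : ℝ≥0∞) (ε : ℝ)
      (A : Set 𝔼[d]), IsFiniteMeasure γ → IsPotential N u → M ≠ ∞ →
      γ.map Prod.fst ≤ M • coneMeasure Ω a →
      γ (contactSet N u)ᶜ = 0 → (∀ᵐ q ∂γ, q.2 ∈ frontier Ω) → 0 < ε →
      (∀ᵐ q ∂γ, ε ≤ N (q.1 - q.2)) → MeasurableSet A →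
      (γ.prod ((volume : Measure ℝ).restrict (Icc 0 (1 / 2)))) (interp ⁻¹' A) ≤
        M * (ENNReal.ofReal (C / ε ^ 2) * volume A) := by
  have hd1 : 1 ≤ d := by omega
  obtain ⟨C, hC, hbound⟩ := prod_preimage_le_of_finite_targets hd1 hΩ ha hN
  refine ⟨4 * C, by positivity, fun u γ M ε A _ hu hMt hM hc hγ2 hε hγε hA => ?_⟩
  set τ := (volume : Measure ℝ).restrict (Icc 0 (1 / 2)) with hτ
  set f₁ := γ.map Prod.fst with hf₁
  set f₂ := γ.map Prod.snd with hf₂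
  have hf₁fin : IsFiniteMeasure f₁ := by rw [hf₁]; infer_instance
  have hf₂fin : IsFiniteMeasure f₂ := by rw [hf₂]; infer_instance
  have hplan : IsTransportPlan f₁ f₂ γ := ⟨rfl, rfl⟩
  have hmass : f₁ univ = f₂ univ := by
    rw [hf₁, hf₂, Measure.map_apply measurable_fst MeasurableSet.univ,
      Measure.map_apply measurable_snd MeasurableSet.univ, preimage_univ, preimage_univ]
  have hf₁κ : f₁ ≪ coneMeasure Ω a :=
    hM.absolutelyContinuous.trans Measure.smul_absolutelyContinuous
  have hf₁F := hf₁κ.ae_le (ae_mem_frontier_coneMeasure hd1 hΩ ha)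
  have hf₂F : ∀ᵐ x ∂f₂, x ∈ frontier Ω := by
    rw [hf₂, ae_map_iff (p := fun x => x ∈ frontier Ω) measurable_snd.aemeasurable
      isClosed_frontier.measurableSet]
    exact hγ2
  obtain ⟨v, γ', un, γn, hv, hplan', hc', hn, hliminf⟩ :=
    exists_plan_limit hd hΩ ha hN hmass hf₁κ hf₂F
  have hcv : γ (contactSet N v)ᶜ = 0 := contactSet_of_isOptimalPlan hv hΩ hf₁F hf₂F hplan' hc'
    (isOptimalPlan_of_contactSet hu hΩ hf₁F hf₂F hplan hc)
  have heq := restrict_offDiag_eq hd1 hΩ ha hN hv hf₁κ hf₂F hplan hcv hplan' hc'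
  -- `γ` is bounded by the limit plan, even after restriction to rays of length more than `ε / 2`
  -- (an open condition, unlike `ε ≤ N (x - y)`)
  set O : Set (𝔼[d] × 𝔼[d]) := {q | ε / 2 < N (q.1 - q.2)} with hO
  have hOopen : IsOpen O := isOpen_lt continuous_const ((continuous_seminorm N).comp (by fun_prop))
  have hfin' := isFiniteMeasure_of_isTransportPlan hplan'
  have hfinn : ∀ n, IsFiniteMeasure (γn n) := fun n => ⟨by
    have h1 := (hn n).2.1
    have h2 : (γn n) univ = f₁ univ := by
      rw [← h1, Measure.map_apply measurable_fst MeasurableSet.univ, preimage_univ]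
    rw [h2]; exact measure_lt_top _ _⟩
  have hle : ∀ S, MeasurableSet S → γ S ≤ γ' (O ∩ S) := by
    intro S hS
    have h1 : γ S = γ.restrict {q | q.1 ≠ q.2} (O ∩ S) := by
      rw [Measure.restrict_apply (hOopen.measurableSet.inter hS)]
      refine measure_congr ?_
      filter_upwards [hγε] with q hq
      refine propext ⟨fun h => ⟨⟨?_, h⟩, fun h' => ?_⟩, fun h => h.1.2⟩
      · change ε / 2 < N (q.1 - q.2)
        linarith
      · rw [h', sub_self, map_zero] at hq
        linarith
    rw [h1, heq]
    exact Measure.restrict_apply_le _ _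
  have hopen : ∀ U : Set 𝔼[d], IsOpen U → (γ.prod τ) (interp ⁻¹' U) ≤
      M * (ENNReal.ofReal (4 * C / ε ^ 2) * volume U) := by
    intro U hU
    have hUm : MeasurableSet (interp ⁻¹' U) := continuous_interp.measurable hU.measurableSet
    have hsec : ∀ t : ℝ, IsOpen ((fun q : 𝔼[d] × 𝔼[d] => (q, t)) ⁻¹' (interp ⁻¹' U)) := fun t =>
      (hU.preimage continuous_interp).preimage (by fun_prop)
    calc (γ.prod τ) (interp ⁻¹' U)
        = ∫⁻ t, γ ((fun q => (q, t)) ⁻¹' (interp ⁻¹' U)) ∂τ := Measure.prod_apply_symm hUm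
      _ ≤ ∫⁻ t, liminf (fun n => γn n (O ∩ (fun q => (q, t)) ⁻¹' (interp ⁻¹' U))) atTop ∂τ :=
          lintegral_mono fun t => (hle _ (hsec t).measurableSet).trans
            (hliminf _ (hOopen.inter (hsec t)))
      _ ≤ liminf (fun n => ∫⁻ t, γn n (O ∩ (fun q => (q, t)) ⁻¹' (interp ⁻¹' U)) ∂τ) atTop := by
          refine lintegral_liminf_le fun n => ?_
          have := measurable_measure_prodMk_right (μ := (γn n).restrict O) hUm
          simp only [Measure.restrict_apply (hsec _).measurableSet] at this
          simpa only [inter_comm O] using this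
      _ = liminf (fun n => (((γn n).restrict O).prod τ) (interp ⁻¹' U)) atTop := by
          congr 1
          funext n
          rw [Measure.prod_apply_symm hUm]
          refine lintegral_congr fun t => ?_
          rw [Measure.restrict_apply (hsec t).measurableSet, inter_comm]
      _ ≤ liminf (fun _ : ℕ => M * (ENNReal.ofReal (4 * C / ε ^ 2) * volume U)) atTop := by
          refine liminf_le_liminf (Eventually.of_forall fun n => ?_)
          obtain ⟨h1, h2, h3, T, h4, h5⟩ := hn n
          have e : 4 * C / ε ^ 2 = C / (ε / 2) ^ 2 := by field_simp; norm_num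
          rw [e]
          exact hbound (un n) (γn n) M T (ε / 2) U (hfinn n) h1 (h2.le.trans hM) h3 h4 h5
            (by positivity) hU.measurableSet
      _ = _ := liminf_const _
  -- outer regularity of the Lebesgue measure
  set c := M * ENNReal.ofReal (4 * C / ε ^ 2) with hcdef
  have hct : c ≠ ∞ := ENNReal.mul_ne_top hMt ENNReal.ofReal_ne_top
  have hlim : Tendsto (fun δ : ℝ≥0∞ => c * (volume A + δ)) (𝓝[>] 0) (𝓝 (c * volume A)) := by
    have h1 : Tendsto (fun δ : ℝ≥0∞ => volume A + δ) (𝓝[>] 0) (𝓝 (volume A + 0)) :=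
      (tendsto_const_nhds.add tendsto_id).mono_left nhdsWithin_le_nhds
    rw [add_zero] at h1
    exact ENNReal.Tendsto.const_mul h1 (Or.inr hct)
  rw [← mul_assoc]
  refine ge_of_tendsto hlim ?_
  filter_upwards [self_mem_nhdsWithin] with δ hδ
  obtain ⟨U, hAU, hU, hUle⟩ := A.exists_isOpen_le_add volume (ne_of_gt hδ)
  calc (γ.prod τ) (interp ⁻¹' A) ≤ (γ.prod τ) (interp ⁻¹' U) :=
        measure_mono (preimage_mono hAU)
    _ ≤ c * volume U := by rw [hcdef, mul_assoc]; exact hopen U hU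
    _ ≤ _ := by gcongr

end Bounded

/-! ### Integrability of the first half of the transport density -/

section Density

/-- If a measure is bounded by `W μ`, then the `L^r` norm of its density is controlled by an
integral of `W` against the measure itself. -/
theorem exists_density_of_le_withDensity {X : Type*} [MeasurableSpace X] {μ S : Measure X}
    [SigmaFinite μ] [SFinite S] {W : X → ℝ≥0∞} (hW : Measurable W) (h : S ≤ μ.withDensity W)
    {r : ℝ} (hr : 1 ≤ r) :
    ∃ s : X → ℝ≥0∞, Measurable s ∧ S = μ.withDensity s ∧
      ∫⁻ x, s x ^ r ∂μ ≤ ∫⁻ x, W x ^ (r - 1) ∂S := by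
  have hac : S ≪ μ := h.absolutelyContinuous.trans (withDensity_absolutelyContinuous μ W)
  have hs := Measure.measurable_rnDeriv S μ
  have hSs : S = μ.withDensity (S.rnDeriv μ) := (Measure.withDensity_rnDeriv_eq S μ hac).symm
  refine ⟨S.rnDeriv μ, hs, hSs, ?_⟩
  have hle : S.rnDeriv μ ≤ᵐ[μ] W := by
    refine ae_le_of_forall_setLIntegral_le_of_sigmaFinite hs fun A hA _ => ?_
    rw [← withDensity_apply _ hA, ← withDensity_apply _ hA, ← hSs]
    exact Measure.le_iff.1 h A hA
  have e : ∫⁻ x, W x ^ (r - 1) ∂S = ∫⁻ x, S.rnDeriv μ x * W x ^ (r - 1) ∂μ := by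
    conv_lhs => rw [hSs]
    exact lintegral_withDensity_eq_lintegral_mul _ hs (hW.pow_const _)
  rw [e]
  refine lintegral_mono_ae ?_
  filter_upwards [hle] with x hx
  calc S.rnDeriv μ x ^ r = S.rnDeriv μ x ^ (1 + (r - 1)) := by ring_nf
    _ = S.rnDeriv μ x * S.rnDeriv μ x ^ (r - 1) := by
        rw [ENNReal.rpow_add_of_nonneg _ _ zero_le_one (by linarith), ENNReal.rpow_one]
    _ ≤ _ := by gcongr

/-- A measure that is controlled on each set of a countable partition is bounded by a measure with
a step density. -/
theorem le_withDensity_tsum {X ι : Type*} [MeasurableSpace X] [Countable ι] {μ S : Measure X}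
    {Z : ι → Set X} (hZ : ∀ i, MeasurableSet (Z i)) (hcover : S (⋃ i, Z i)ᶜ = 0) {w : ι → ℝ≥0∞}
    (hw : ∀ i A, MeasurableSet A → S (A ∩ Z i) ≤ w i * μ A) :
    S ≤ μ.withDensity fun x => ∑' i, (Z i).indicator (fun _ => w i) x := by
  refine Measure.le_iff.2 fun A hA => ?_
  rw [withDensity_apply _ hA, lintegral_tsum fun i =>
    (measurable_const.indicator (hZ i)).aemeasurable]
  calc S A ≤ S (⋃ i, A ∩ Z i) := by
        refine measure_mono_ae ?_
        have h : ∀ᵐ x ∂S, x ∈ ⋃ i, Z i := hcover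
        filter_upwards [h] with x hx hxA
        obtain ⟨i, hi⟩ := mem_iUnion.1 hx
        exact mem_iUnion.2 ⟨i, hxA, hi⟩
    _ ≤ ∑' i, S (A ∩ Z i) := measure_iUnion_le _
    _ ≤ _ := by
        refine ENNReal.tsum_le_tsum fun i => ?_
        rw [lintegral_indicator_const (hZ i), Measure.restrict_apply (hZ i), inter_comm]
        have h := hw i (A ∩ Z i) (hA.inter (hZ i))
        rwa [inter_assoc, inter_self, inter_comm] at h

theorem mul_div_rpow_le {n x B : ℝ≥0∞} (hn : n ≤ B) (hB : B ≠ ∞) {ρ : ℝ} (h0 : 0 ≤ ρ)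
    (h1 : ρ ≤ 1) : n * (x / n) ^ ρ ≤ (1 + B) * x ^ ρ := by
  rcases eq_or_ne n 0 with rfl | hn0
  · simp
  have hnt : n ≠ ∞ := ne_top_of_le_ne_top hB hn
  have e : n * (x / n) ^ ρ = n ^ (1 - ρ) * x ^ ρ := by
    rw [ENNReal.div_rpow_of_nonneg _ _ h0, ENNReal.rpow_sub _ _ hn0 hnt, ENNReal.rpow_one,
      div_eq_mul_inv, div_eq_mul_inv]
    ring
  rw [e]
  gcongr
  calc n ^ (1 - ρ) ≤ (1 + B) ^ (1 - ρ) :=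
        ENNReal.rpow_le_rpow (hn.trans le_add_self) (by linarith)
    _ ≤ (1 + B) ^ (1 : ℝ) := ENNReal.rpow_le_rpow_of_exponent_le le_self_add (by linarith)
    _ = 1 + B := ENNReal.rpow_one _

variable {Ω : Set 𝔼[d]} {a : 𝔼[d]} {N : Seminorm ℝ 𝔼[d]} {u : 𝔼[d] → ℝ} {f₂ : Measure 𝔼[d]}
  {γ : Measure (𝔼[d] × 𝔼[d])}

/-- The rays whose length is of order `2 ^ l` and which start where the density of the starting
measure is of order `2 ^ k`. -/
def dyadicRaySet (Ω : Set 𝔼[d]) (N : Seminorm ℝ 𝔼[d]) (u : 𝔼[d] → ℝ) (g : 𝔼[d] → ℝ) (i : ℤ × ℤ) :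
    Set (𝔼[d] × 𝔼[d]) :=
  raySet Ω N u ∩ {q | g q.1 ∈ Ioc ((2 : ℝ) ^ i.1) (2 ^ (i.1 + 1)) ∧
    N (q.1 - q.2) ∈ Ioc ((2 : ℝ) ^ i.2) (2 ^ (i.2 + 1))}

theorem measurableSet_dyadicRaySet (hu : IsPotential N u) {g : 𝔼[d] → ℝ} (hg : Measurable g)
    (i : ℤ × ℤ) : MeasurableSet (dyadicRaySet Ω N u g i) := by
  have h : Measurable fun q : 𝔼[d] × 𝔼[d] => N (q.1 - q.2) :=
    ((continuous_seminorm N).comp (by fun_prop)).measurable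
  exact (measurableSet_raySet hu).inter
    (((hg.comp measurable_fst) measurableSet_Ioc).inter (h measurableSet_Ioc))

theorem eq_of_mem_Ioc_zpow {x : ℝ} {k l : ℤ} (hk : x ∈ Ioc ((2 : ℝ) ^ k) (2 ^ (k + 1)))
    (hl : x ∈ Ioc ((2 : ℝ) ^ l) (2 ^ (l + 1))) : k = l := by
  have h1 := (zpow_lt_zpow_iff_right₀ (one_lt_two (α := ℝ))).1 (hk.1.trans_le hl.2)
  have h2 := (zpow_lt_zpow_iff_right₀ (one_lt_two (α := ℝ))).1 (hl.1.trans_le hk.2)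
  omega

theorem eq_of_mem_dyadicRaySet {g : 𝔼[d] → ℝ} {i j : ℤ × ℤ} {q : 𝔼[d] × 𝔼[d]}
    (hi : q ∈ dyadicRaySet Ω N u g i) (hj : q ∈ dyadicRaySet Ω N u g j) : i = j :=
  Prod.ext (eq_of_mem_Ioc_zpow hi.2.1 hj.2.1) (eq_of_mem_Ioc_zpow hi.2.2 hj.2.2)

theorem exists_mem_dyadicRaySet (hN : IsStrictlyConvexNorm N) {g : 𝔼[d] → ℝ} {q : 𝔼[d] × 𝔼[d]}
    (hq : q ∈ raySet Ω N u) (hg : 0 < g q.1) : ∃ i, q ∈ dyadicRaySet Ω N u g i := by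
  obtain ⟨k, hk⟩ := exists_mem_Ioc_zpow hg one_lt_two
  obtain ⟨l, hl⟩ := exists_mem_Ioc_zpow (seminorm_sub_pos hN hq.1.2.2) one_lt_two
  exact ⟨(k, l), hq, hk, hl⟩

theorem restrict_withDensity_cost_le {E : Set (𝔼[d] × 𝔼[d])} (hE : MeasurableSet E) {B : ℝ}
    (hB : ∀ q ∈ E, N (q.1 - q.2) ≤ B) :
    (γ.withDensity fun q => ENNReal.ofReal (N (q.1 - q.2))).restrict E ≤
      ENNReal.ofReal B • γ.restrict E := by
  rw [restrict_withDensity hE, ← withDensity_const]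
  refine withDensity_mono ?_
  filter_upwards [ae_restrict_mem hE] with q hq using ENNReal.ofReal_le_ofReal (hB q hq)

theorem map_fst_restrict_le {m : Measure 𝔼[d]} {g : 𝔼[d] → ℝ} (hg : Measurable g)
    (h : γ.map Prod.fst = m.withDensity fun x => ENNReal.ofReal (g x)) {E : Set (𝔼[d] × 𝔼[d])}
      {B : ℝ}
    (hB : ∀ q ∈ E, g q.1 ≤ B) :
    (γ.restrict E).map Prod.fst ≤ ENNReal.ofReal B • m := by
  refine Measure.le_iff.2 fun S hS => ?_
  have hT : MeasurableSet {x | g x ≤ B} := measurableSet_le hg measurable_const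
  calc (γ.restrict E).map Prod.fst S = γ (Prod.fst ⁻¹' S ∩ E) := by
        rw [Measure.map_apply measurable_fst hS, Measure.restrict_apply (measurable_fst hS)]
    _ ≤ γ (Prod.fst ⁻¹' (S ∩ {x | g x ≤ B})) :=
        measure_mono fun q hq => ⟨hq.1, hB q hq.2⟩
    _ = ∫⁻ x in S ∩ {x | g x ≤ B}, ENNReal.ofReal (g x) ∂m := by
        rw [← Measure.map_apply measurable_fst (hS.inter hT), h, withDensity_apply _ (hS.inter hT)]
    _ ≤ ∫⁻ x in S ∩ {x | g x ≤ B}, ENNReal.ofReal B ∂m :=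
        setLIntegral_mono' (hS.inter hT) fun x hx => ENNReal.ofReal_le_ofReal hx.2
    _ ≤ _ := by
        rw [setLIntegral_const, Measure.smul_apply, smul_eq_mul]
        gcongr
        exact inter_subset_left

/-- Density bound for the first half of the transport density, in terms of the step function `w`
of order `g(x) / N(x - y)` along the ray from `x` to `y`. -/
theorem exists_step_bound (hd : 2 ≤ d) (hΩ : IsUniformlyConvexDomain Ω) (ha : a ∈ interior Ω)
    (hN : IsStrictlyConvexNorm N) [IsFiniteMeasure γ] (hu : IsPotential N u)
    {g : 𝔼[d] → ℝ} (hg : Measurable g)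
    (hγ1 : γ.map Prod.fst = (boundaryMeasure Ω).withDensity fun x => ENNReal.ofReal (g x))
    (hγ2 : ∀ᵐ q ∂γ, q.2 ∈ frontier Ω) (hc : γ (contactSet N u)ᶜ = 0) :
    ∃ (D : ℝ≥0∞) (W : 𝔼[d] → ℝ≥0∞), D ≠ ∞ ∧ Measurable W ∧
      (((γ.withDensity fun q => ENNReal.ofReal (N (q.1 - q.2))).prod
        ((volume : Measure ℝ).restrict (Icc 0 (1 / 2)))).map interp ≤ volume.withDensity W) ∧
      ∀ᵐ z ∂((γ.withDensity fun q => ENNReal.ofReal (N (q.1 - q.2))).prod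
        ((volume : Measure ℝ).restrict (Icc 0 (1 / 2)))),
        W (interp z) ≤ D * ENNReal.ofReal (g z.1.1) / ENNReal.ofReal (N (z.1.1 - z.1.2)) := by
  have hd1 : 1 ≤ d := by omega
  obtain ⟨C, hC, hbound⟩ := prod_preimage_le hd hΩ ha hN
  obtain ⟨Cb, hCb, hbdry⟩ := boundaryMeasure_le_coneMeasure hd1 hΩ ha
  set τ := (volume : Measure ℝ).restrict (Icc 0 (1 / 2)) with hτ
  set γN := γ.withDensity fun q => ENNReal.ofReal (N (q.1 - q.2)) with hγN
  set E := dyadicRaySet Ω N u g with hE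
  have hEm : ∀ i, MeasurableSet (E i) := measurableSet_dyadicRaySet hu hg
  have hinj := injOn_interp hΩ hN hu
  have hsub : ∀ i, E i ×ˢ Ioo (0 : ℝ) 1 ⊆ raySet Ω N u ×ˢ Ioo (0 : ℝ) 1 := fun i =>
    prod_mono inter_subset_left le_rfl
  set Z : ℤ × ℤ → Set 𝔼[d] := fun i => interp '' (E i ×ˢ Ioo (0 : ℝ) 1) with hZ
  have hZm : ∀ i, MeasurableSet (Z i) := fun i =>
    ((hEm i).prod measurableSet_Ioo).image_of_measurable_injOn continuous_interp.measurable
      (hinj.mono (hsub i))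
  have hNm : Measurable fun q : 𝔼[d] × 𝔼[d] => ENNReal.ofReal (N (q.1 - q.2)) :=
    ((continuous_seminorm N).comp (by fun_prop)).measurable.ennreal_ofReal
  -- almost every ray belongs to one of the dyadic sets
  have hray : ∀ᵐ q ∂γN, ∃ i, q ∈ E i := by
    have h1 : ∀ᵐ x ∂(γ.map Prod.fst), 0 < g x ∧ x ∈ frontier Ω := by
      have h2 : ∀ᵐ x ∂boundaryMeasure Ω, x ∈ frontier Ω :=
        ae_restrict_mem isClosed_frontier.measurableSet
      rw [hγ1, ae_withDensity_iff hg.ennreal_ofReal]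
      filter_upwards [h2] with x hx hne
      exact ⟨by simpa using hne, hx⟩
    have h3 := ae_of_ae_map measurable_fst.aemeasurable h1
    have hc : ∀ᵐ q ∂γ, q ∈ contactSet N u := hc
    rw [hγN, ae_withDensity_iff hNm]
    filter_upwards [h3, hγ2, hc] with q h4 h5 h6 hne
    refine exists_mem_dyadicRaySet hN ⟨⟨h4.2, h5, fun h => hne ?_⟩, h6⟩ h4.1
    rw [h, sub_self, map_zero, ENNReal.ofReal_zero]
  have ht : ∀ᵐ t ∂τ, t ∈ Ioo (0 : ℝ) 1 := by
    have h0 : ∀ᵐ t ∂τ, t ≠ 0 := ae_restrict_of_ae (by simp [ae_iff])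
    filter_upwards [h0, ae_restrict_mem measurableSet_Icc] with t ht0 ht
    exact ⟨lt_of_le_of_ne ht.1 ht0.symm, by linarith [ht.2]⟩
  have hae : ∀ᵐ z ∂(γN.prod τ), ∃ i, z ∈ E i ×ˢ Ioo (0 : ℝ) 1 := by
    have h1 := Measure.quasiMeasurePreserving_fst (μ := γN) (ν := τ) |>.ae hray
    have h2 := Measure.quasiMeasurePreserving_snd (μ := γN) (ν := τ) |>.ae ht
    filter_upwards [h1, h2] with z hz1 hz2
    exact hz1.imp fun i hi => ⟨hi, hz2⟩
  have hmemZ : ∀ i j z, z ∈ E i ×ˢ Ioo (0 : ℝ) 1 → interp z ∈ Z j → i = j := by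
    rintro i j z hz ⟨z', hz', heq⟩
    have := hinj (hsub _ hz') (hsub _ hz) heq
    subst this
    exact eq_of_mem_dyadicRaySet hz.1 hz'.1
  set w : ℤ × ℤ → ℝ≥0∞ := fun i => Cb * ENNReal.ofReal (4 * C * (2 ^ i.1 / 2 ^ i.2)) with hw
  have hpiece : ∀ i A, MeasurableSet A → (γN.prod τ).map interp (A ∩ Z i) ≤ w i * volume A := by
    intro i A hA
    have hBg : ∀ q ∈ E i, g q.1 ≤ 2 ^ (i.1 + 1) := fun q hq => hq.2.1.2
    have hBN : ∀ q ∈ E i, N (q.1 - q.2) ≤ 2 ^ (i.2 + 1) := fun q hq => hq.2.2.2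
    have h1 : (γN.prod τ).map interp (A ∩ Z i) ≤ ((γN.restrict (E i)).prod τ) (interp ⁻¹' A) := by
      have hprod : (γN.restrict (E i)).prod τ = (γN.prod τ).restrict (E i ×ˢ univ) := by
        rw [← Measure.prod_restrict, Measure.restrict_univ]
      rw [Measure.map_apply continuous_interp.measurable (hA.inter (hZm i)), hprod,
        Measure.restrict_apply (continuous_interp.measurable hA)]
      refine measure_mono_ae ?_
      filter_upwards [hae] with z ⟨j, hj⟩ hz
      have := hmemZ j i z hj hz.2
      subst this
      exact ⟨hz.1, hj.1, mem_univ _⟩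
    have h2 : (γN.restrict (E i)).prod τ ≤
        (ENNReal.ofReal (2 ^ (i.2 + 1)) • γ.restrict (E i)).prod τ :=
      Measure.prod_mono (restrict_withDensity_cost_le (hEm i) hBN) le_rfl
    have h3 : (γ.restrict (E i)).map Prod.fst ≤
        (ENNReal.ofReal (2 ^ (i.1 + 1)) * Cb) • coneMeasure Ω a := by
      refine (map_fst_restrict_le hg hγ1 hBg).trans ?_
      refine Measure.le_iff'.2 fun S => ?_
      rw [mul_smul, Measure.smul_apply, Measure.smul_apply, smul_eq_mul, smul_eq_mul]
      gcongr
    have h4 := hbound u (γ.restrict (E i)) (ENNReal.ofReal (2 ^ (i.1 + 1)) * Cb) (2 ^ i.2) A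
      inferInstance hu (ENNReal.mul_ne_top ENNReal.ofReal_ne_top hCb) h3
      (nonpos_iff_eq_zero.1 ((Measure.restrict_apply_le _ _).trans hc.le))
      (ae_restrict_of_ae hγ2) (by positivity)
      (by filter_upwards [ae_restrict_mem (hEm i)] with q hq using hq.2.2.1.le) hA
    calc _ ≤ ((γN.restrict (E i)).prod τ) (interp ⁻¹' A) := h1
      _ ≤ ((ENNReal.ofReal (2 ^ (i.2 + 1)) • γ.restrict (E i)).prod τ) (interp ⁻¹' A) :=
          Measure.le_iff'.1 h2 _
      _ ≤ ENNReal.ofReal (2 ^ (i.2 + 1)) * (ENNReal.ofReal (2 ^ (i.1 + 1)) * Cb *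
          (ENNReal.ofReal (C / (2 ^ i.2) ^ 2) * volume A)) := by
          rw [Measure.prod_smul_left, Measure.smul_apply, smul_eq_mul]
          gcongr
      _ = w i * volume A := by
          have e : 4 * C * ((2 : ℝ) ^ i.1 / 2 ^ i.2) =
              2 ^ (i.2 + 1) * (2 ^ (i.1 + 1) * (C / (2 ^ i.2) ^ 2)) := by
            rw [zpow_add_one₀ two_ne_zero, zpow_add_one₀ two_ne_zero]
            field_simp
            norm_num
          simp only [hw]
          rw [e, ENNReal.ofReal_mul (by positivity), ENNReal.ofReal_mul (by positivity)]
          ring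
  have hcover : (γN.prod τ).map interp (⋃ i, Z i)ᶜ = 0 := by
    rw [Measure.map_apply continuous_interp.measurable (MeasurableSet.iUnion hZm).compl]
    have h1 : ∀ᵐ z ∂(γN.prod τ), z ∈ interp ⁻¹' ⋃ i, Z i := by
      filter_upwards [hae] with z ⟨i, hi⟩
      exact mem_iUnion.2 ⟨i, z, hi, rfl⟩
    exact h1
  refine ⟨Cb * ENNReal.ofReal (8 * C), _, ENNReal.mul_ne_top hCb ENNReal.ofReal_ne_top, ?_,
    le_withDensity_tsum hZm hcover hpiece, ?_⟩
  · exact Measurable.tsum fun i => measurable_const.indicator (hZm i)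
  filter_upwards [hae] with z ⟨i, hi⟩
  have hiZ : interp z ∈ Z i := ⟨z, hi, rfl⟩
  rw [tsum_eq_single i fun j hj => indicator_of_notMem
    (fun h => hj (hmemZ i j z hi h).symm) _, indicator_of_mem hiZ]
  have hNpos : 0 < N (z.1.1 - z.1.2) := lt_trans (by positivity) hi.1.2.2.1
  simp only [hw]
  have e : Cb * ENNReal.ofReal (8 * C) * ENNReal.ofReal (g z.1.1) =
      Cb * ENNReal.ofReal (8 * C * g z.1.1) := by
    rw [ENNReal.ofReal_mul (by positivity : 0 ≤ 8 * C), mul_assoc]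
  rw [e, mul_div_assoc, ← ENNReal.ofReal_div_of_pos hNpos]
  gcongr
  obtain ⟨⟨h1, -⟩, -, h2⟩ := hi.1.2
  rw [zpow_add_one₀ two_ne_zero] at h2
  rw [le_div_iff₀ hNpos]
  calc 4 * C * ((2 : ℝ) ^ i.1 / 2 ^ i.2) * N (z.1.1 - z.1.2)
      ≤ 4 * C * ((2 : ℝ) ^ i.1 / 2 ^ i.2) * (2 ^ i.2 * 2) := by gcongr
    _ = 8 * C * 2 ^ i.1 := by field_simp; norm_num
    _ ≤ 8 * C * g z.1.1 := by gcongr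

theorem lintegral_prod_cost_le {F : 𝔼[d] × 𝔼[d] → ℝ≥0∞} [SFinite γ] (hF : Measurable F) :
    ∫⁻ z, F z.1 ∂((γ.withDensity fun q => ENNReal.ofReal (N (q.1 - q.2))).prod
        ((volume : Measure ℝ).restrict (Icc 0 (1 / 2)))) ≤
      ∫⁻ q, ENNReal.ofReal (N (q.1 - q.2)) * F q ∂γ := by
  have hNm : Measurable fun q : 𝔼[d] × 𝔼[d] => ENNReal.ofReal (N (q.1 - q.2)) :=
    ((continuous_seminorm N).comp (by fun_prop)).measurable.ennreal_ofReal
  have hτ1 : ((volume : Measure ℝ).restrict (Icc 0 (1 / 2))) univ ≤ 1 := by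
    rw [Measure.restrict_apply MeasurableSet.univ, univ_inter, Real.volume_Icc]
    exact ENNReal.ofReal_le_one.2 (by norm_num)
  have hFf : Measurable fun z : (𝔼[d] × 𝔼[d]) × ℝ => F z.1 := hF.comp measurable_fst
  rw [lintegral_prod _ hFf.aemeasurable]
  refine (lintegral_mono (g := F) fun q => ?_).trans
    (lintegral_withDensity_eq_lintegral_mul _ hNm hF).le
  simp only [lintegral_const]
  exact mul_le_of_le_one_right zero_le hτ1

/-- The first half of the transport density has an `L^r` density, for `1 ≤ r ≤ 2`, if the starting
measure has one. -/
theorem exists_density_half (hd : 2 ≤ d) (hΩ : IsUniformlyConvexDomain Ω)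
    (hN : IsStrictlyConvexNorm N) [IsFiniteMeasure γ] (hu : IsPotential N u)
    {g : 𝔼[d] → ℝ} (hg : Measurable g)
    (hγ1 : γ.map Prod.fst = (boundaryMeasure Ω).withDensity fun x => ENNReal.ofReal (g x))
    (hγ2 : ∀ᵐ q ∂γ, q.2 ∈ frontier Ω) (hc : γ (contactSet N u)ᶜ = 0)
    {r : ℝ} (hr1 : 1 ≤ r) (hr2 : r ≤ 2)
    (hgr : ∫⁻ x, ENNReal.ofReal (g x) ^ r ∂boundaryMeasure Ω < ∞) :
    ∃ s : 𝔼[d] → ℝ≥0∞, Measurable s ∧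
      ((γ.withDensity fun q => ENNReal.ofReal (N (q.1 - q.2))).prod
        ((volume : Measure ℝ).restrict (Icc 0 (1 / 2)))).map interp = volume.withDensity s ∧
      ∫⁻ z, s z ^ r < ∞ := by
  obtain ⟨a, ha⟩ := hΩ.nonempty_interior
  obtain ⟨D, W, hD, hW, hle, hWle⟩ := exists_step_bound hd hΩ ha hN hu hg hγ1 hγ2 hc
  obtain ⟨s, hs, hSs, hint⟩ := exists_density_of_le_withDensity hW hle hr1
  refine ⟨s, hs, hSs, hint.trans_lt ?_⟩
  obtain ⟨R, hR, hRb⟩ := exists_norm_sub_le hΩ a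
  obtain ⟨K, hK, hNK⟩ := seminorm_le_mul_norm N
  set τ := (volume : Measure ℝ).restrict (Icc 0 (1 / 2)) with hτ
  have hNm : Measurable fun q : 𝔼[d] × 𝔼[d] => ENNReal.ofReal (N (q.1 - q.2)) :=
    ((continuous_seminorm N).comp (by fun_prop)).measurable.ennreal_ofReal
  have hgm : Measurable fun q : 𝔼[d] × 𝔼[d] => ENNReal.ofReal (g q.1) :=
    (hg.comp measurable_fst).ennreal_ofReal
  have hBae : ∀ᵐ q ∂γ, N (q.1 - q.2) ≤ K * (2 * R) := by
    have h1 : ∀ᵐ x ∂(γ.map Prod.fst), x ∈ frontier Ω := by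
      rw [hγ1]
      exact (withDensity_absolutelyContinuous _ _).ae_le
        (ae_restrict_mem isClosed_frontier.measurableSet)
    filter_upwards [ae_of_ae_map measurable_fst.aemeasurable h1, hγ2] with q h2 h3
    refine (hNK _).trans (mul_le_mul_of_nonneg_left ?_ hK.le)
    have h4 := hRb _ (frontier_subset_domain hΩ h2)
    have h5 := hRb _ (frontier_subset_domain hΩ h3)
    calc ‖q.1 - q.2‖ = ‖(q.1 - a) - (q.2 - a)‖ := by congr 1; abel
      _ ≤ ‖q.1 - a‖ + ‖q.2 - a‖ := norm_sub_le _ _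
      _ ≤ 2 * R := by linarith
  set B := ENNReal.ofReal (K * (2 * R)) with hB
  calc ∫⁻ x, W x ^ (r - 1) ∂(((γ.withDensity fun q => ENNReal.ofReal (N (q.1 - q.2))).prod
          τ).map interp)
      = ∫⁻ z, W (interp z) ^ (r - 1)
          ∂((γ.withDensity fun q => ENNReal.ofReal (N (q.1 - q.2))).prod τ) :=
        lintegral_map (hW.pow_const _) continuous_interp.measurable
    _ ≤ ∫⁻ z, (D * ENNReal.ofReal (g z.1.1) / ENNReal.ofReal (N (z.1.1 - z.1.2))) ^ (r - 1)
          ∂((γ.withDensity fun q => ENNReal.ofReal (N (q.1 - q.2))).prod τ) := by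
        refine lintegral_mono_ae ?_
        filter_upwards [hWle] with z hz
        exact ENNReal.rpow_le_rpow hz (by linarith)
    _ ≤ ∫⁻ q, ENNReal.ofReal (N (q.1 - q.2)) *
          (D * ENNReal.ofReal (g q.1) / ENNReal.ofReal (N (q.1 - q.2))) ^ (r - 1) ∂γ :=
        lintegral_prod_cost_le
          (F := fun q => (D * ENNReal.ofReal (g q.1) / ENNReal.ofReal (N (q.1 - q.2))) ^ (r - 1))
          (((hgm.const_mul D).div hNm).pow_const _)
    _ ≤ ∫⁻ q, (1 + B) * (D * ENNReal.ofReal (g q.1)) ^ (r - 1) ∂γ := by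
        refine lintegral_mono_ae ?_
        filter_upwards [hBae] with q hq
        exact mul_div_rpow_le (ENNReal.ofReal_le_ofReal hq) ENNReal.ofReal_ne_top (by linarith)
          (by linarith)
    _ = (1 + B) * D ^ (r - 1) * ∫⁻ q, ENNReal.ofReal (g q.1) ^ (r - 1) ∂γ := by
        rw [← lintegral_const_mul _ (hgm.pow_const _)]
        refine lintegral_congr fun q => ?_
        rw [ENNReal.mul_rpow_of_nonneg _ _ (by linarith), mul_assoc]
    _ = (1 + B) * D ^ (r - 1) * ∫⁻ x, ENNReal.ofReal (g x) ^ (r - 1) ∂(γ.map Prod.fst) := by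
        rw [lintegral_map (hg.ennreal_ofReal.pow_const _) measurable_fst]
    _ = (1 + B) * D ^ (r - 1) * ∫⁻ x, ENNReal.ofReal (g x) ^ r ∂boundaryMeasure Ω := by
        rw [hγ1, lintegral_withDensity_eq_lintegral_mul _ hg.ennreal_ofReal
          (hg.ennreal_ofReal.pow_const _)]
        congr 1
        refine lintegral_congr fun x => ?_
        have e : r = 1 + (r - 1) := by ring
        conv_rhs => rw [e, ENNReal.rpow_add_of_nonneg _ _ zero_le_one (by linarith),
          ENNReal.rpow_one]
        rfl
    _ < ∞ := by
        refine ENNReal.mul_lt_top (ENNReal.mul_lt_top ?_ ?_) hgr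
        · exact ENNReal.add_lt_top.2 ⟨ENNReal.one_lt_top, ENNReal.ofReal_lt_top⟩
        · exact ENNReal.rpow_lt_top_of_nonneg (by linarith) hD

end Density

/-! ### The two halves of the transport density -/

section Halves

variable {Ω : Set 𝔼[d]} {a : 𝔼[d]} {N : Seminorm ℝ 𝔼[d]} {u : 𝔼[d] → ℝ} {f₁ f₂ : Measure 𝔼[d]}
  {γ : Measure (𝔼[d] × 𝔼[d])} {p : ℝ≥0∞}

theorem IsPotential.neg (hu : IsPotential N u) : IsPotential N fun x => -u x := fun x y => by
  have h := hu y x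
  rw [map_sub_rev] at h
  linarith

theorem map_swap_contactSet (hu : IsPotential N u) (hc : γ (contactSet N u)ᶜ = 0) :
    γ.map Prod.swap (contactSet N fun x => -u x)ᶜ = 0 := by
  rw [Measure.map_apply measurable_swap (isClosed_contactSet hu.neg).measurableSet.compl]
  refine measure_mono_null ?_ hc
  rintro ⟨x, y⟩ h hxy
  refine h ?_
  have hxy : u x - u y = N (x - y) := hxy
  change -u y - -u x = N (y - x)
  rw [map_sub_rev, ← hxy]
  ring

theorem isTransportPlan_swap (h : IsTransportPlan f₁ f₂ γ) :
    IsTransportPlan f₂ f₁ (γ.map Prod.swap) :=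
  ⟨(Measure.map_map measurable_fst measurable_swap).trans h.map_snd,
    (Measure.map_map measurable_snd measurable_swap).trans h.map_fst⟩

theorem map_swap_withDensity_cost :
    (γ.map Prod.swap).withDensity (fun q => ENNReal.ofReal (N (q.1 - q.2))) =
      (γ.withDensity fun q => ENNReal.ofReal (N (q.1 - q.2))).map Prod.swap := by
  have hNm : Measurable fun q : 𝔼[d] × 𝔼[d] => ENNReal.ofReal (N (q.1 - q.2)) :=
    ((continuous_seminorm N).comp (by fun_prop)).measurable.ennreal_ofReal
  ext S hS
  rw [withDensity_apply _ hS, Measure.map_apply measurable_swap hS,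
    withDensity_apply _ (measurable_swap hS), Measure.restrict_map measurable_swap hS,
    lintegral_map hNm measurable_swap]
  refine lintegral_congr fun q => ?_
  rw [Prod.fst_swap, Prod.snd_swap, map_sub_rev]

/-- The second half of the transport density of a plan is the first half of the transport density
of the reversed plan. -/
theorem planDensity_eq_add [SFinite γ] :
    planDensity N γ =
      ((γ.withDensity fun q => ENNReal.ofReal (N (q.1 - q.2))).prod
        ((volume : Measure ℝ).restrict (Icc 0 (1 / 2)))).map interp +
      (((γ.map Prod.swap).withDensity fun q => ENNReal.ofReal (N (q.1 - q.2))).prod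
        ((volume : Measure ℝ).restrict (Icc 0 (1 / 2)))).map interp := by
  have hsplit : (volume : Measure ℝ).restrict (Icc 0 1) =
      (volume : Measure ℝ).restrict (Icc 0 (1 / 2)) +
        ((volume : Measure ℝ).restrict (Icc 0 (1 / 2))).map fun t => 1 - t := by
    have h1 : ((volume : Measure ℝ).restrict (Icc 0 (1 / 2))).map (fun t => 1 - t) =
        (volume : Measure ℝ).restrict (Icc (1 / 2) 1) := by
      have hpre : Icc (0 : ℝ) (1 / 2) = (fun t => 1 - t) ⁻¹' Icc (1 / 2) 1 := by
        ext t
        simp only [mem_Icc, mem_preimage]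
        constructor <;> rintro ⟨h1, h2⟩ <;> constructor <;> linarith
      have hmp := Measure.measurePreserving_sub_left (volume : Measure ℝ) 1
      rw [hpre, ← Measure.restrict_map (by fun_prop) measurableSet_Icc, hmp.map_eq]
    have h2 : Icc (0 : ℝ) 1 = Icc 0 (1 / 2) ∪ Icc (1 / 2) 1 :=
      (Icc_union_Icc_eq_Icc (by norm_num) (by norm_num)).symm
    rw [h1, h2]
    refine Measure.restrict_union₀ ?_ measurableSet_Icc.nullMeasurableSet
    refine measure_mono_null (t := {(1 / 2 : ℝ)}) ?_ (by simp)
    rintro t ⟨h3, h4⟩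
    exact le_antisymm h3.2 h4.1
  have hmap : (γ.withDensity fun q => ENNReal.ofReal (N (q.1 - q.2))).prod
      (((volume : Measure ℝ).restrict (Icc 0 (1 / 2))).map fun t => 1 - t) =
      ((γ.withDensity fun q => ENNReal.ofReal (N (q.1 - q.2))).prod
        ((volume : Measure ℝ).restrict (Icc 0 (1 / 2)))).map (Prod.map id fun t => 1 - t) := by
    rw [← Measure.map_prod_map _ _ measurable_id (by fun_prop), Measure.map_id]
  have hswap : (((γ.map Prod.swap).withDensity fun q => ENNReal.ofReal (N (q.1 - q.2))).prod
        ((volume : Measure ℝ).restrict (Icc 0 (1 / 2)))) =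
      ((γ.withDensity fun q => ENNReal.ofReal (N (q.1 - q.2))).prod
        ((volume : Measure ℝ).restrict (Icc 0 (1 / 2)))).map (Prod.map Prod.swap id) := by
    rw [map_swap_withDensity_cost, ← Measure.map_prod_map _ _ measurable_swap measurable_id,
      Measure.map_id]
  have him : Measurable (interp (d := d)) := continuous_interp.measurable
  have hm1 : Measurable (Prod.map id (fun t => 1 - t) :
      (𝔼[d] × 𝔼[d]) × ℝ → (𝔼[d] × 𝔼[d]) × ℝ) := measurable_id.prodMap (by fun_prop)
  have hm2 : Measurable (Prod.map Prod.swap id : (𝔼[d] × 𝔼[d]) × ℝ → (𝔼[d] × 𝔼[d]) × ℝ) :=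
    measurable_swap.prodMap measurable_id
  have hcomp : (interp (d := d)) ∘ Prod.map id (fun t => 1 - t) =
      interp ∘ Prod.map Prod.swap id := by
    funext z
    simp only [Function.comp_apply, interp, Prod.map_fst, Prod.map_snd, id_eq, Prod.fst_swap,
      Prod.snd_swap, sub_sub_cancel]
    exact add_comm _ _
  change Measure.map interp _ = _
  rw [hsplit, Measure.prod_add, Measure.map_add _ _ him, hmap, hswap, Measure.map_map him hm1,
    Measure.map_map him hm2, hcomp]

end Halves

/-! ### `L^p` densities of measures -/

section MemLp

variable {X : Type*} [MeasurableSpace X] {p : ℝ≥0∞} {m μ ν : Measure X}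

theorem MeasureMemLp.exists_measurable (hp1 : 1 ≤ p) (hp2 : p ≤ 2) (h : MeasureMemLp p m μ) :
    ∃ g : X → ℝ, Measurable g ∧
      μ = m.withDensity (fun x => ENNReal.ofReal (g x)) ∧
      ∫⁻ x, ENNReal.ofReal (g x) ^ p.toReal ∂m < ∞ := by
  obtain ⟨g, hg0, hg, hμ⟩ := h
  have hp0 : p ≠ 0 := (zero_lt_one.trans_le hp1).ne'
  have hpt : p ≠ ∞ := ne_top_of_le_ne_top ENNReal.ofNat_ne_top hp2
  have hae := hg.aestronglyMeasurable.ae_eq_mk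
  set g' := hg.aestronglyMeasurable.mk g with hg'
  have hg'm : Measurable g' := hg.aestronglyMeasurable.stronglyMeasurable_mk.measurable
  have hae' : ∀ᵐ x ∂m, ENNReal.ofReal (g x) = ENNReal.ofReal (max (g' x) 0) := by
    filter_upwards [hae] with x hx
    rw [hx, ENNReal.ofReal_max, ENNReal.ofReal_zero, max_eq_left zero_le]
  refine ⟨fun x => max (g' x) 0, hg'm.max measurable_const,
    hμ.trans (withDensity_congr_ae hae'), ?_⟩
  refine lt_of_eq_of_lt (lintegral_congr_ae ?_)
    (lintegral_rpow_enorm_lt_top_of_eLpNorm_lt_top hp0 hpt hg.eLpNorm_lt_top)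
  filter_upwards [hae'] with x hx
  rw [← hx, Real.enorm_eq_ofReal (hg0 x)]

theorem measureMemLp_withDensity (hp1 : 1 ≤ p) (hp2 : p ≤ 2) {s : X → ℝ≥0∞}
    (hs : Measurable s) (hint : ∫⁻ x, s x ^ p.toReal ∂m < ∞) :
    MeasureMemLp p m (m.withDensity s) := by
  have hp0 : p ≠ 0 := (zero_lt_one.trans_le hp1).ne'
  have hpt : p ≠ ∞ := ne_top_of_le_ne_top ENNReal.ofNat_ne_top hp2
  have hpos : 0 < p.toReal := ENNReal.toReal_pos hp0 hpt
  have hfin : ∀ᵐ x ∂m, ENNReal.ofReal (s x).toReal = s x := by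
    filter_upwards [ae_lt_top (hs.pow_const _) hint.ne] with x hx
    refine ENNReal.ofReal_toReal fun h => ?_
    rw [h, ENNReal.top_rpow_of_pos hpos] at hx
    exact lt_irrefl _ hx
  refine ⟨fun x => (s x).toReal, fun x => ENNReal.toReal_nonneg,
    ⟨hs.ennreal_toReal.aestronglyMeasurable, ?_⟩, (withDensity_congr_ae hfin).symm⟩
  rw [eLpNorm_lt_top_iff_lintegral_rpow_enorm_lt_top hp0 hpt]
  refine lt_of_eq_of_lt (lintegral_congr_ae ?_) hint
  filter_upwards [hfin] with x hx
  rw [Real.enorm_eq_ofReal ENNReal.toReal_nonneg, hx]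

theorem MeasureMemLp.add (hμ : MeasureMemLp p m μ) (hν : MeasureMemLp p m ν) :
    MeasureMemLp p m (μ + ν) := by
  obtain ⟨g, hg0, hg, rfl⟩ := hμ
  obtain ⟨h, hh0, hh, rfl⟩ := hν
  refine ⟨g + h, fun x => add_nonneg (hg0 x) (hh0 x), hg.add hh, ?_⟩
  ext S hS
  rw [Measure.add_apply, withDensity_apply _ hS, withDensity_apply _ hS, withDensity_apply _ hS,
    ← lintegral_add_left' hg.aestronglyMeasurable.aemeasurable.ennreal_ofReal.restrict]
  exact lintegral_congr fun x => (ENNReal.ofReal_add (hg0 x) (hh0 x)).symm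

theorem MeasureMemLp.restrict (hμ : MeasureMemLp p m μ) {S : Set X} (hS : MeasurableSet S) :
    MeasureMemLp p (m.restrict S) (μ.restrict S) := by
  obtain ⟨g, hg0, hg, rfl⟩ := hμ
  exact ⟨g, hg0, hg.restrict S, restrict_withDensity hS _⟩

end MemLp

/-! ### Summability of the transport density, and its uniqueness -/

section Conclusion

variable {Ω : Set 𝔼[d]} {a : 𝔼[d]} {N : Seminorm ℝ 𝔼[d]} {u : 𝔼[d] → ℝ} {f₁ f₂ : Measure 𝔼[d]}
  {γ : Measure (𝔼[d] × 𝔼[d])} {p : ℝ≥0∞}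

theorem absolutelyContinuous_boundaryMeasure (h : MeasureMemLp p (boundaryMeasure Ω) f₁) :
    f₁ ≪ boundaryMeasure Ω := by
  obtain ⟨g, -, -, rfl⟩ := h
  exact withDensity_absolutelyContinuous _ _

theorem ae_mem_frontier (h : MeasureMemLp p (boundaryMeasure Ω) f₁) :
    ∀ᵐ x ∂f₁, x ∈ frontier Ω :=
  (absolutelyContinuous_boundaryMeasure h).ae_le
    (ae_restrict_mem isClosed_frontier.measurableSet)

theorem absolutelyContinuous_coneMeasure (hd : 1 ≤ d) (hΩ : IsUniformlyConvexDomain Ω)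
    (ha : a ∈ interior Ω) (h : MeasureMemLp p (boundaryMeasure Ω) f₁) :
    f₁ ≪ coneMeasure Ω a := by
  obtain ⟨C, -, hC⟩ := boundaryMeasure_le_coneMeasure hd hΩ ha
  exact (absolutelyContinuous_boundaryMeasure h).trans
    (hC.absolutelyContinuous.trans Measure.smul_absolutelyContinuous)

/-- The transport density is concentrated on the convex set `Ω`. -/
theorem planDensity_restrict_eq (hΩ : IsUniformlyConvexDomain Ω) [IsFiniteMeasure f₁]
    (hf₁ : ∀ᵐ x ∂f₁, x ∈ frontier Ω) (hf₂ : ∀ᵐ x ∂f₂, x ∈ frontier Ω)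
    (h : IsTransportPlan f₁ f₂ γ) : (planDensity N γ).restrict Ω = planDensity N γ := by
  have := isFiniteMeasure_of_isTransportPlan h
  have hΩm : MeasurableSet Ω := hΩ.isCompact.isClosed.measurableSet
  have him : Measurable (interp (d := d)) := continuous_interp.measurable
  have hq : ∀ᵐ q ∂γ, q ∈ frontier Ω ×ˢ frontier Ω :=
    ae_mem_prod_of_isTransportPlan h isClosed_frontier.measurableSet hf₁ hf₂
  set γN := γ.withDensity fun q => ENNReal.ofReal (N (q.1 - q.2)) with hγN
  set τ := (volume : Measure ℝ).restrict (Icc 0 1) with hτ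
  have hq' : ∀ᵐ q ∂γN, q ∈ frontier Ω ×ˢ frontier Ω :=
    (withDensity_absolutelyContinuous _ _).ae_le hq
  have ht : ∀ᵐ t ∂τ, t ∈ Icc (0 : ℝ) 1 := ae_restrict_mem measurableSet_Icc
  have hz : ∀ᵐ z ∂(γN.prod τ), interp z ∈ Ω := by
    filter_upwards [Measure.quasiMeasurePreserving_fst (μ := γN) (ν := τ) |>.ae hq',
      Measure.quasiMeasurePreserving_snd (μ := γN) (ν := τ) |>.ae ht] with z h1 h2
    exact hΩ.convex (frontier_subset_domain hΩ h1.1) (frontier_subset_domain hΩ h1.2)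
      (by linarith [h2.2]) h2.1 (by ring)
  have hmem : ∀ᵐ x ∂(planDensity N γ), x ∈ Ω := by
    change ∀ᵐ x ∂((γN.prod τ).map interp), x ∈ Ω
    rw [ae_map_iff (p := fun x => x ∈ Ω) him.aemeasurable hΩm]
    exact hz
  exact Measure.restrict_eq_self_of_ae_mem hmem

theorem measureMemLp_planDensity (hd : 2 ≤ d) (hΩ : IsUniformlyConvexDomain Ω)
    (hN : IsStrictlyConvexNorm N) (hp1 : 1 ≤ p) (hp2 : p ≤ 2) [IsFiniteMeasure f₁]
    [IsFiniteMeasure f₂] (hf₁ : MeasureMemLp p (boundaryMeasure Ω) f₁)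
    (hf₂ : MeasureMemLp p (boundaryMeasure Ω) f₂) (hu : IsPotential N u)
    (h : IsTransportPlan f₁ f₂ γ) (hc : γ (contactSet N u)ᶜ = 0) :
    MeasureMemLp p (volume.restrict Ω) (planDensity N γ) := by
  have hfin := isFiniteMeasure_of_isTransportPlan h
  have hpt : p ≠ ∞ := ne_top_of_le_ne_top ENNReal.ofNat_ne_top hp2
  have hr1 : 1 ≤ p.toReal := by
    rw [← ENNReal.toReal_one]; exact ENNReal.toReal_mono hpt hp1
  have hr2 : p.toReal ≤ 2 := by
    rw [← ENNReal.toReal_ofNat 2]; exact ENNReal.toReal_mono ENNReal.ofNat_ne_top hp2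
  have half : ∀ {f₁ f₂ : Measure 𝔼[d]} {γ : Measure (𝔼[d] × 𝔼[d])}
      {u : 𝔼[d] → ℝ}, IsFiniteMeasure γ →
      IsTransportPlan f₁ f₂ γ → IsPotential N u → γ (contactSet N u)ᶜ = 0 →
      MeasureMemLp p (boundaryMeasure Ω) f₁ → MeasureMemLp p (boundaryMeasure Ω) f₂ →
      MeasureMemLp p volume (((γ.withDensity fun q => ENNReal.ofReal (N (q.1 - q.2))).prod
        ((volume : Measure ℝ).restrict (Icc 0 (1 / 2)))).map interp) := by
    intro f₁ f₂ γ u _ h hu hc hf₁ hf₂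
    obtain ⟨g, hg, hfg, hgr⟩ := MeasureMemLp.exists_measurable hp1 hp2 hf₁
    have hγ2 : ∀ᵐ q ∂γ, q.2 ∈ frontier Ω := by
      have := ae_mem_frontier hf₂
      rw [← h.map_snd] at this
      exact ae_of_ae_map measurable_snd.aemeasurable this
    obtain ⟨s, hs, hSs, hsr⟩ := exists_density_half hd hΩ hN hu hg (h.map_fst.trans hfg) hγ2
      hc hr1 hr2 hgr
    rw [hSs]
    exact measureMemLp_withDensity hp1 hp2 hs hsr
  rw [← planDensity_restrict_eq hΩ (ae_mem_frontier hf₁) (ae_mem_frontier hf₂) h,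
    planDensity_eq_add]
  exact MeasureMemLp.restrict (MeasureMemLp.add (half hfin h hu hc hf₁ hf₂)
    (half inferInstance (isTransportPlan_swap h) hu.neg (map_swap_contactSet hu hc) hf₂ hf₁))
    hΩ.isCompact.isClosed.measurableSet

end Conclusion

end TransportDensity

theorem mainTheorem2 {d : ℕ} (Ω : Set (EuclideanSpace ℝ (Fin d)))
    (hΩ : IsUniformlyConvexDomain Ω)
    (N : Seminorm ℝ (EuclideanSpace ℝ (Fin d))) (hN : IsStrictlyConvexNorm N)
    (hUA : d = 2 ∨ (2 ≤ d ∧ ∀ x, N x = ‖x‖))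
    (p : ENNReal) (hp1 : 1 ≤ p) (hp2 : p ≤ 2)
    (f₁ f₂ : Measure (EuclideanSpace ℝ (Fin d))) [IsFiniteMeasure f₁] [IsFiniteMeasure f₂]
    (hmass : f₁ univ = f₂ univ)
    (hf₁ : MeasureMemLp p (boundaryMeasure Ω) f₁)
    (hf₂ : MeasureMemLp p (boundaryMeasure Ω) f₂) :
    (∃! σ, IsTransportDensity N f₁ f₂ σ) ∧
      ∀ σ, IsTransportDensity N f₁ f₂ σ → MeasureMemLp p (volume.restrict Ω) σ := by
  open TransportDensity in
  have hd : 2 ≤ d := by rcases hUA with h | h <;> omega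
  have hd1 : 1 ≤ d := by omega
  obtain ⟨a, ha⟩ := hΩ.nonempty_interior
  have hκ := absolutelyContinuous_coneMeasure hd1 hΩ ha hf₁
  have hF₁ := ae_mem_frontier hf₁
  have hF₂ := ae_mem_frontier hf₂
  obtain ⟨u, γ, -, -, hu, hplan, hc, -, -⟩ := exists_plan_limit hd hΩ ha hN hmass hκ hF₂
  have hopt := isOptimalPlan_of_contactSet hu hΩ hF₁ hF₂ hplan hc
  have hcontact : ∀ γ', IsOptimalPlan N f₁ f₂ γ' → γ' (contactSet N u)ᶜ = 0 := fun γ' h =>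
    contactSet_of_isOptimalPlan hu hΩ hF₁ hF₂ hplan hc h
  refine ⟨⟨planDensity N γ, ⟨γ, hopt, rfl⟩, ?_⟩, ?_⟩
  · rintro _ ⟨γ', h', rfl⟩
    exact planDensity_eq_of_restrict_offDiag_eq (restrict_offDiag_eq hd1 hΩ ha hN hu hκ hF₂
      h'.isTransportPlan (hcontact γ' h') hplan hc)
  · rintro _ ⟨γ', h', rfl⟩
    exact measureMemLp_planDensity hd hΩ hN hp1 hp2 hf₁ hf₂ hu h'.isTransportPlan (hcontact γ' h')
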